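/- **Setting.** Let $\mathcal S,\mathcal A$ be finite nonempty sets of sizes $S,A$, let $M,H,K\ge 1$, and let $\mathcal X=\{1,\dots,M+1\}$. A logistic DCMDP has rewards $r_h(s,a,x)\in[0,1]$, transition probabilities $P_h(\cdot\mid s,a,x)$ on $\mathcal S$ ($h=1,\dots,H$), a discount $\alpha\in[0,1]$, and latent features $f^*_t(s,a,x)\in\mathbb R^M$ ($1\le t\le H$) and $f^*_0(\emptyset)\in\mathbb R^M$, where $(s_0,a_0,x_0)=\emptyset$. The triple $(s,a,x)$ at time $t$, or $\emptyset$ at time $0$, is called a coordinate. For a history $\tau_h=(s_1,a_1,x_1,\dots,s_{h-1},a_{h-1},x_{h-1})$ put $\sigma(\tau_h;f)=\sum_{t=0}^{h-1}\alpha^{h-t-1}f_t(s_t,a_t,x_t)$. Let $H_\alpha=\sum_{j=0}^{2H-1}\alpha^j$, $\eta=H_\alpha^{-1/2}$, $z_i(u)=e^{\eta u_i}/(1+\sum_{m\le M}e^{\eta u_m})$ for $i\le M$ and $z_{M+1}=1-\sum_{i\le M}z_i$. At step $h$ the agent sees $\tau_h$ and $s_h$ and picks $a_h$; then $x_h\sim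 z(\sigma(\tau_h;f^*))$, the reward $r_h(s_h,a_h,x_h)$ is received, and $s_{h+1}\sim P_h(\cdot\mid s_h,a_h,x_h)$. Let $V_1^\pi(s)$ be the expected total reward of an episode from $s_1=s$ under a history-dependent policy $\pi$, and $V_1^*=\sup_\pi V_1^\pi$. Let $1/\kappa$ be the minimum over $h\le H$ and all $\tau_h$ of $\lambda_{\min}(\mathrm{diag}(z)-zz^{T})$, where $z$ is the vector of the first $M$ entries of $z(\sigma(\tau_h;f^*))$. Known bounds $b$ satisfy $|f^*|\le b$ entrywise and $\|b\|_2\le L$; let $\mathcal F=\{f:|f|\le b\text{ entrywise}\}$. **Algorithm (Tractable LDC-UCB)**, with parameters $\lambda>0$ and $\delta\in(0,1)$. The initial states $s_1^k$ are arbitrary and may depend, also randomly, on the previous episodes. In episode $k$: 1. From episodes $1,\dots,k-1$ compute the visit counts $n^k_h(s,a,x)$ (with $n^k_0(\emptyset)=k-1$), the empirical rewards $\hat r^k$ and empirical transitions $\hat P^k$ (zero if there are no visits), and $$\hat f^k\in\arg\max_{f\in\mathcal F}\ \sum_{k'<k}\sum_{h=1}^{H}\log z_{x_h^{k'}}\big(\sigma(\tau_h^{k'};f)\big)-\lambda\|f\|_2^2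 .$$ 2. Put $\bar r^k=\hat r^k+\min\{\sqrt{\iota/(n\vee1)},1\}+\min\{H\sqrt{4S\iota/(n\vee1)},2H\}$ with $\iota=\log(8SAMHK/\delta)$ and $n=n_h^k(s,a,x)$. The confidence interval $[l,u]$ of each of the $M$ entries at a coordinate with $n$ visits is $\hat f^k\pm 2\gamma_k(\delta/4)\sqrt{\kappa H_\alpha}/\sqrt{n+4\lambda H_\alpha}$, where $$\gamma_k(\delta)=\big(2+2L+\sqrt{2(1+L)}\big)\beta_k(\delta)+\sqrt{2(1+L)HM/\lambda}\;\beta_k(\delta)^2,$$ $$\beta_k(\delta)=\tfrac{M^{3/2}(M+1)SAH}{\sqrt\lambda}\Big(\log\big(1+\tfrac{k}{(M+1)SA\lambda}\big)+2\log\tfrac2\delta\Big)+\sqrt{\tfrac{\lambda}{4M}}+\sqrt\lambda L .$$ 3. Plan optimistically. On pairs of a state $s$ and a cuboid $I\subset\mathbb R^M$ (an interval for $\sigma$) let $\bar V_{H+1}=0$, $$\bar Q_{i,h}(s,a,I)=\bar r^k_h(s,a,i)+\sum_{s'}\hat P^k_h(s'\mid s,a,i)\,\bar V_{h+1}\big(s',\alpha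 I+[l_h(s,a,i),u_h(s,a,i)]\big),$$ $$\bar V_h(s,I)=\min\Big\{H,\ \max_{a}\max_{t}\sum_{i=1}^{M+1}z_i\big(\mathrm{thr}_t(\bar Q_h,I)\big)\bar Q_{i,h}(s,a,I)\Big\}.$$ Here $t$ ranges over the $M$ midpoints of consecutive elements of $\bar Q_{1,h},\dots,\bar Q_{M+1,h}$ in ascending order, and for $i\le M$ the vector $\mathrm{thr}_t(Q,I)$ has as $i$-th entry the lower end of $I$ if $Q_i<t$ and the upper end otherwise. Play a policy $\bar\pi^k$ which at $(s,\tau_h)$ takes an action $a$ attaining this maximum at $I=[\sigma(\tau_h;l),\sigma(\tau_h;u)]$. All ties are broken arbitrarily. **Theorem.** For all constants $c_0>0$ and $0<c_1\le c_2$ there are $C>0$ and $p\in\mathbb N$, depending only on $c_0,c_1,c_2$, such that in the above setting, if $L\ge c_0$ and $$c_1\,\frac{HM^{2.5}SA}{L}\le\lambda\le c_2\,\frac{HM^{2.5}SA}{L},$$ then with probability at least $1-\delta$ the regret of Tractable LDC-UCB satisfies $$\sum_{k=1}^K\Big(V_1^*(s_1^k)-V_1^{\bar\pi^k}(s_1^k)\Big)\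 \le\ C\,\sqrt{H^8M^{6.5}S^2A^2L^4\kappa K}\;\Big(\log\big(3+SAMHKL/\delta\big)\Big)^p .$$ -/

import Mathlib

open scoped BigOperators

noncomputable section

namespace LogDCMDP

universe u v

/-! Time is indexed from `0`: an index `h : Fin H` is the time step `h + 1` of an episode.
The context space is `Fin (M + 1)`; `Fin.last M` is the reference context number `M + 1`. -/

/-- A state-action-context triple. -/
abbrev Triple (S : Type u) (A : Type v) (M : ℕ) := S × A × Fin (M + 1)

/-- The arguments of a latent feature map. `none` is the empty triple of time zero, which precedes
every history, and `some (h, s, a, x)` is the triple `(s, a, x)` at time step `h + 1`. -/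
abbrev Coord (S : Type u) (A : Type v) (M H : ℕ) := Option (Fin H × Triple S A M)

/-- Latent feature maps, with values in `ℝ ^ M`. -/
abbrev Feature (S : Type u) (A : Type v) (M H : ℕ) := Coord S A M H → Fin M → ℝ

/-- The triples of an episode, followed by the state in which the episode ends. -/
abbrev Episode (S : Type u) (A : Type v) (M H : ℕ) := (Fin H → Triple S A M) × S

/-- History dependent randomized policies. A history available at index `h` is a function
`Fin h → Triple S A M`. -/
abbrev Policy (S : Type u) (A : Type v) (M H : ℕ) :=
  (h : Fin H) → (Fin h → Triple S A M) → S → PMF A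

/-! ### Softmax and the sufficient statistic -/

/-- The softmax with temperature `η`; the last context has the remaining probability. -/
def softmax {M : ℕ} (η : ℝ) (w : Fin M → ℝ) : Fin (M + 1) → ℝ :=
  Fin.snoc (α := fun _ => ℝ)
    (fun i => Real.exp (η * w i) / (1 + ∑ m, Real.exp (η * w m)))
    (1 - ∑ i, Real.exp (η * w i) / (1 + ∑ m, Real.exp (η * w m)))

lemma softmax_castSucc {M : ℕ} (η : ℝ) (w : Fin M → ℝ) (i : Fin M) :
    softmax η w i.castSucc = Real.exp (η * w i) / (1 + ∑ m, Real.exp (η * w m)) := by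
  simp [softmax]

lemma softmax_last {M : ℕ} (η : ℝ) (w : Fin M → ℝ) :
    softmax η w (Fin.last M) = 1 / (1 + ∑ m, Real.exp (η * w m)) := by
  have h : (0 : ℝ) < 1 + ∑ m, Real.exp (η * w m) := by positivity
  simp only [softmax, Fin.snoc_last, ← Finset.sum_div]
  field_simp
  ring

lemma softmax_nonneg {M : ℕ} (η : ℝ) (w : Fin M → ℝ) (i : Fin (M + 1)) :
    0 ≤ softmax η w i := by
  induction i using Fin.lastCases with
  | last => rw [softmax_last]; positivity
  | cast i => rw [softmax_castSucc]; positivity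

lemma sum_softmax {M : ℕ} (η : ℝ) (w : Fin M → ℝ) : ∑ i, softmax η w i = 1 := by
  simp [Fin.sum_univ_castSucc, softmax]

/-- The softmax as a probability distribution on the contexts. -/
def softmaxPMF {M : ℕ} (η : ℝ) (w : Fin M → ℝ) : PMF (Fin (M + 1)) :=
  PMF.ofFintype (fun i => ENNReal.ofReal (softmax η w i)) (by
    rw [← ENNReal.ofReal_sum_of_nonneg fun i _ => softmax_nonneg η w i, sum_softmax,
      ENNReal.ofReal_one])

/-- The effective history horizon `(α ^ (2 H) - 1) / (α - 1)`, read as `2 H` for `α = 1`. -/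
def effHorizon (α : ℝ) (H : ℕ) : ℝ := ∑ j ∈ Finset.range (2 * H), α ^ j

/-- The temperature of the softmax, the inverse square root of the effective horizon. -/
def temp (α : ℝ) (H : ℕ) : ℝ := 1 / √(effHorizon α H)

section Model

variable {S : Type u} {A : Type v} {M H : ℕ}

/-- The sufficient statistic: the discounted sum of the features along the history, including the
feature of the empty triple of time zero. -/
def suffStat (α : ℝ) (f : Feature S A M H) (h : Fin H) (τ : Fin h → Triple S A M) : Fin M → ℝ :=
  fun i => α ^ (h : ℕ) * f none i +
    ∑ t : Fin h, α ^ ((h : ℕ) - 1 - t) * f (some (⟨t, t.2.trans h.2⟩, τ t)) i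

end Model

/-- A logistic dynamic contextual MDP with rewards `r` in `[0, 1]`, transitions `P`,
history discount factor `α` and latent feature maps `f`. -/
structure Model (S : Type u) (A : Type v) (M H : ℕ) where
  r : Fin H → S → A → Fin (M + 1) → ℝ
  r_nonneg : ∀ h s a x, 0 ≤ r h s a x
  r_le_one : ∀ h s a x, r h s a x ≤ 1
  P : Fin H → S → A → Fin (M + 1) → PMF S
  α : ℝ
  α_nonneg : 0 ≤ α
  α_le_one : α ≤ 1
  f : Feature S A M H

section Values

variable {S : Type u} {A : Type v} {M H : ℕ}

/-- The conditional law of the next context given the history. -/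
def Model.ctxLaw (m : Model S A M H) (h : Fin H) (τ : Fin h → Triple S A M) : PMF (Fin (M + 1)) :=
  softmaxPMF (temp m.α H) (suffStat m.α m.f h τ)

/-- The joint law of the first `h` triples of an episode and of the state that follows them,
when the episode starts in `s₀` and `π` is played. -/
def Model.prefixLaw (m : Model S A M H) (π : Policy S A M H) (s₀ : S) :
    (h : ℕ) → h ≤ H → PMF ((Fin h → Triple S A M) × S)
  | 0, _ => PMF.pure (fun i => i.elim0, s₀)
  | h + 1, hh =>
      (m.prefixLaw π s₀ h (Nat.le_of_succ_le hh)).bind fun p =>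
      (π ⟨h, hh⟩ p.1 p.2).bind fun a =>
      (m.ctxLaw ⟨h, hh⟩ p.1).bind fun x =>
      (m.P ⟨h, hh⟩ p.2 a x).bind fun s' =>
      PMF.pure (Fin.snoc (α := fun _ => Triple S A M) p.1 (p.2, a, x), s')

/-- The law of an episode that starts in `s₀`. -/
def Model.episodeLaw (m : Model S A M H) (π : Policy S A M H) (s₀ : S) : PMF (Episode S A M H) :=
  m.prefixLaw π s₀ H le_rfl

/-- The sum of the rewards of an episode. -/
def Model.totalReward (m : Model S A M H) (e : Episode S A M H) : ℝ :=
  ∑ h, m.r h (e.1 h).1 (e.1 h).2.1 (e.1 h).2.2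

/-- The value of a policy at the first time step: its expected total reward. -/
def Model.value [Fintype S] [Fintype A] (m : Model S A M H) (π : Policy S A M H) (s₀ : S) : ℝ :=
  ∑ e : Episode S A M H, (m.episodeLaw π s₀ e).toReal * m.totalReward e

/-- The optimal value over all history dependent policies. -/
def Model.optimalValue [Fintype S] [Fintype A] (m : Model S A M H) (s₀ : S) : ℝ :=
  ⨆ π : Policy S A M H, m.value π s₀

/-- The `M × M` matrix `diag z - z zᵀ`, where `z` consists of the first `M` softmax values. -/
def gradMatrix (η : ℝ) (w : Fin M → ℝ) : Matrix (Fin M) (Fin M) ℝ :=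
  Matrix.diagonal (fun i => softmax η w i.castSucc) -
    Matrix.vecMulVec (fun i => softmax η w i.castSucc) (fun i => softmax η w i.castSucc)

/-- The problem dependent constant `κ`, the inverse of the least eigenvalue of `gradMatrix`
over all histories. -/
def Model.kappa (m : Model S A M H) : ℝ :=
  (⨅ p : (h : Fin H) × (Fin h → Triple S A M),
    sInf (spectrum ℝ (gradMatrix (temp m.α H) (suffStat m.α m.f p.1 p.2))))⁻¹

/-- The state at index `h` of an episode; the final state for `h = H`. -/
def Episode.state (e : Episode S A M H) (h : ℕ) : S :=
  if hh : h < H then (e.1 ⟨h, hh⟩).1 else e.2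

/-- The history of an episode that is available at index `h`. -/
def Episode.hist (e : Episode S A M H) (h : Fin H) : Fin h → Triple S A M :=
  fun t => e.1 ⟨t, t.2.trans h.2⟩

end Values

/-! ### Threshold optimistic planning -/

section Planning

variable {S : Type u} {A : Type v} {M H : ℕ}

/-- The threshold vector of the cuboid `[I.1, I.2]`. The reference context has no coordinate. -/
def thr (t : ℝ) (Q : Fin (M + 1) → ℝ) (I : (Fin M → ℝ) × (Fin M → ℝ)) : Fin M → ℝ :=
  fun i => if Q i.castSucc < t then I.1 i else I.2 i

/-- The `j`-th element of the threshold set of `Q`: the midpoint of the `j`-th and the `(j+1)`-st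
of the values of `Q` in ascending order. -/
def thrPoint (Q : Fin (M + 1) → ℝ) (j : Fin M) : ℝ :=
  (Q (Tuple.sort Q j.castSucc) + Q (Tuple.sort Q j.succ)) / 2

/-- The maximum over the threshold set of the expectation of `Q` under the softmax. -/
def thrMax (η : ℝ) (Q : Fin (M + 1) → ℝ) (I : (Fin M → ℝ) × (Fin M → ℝ)) : ℝ :=
  ⨆ j : Fin M, ∑ i, softmax η (thr (thrPoint Q j) Q I) i * Q i

/-- The input of the planner: optimistic rewards, estimated transitions, and the lower and upper
ends of the confidence intervals of the features. -/
structure PlanInput (S : Type u) (A : Type v) (M H : ℕ) where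
  rbar : Fin H → S → A → Fin (M + 1) → ℝ
  phat : Fin H → S → A → Fin (M + 1) → S → ℝ
  lo : Feature S A M H
  up : Feature S A M H

/-- The confidence interval of the sufficient statistic after the triple at `c`: the interval `I`
is discounted and the interval of the feature at `c` is added. -/
def PlanInput.next (p : PlanInput S A M H) (α : ℝ) (c : Coord S A M H)
    (I : (Fin M → ℝ) × (Fin M → ℝ)) : (Fin M → ℝ) × (Fin M → ℝ) :=
  (fun i => α * I.1 i + p.lo c i, fun i => α * I.2 i + p.up c i)

/-- The optimistic state-action values, given the optimistic value `V` of the next step. -/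
def PlanInput.qBar [Fintype S] (p : PlanInput S A M H) (α : ℝ)
    (V : S → (Fin M → ℝ) × (Fin M → ℝ) → ℝ) (h : Fin H) (s : S) (a : A)
    (I : (Fin M → ℝ) × (Fin M → ℝ)) (i : Fin (M + 1)) : ℝ :=
  p.rbar h s a i + ∑ s', p.phat h s a i s' * V s' (p.next α (some (h, s, a, i)) I)

/-- The truncated optimistic value, on states augmented by a confidence interval of the sufficient
statistic, by backward recursion from the value zero after the last step. -/
def PlanInput.vBar [Fintype S] (p : PlanInput S A M H) (α : ℝ) (h : ℕ) (s : S)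
    (I : (Fin M → ℝ) × (Fin M → ℝ)) : ℝ :=
  if hh : h < H then
    min (⨆ a : A, thrMax (temp α H)
      (p.qBar α (fun s' J => p.vBar α (h + 1) s' J) ⟨h, hh⟩ s a I) I) H
  else 0
termination_by H - h

/-- The confidence interval of the sufficient statistic along a history. -/
def PlanInput.ci (p : PlanInput S A M H) (α : ℝ) (h : Fin H) (τ : Fin h → Triple S A M) :
    (Fin M → ℝ) × (Fin M → ℝ) :=
  (suffStat α p.lo h τ, suffStat α p.up h τ)

/-- The quantity that the planned policy maximizes over the actions. -/
def PlanInput.score [Fintype S] (p : PlanInput S A M H) (α : ℝ) (h : Fin H)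
    (τ : Fin h → Triple S A M) (s : S) (a : A) : ℝ :=
  thrMax (temp α H) (p.qBar α (p.vBar α (h + 1)) h s a (p.ci α h τ)) (p.ci α h τ)

end Planning

/-! ### Estimates and bonuses -/

/-- The radius `β_k(δ)`, where `nS` and `nA` are the numbers of states and of actions. -/
def beta (nS nA M H : ℕ) (L lam δ : ℝ) (k : ℕ) : ℝ :=
  (M : ℝ) ^ (3 / 2 : ℝ) * (M + 1) * nS * nA * H / √lam *
      (Real.log (1 + k / ((M + 1) * nS * nA * lam)) + 2 * Real.log (2 / δ)) +
    √(lam / (4 * M)) + √lam * L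

/-- The radius `γ_k(δ)`. -/
def gamma (nS nA M H : ℕ) (L lam δ : ℝ) (k : ℕ) : ℝ :=
  (2 + 2 * L + √(2 * (1 + L))) * beta nS nA M H L lam δ k +
    √(2 * (1 + L) * H * M / lam) * beta nS nA M H L lam δ k ^ 2

section Learning

variable {S : Type u} {A : Type v} {M H : ℕ}

/-- The rectangular set of features with bounds `b`. -/
def rectSet (b : Feature S A M H) : Set (Feature S A M H) := {f | ∀ c i, |f c i| ≤ b c i}

/-- The Euclidean norm of a feature. -/
def l2norm [Fintype S] [Fintype A] (f : Feature S A M H) : ℝ := √(∑ c, ∑ i, f c i ^ 2)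

/-- The regularized log-likelihood of the contexts of the past episodes. -/
def logLik [Fintype S] [Fintype A] (α lam : ℝ) {k : ℕ} (past : Fin k → Episode S A M H)
    (f : Feature S A M H) : ℝ :=
  (∑ j, ∑ h, Real.log (softmax (temp α H) (suffStat α f h ((past j).hist h)) ((past j).1 h).2.2)) -
    lam * l2norm f ^ 2

variable [DecidableEq S] [DecidableEq A]

/-- The number of past episodes that visited a given triple at a given time. The empty triple of
time zero is visited once in every episode. -/
def visits {k : ℕ} (past : Fin k → Episode S A M H) : Coord S A M H → ℕ
  | none => k
  | some c => (Finset.univ.filter fun j => (past j).1 c.1 = c.2).card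

/-- The empirical rewards (zero without visits). -/
def rHat (m : Model S A M H) {k : ℕ} (past : Fin k → Episode S A M H) (h : Fin H) (s : S) (a : A)
    (x : Fin (M + 1)) : ℝ :=
  (∑ j, if (past j).1 h = (s, a, x)
    then m.r h ((past j).1 h).1 ((past j).1 h).2.1 ((past j).1 h).2.2 else 0) /
    visits past (some (h, s, a, x))

/-- The empirical transition probabilities (zero without visits). -/
def pHat {k : ℕ} (past : Fin k → Episode S A M H) (h : Fin H) (s : S) (a : A)
    (x : Fin (M + 1)) (s' : S) : ℝ :=
  (∑ j, if (past j).1 h = (s, a, x) ∧ (past j).state (h + 1) = s' then (1 : ℝ) else 0) /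
    visits past (some (h, s, a, x))

/-- The reward bonus after `n` visits. -/
def rewardBonus (nS nA M H K : ℕ) (δ : ℝ) (n : ℕ) : ℝ :=
  min (√(Real.log (8 * nS * nA * M * H * K / δ) / (max n 1 : ℕ))) 1

/-- The transition bonus after `n` visits. -/
def transBonus (nS nA M H K : ℕ) (δ : ℝ) (n : ℕ) : ℝ :=
  min (H * √(4 * nS * Real.log (8 * nS * nA * M * H * K / δ) / (max n 1 : ℕ))) (2 * H)

variable [Fintype S] [Fintype A]

/-- The half width of the local confidence interval of a feature after `n` visits, in episode
number `k`. -/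
def Model.featBonus (m : Model S A M H) (L lam δ : ℝ) (k n : ℕ) : ℝ :=
  2 * gamma (Fintype.card S) (Fintype.card A) M H L lam (δ / 4) k *
      √(m.kappa * effHorizon m.α H) / √(n + 4 * lam * effHorizon m.α H)

/-- The input that the planner receives after `k` past episodes (that is, in episode number
`k + 1`), when `fhat` is the current estimate of the features. -/
def Model.planInput (m : Model S A M H) (K : ℕ) (L lam δ : ℝ) {k : ℕ}
    (past : Fin k → Episode S A M H) (fhat : Feature S A M H) : PlanInput S A M H where
  rbar h s a x := rHat m past h s a x +
    (rewardBonus (Fintype.card S) (Fintype.card A) M H K δ (visits past (some (h, s, a, x))) +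
      transBonus (Fintype.card S) (Fintype.card A) M H K δ (visits past (some (h, s, a, x))))
  phat := pHat past
  lo c i := fhat c i - m.featBonus L lam δ (k + 1) (visits past c)
  up c i := fhat c i + m.featBonus L lam δ (k + 1) (visits past c)

/-- A learner selects a (history dependent, deterministic) policy for the next episode from the
past episodes. -/
abbrev Learner (S : Type u) (A : Type v) (M H : ℕ) :=
  (k : ℕ) → (Fin k → Episode S A M H) → (h : Fin H) → (Fin h → Triple S A M) → S → A

/-- `ℓ` is a run of the tractable algorithm: in every episode the feature estimate is a maximizer
of the regularized likelihood over the rectangular set, and the policy is greedy for the threshold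
optimistic planner. Ties may be broken arbitrarily. -/
def Model.IsTractableLDCUCB (m : Model S A M H) (K : ℕ) (L lam δ : ℝ) (b : Feature S A M H)
    (ℓ : Learner S A M H) : Prop :=
  ∃ fhat : (k : ℕ) → (Fin k → Episode S A M H) → Feature S A M H,
    ∀ (k : ℕ) (past : Fin k → Episode S A M H),
      fhat k past ∈ rectSet b ∧
      IsMaxOn (logLik m.α lam past) (rectSet b) (fhat k past) ∧
      ∀ (h : Fin H) (τ : Fin h → Triple S A M) (s : S) (a : A),
        (m.planInput K L lam δ past (fhat k past)).score m.α h τ s a ≤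
          (m.planInput K L lam δ past (fhat k past)).score m.α h τ s (ℓ k past h τ s)

end Learning

/-! ### Runs and regret -/

section Runs

variable {S : Type u} {A : Type v} {M H : ℕ}

/-- The policy that a learner plays after `k` past episodes. -/
def Learner.policy (ℓ : Learner S A M H) (k : ℕ) (past : Fin k → Episode S A M H) :
    Policy S A M H :=
  fun h τ s => PMF.pure (ℓ k past h τ s)

/-- The law of the first `k` episodes. The initial state of every episode is chosen by the
environment, possibly at random and possibly depending on the past episodes. -/
def Model.runLaw (m : Model S A M H)
    (init : (k : ℕ) → (Fin k → Episode S A M H) → PMF S) (ℓ : Learner S A M H) :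
    (k : ℕ) → PMF (Fin k → Episode S A M H)
  | 0 => PMF.pure fun i => i.elim0
  | k + 1 =>
      (m.runLaw init ℓ k).bind fun past =>
      (init k past).bind fun s₀ =>
      (m.episodeLaw (ℓ.policy k past) s₀).bind fun e =>
      PMF.pure (Fin.snoc (α := fun _ => Episode S A M H) past e)

/-- The regret of a learner on a realization `ω` of `K` episodes: the sum over the episodes of the
optimal value minus the value of the policy that is played, at the initial state. -/
def Model.regret [Fintype S] [Fintype A] (m : Model S A M H) (ℓ : Learner S A M H) {K : ℕ}
    (ω : Fin K → Episode S A M H) : ℝ :=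
  ∑ k : Fin K, (m.optimalValue ((ω k).state 0) -
    m.value (ℓ.policy k fun j : Fin k => ω ⟨j, j.2.trans k.2⟩) ((ω k).state 0))

end Runs

end LogDCMDP

end

open LogDCMDP

/-! The regret is controlled by optimism. Suppose that the empirical transitions are accurate and
that the confidence intervals contain the true features (`PlanInput.IsValid`). Then the optimistic
value dominates the value of every policy (`PlanInput.IsValid.value_le`), because some threshold
vector is at least as good as any point of the cuboid (`sum_softmax_mul_le_thrMax`). Conversely, the
greedy policy attains the optimistic value up to errors collected along its own trajectory in the
true model (`PlanInput.IsValid.vBar_le`). At each step the error consists of twice the bonus of the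
visited triple and the Lipschitz cost, under the softmax, of the width of the interval for the
sufficient statistic. `Model.prob_lt_sum_expect_le` replaces the expected errors by the observed
ones, and these decay like the inverse square root of the visit counts, so a pigeonhole sum gives
the rate `√K` (`Model.sum_planError_le`).

The heart is the confidence set. For a displacement `v`, the likelihood ratio of `f* + v` against
`f*` is a nonnegative martingale with mean one, whatever the policy. Mixing these martingales over
grids of all dyadic meshes and applying Ville's inequality controls the ratio at every grid point,
uniformly in time (`Model.prob_not_featAccurate_le`). Unbiased randomized rounding extends the
control to every `v` (`Model.FeatAccurate.pastLogRatio_le`): the logits are linear in `v`, so their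
mean is preserved, and the cumulant generating function costs `r ^ 2 / 2` per step at mesh `r`,
because the temperature makes the gradients of the logits have norm at most one.

For `v = f̂ - f*`, the control is used at `v / 2`, while the optimality of `f̂` bounds the ratio at
`v` from below. Half the log ratio at `v` and the log ratio at `v / 2` differ by a convexity gap,
which dominates the variance of the logits (`variance_le_cgf_gap`, a Hellinger argument that is
polynomial in `L`), and hence `1 / κ` times the squared sufficient statistic of `v`. A single
feature is a difference of two consecutive sufficient statistics, so this yields a bound for each
coordinate weighted by its visits (`Model.visits_mul_sq_le`), and `le_gamma_sq` checks that the
radius `γ` of the algorithm is large enough.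

All concentration statements are instances of one weighted union bound for exponential
supermartingales, `Model.prob_exists_log_lt_sum_le`. The failure probabilities are `δ / 2` for the
features, `δ / 4` for the transitions and `δ / 4` for the passage from expected to observed errors.
-/

namespace LogDCMDP

set_option linter.unusedSectionVars false

/-! ### Expectations on finite types -/

section Expectation

variable {α β : Type*} [Fintype α] [Fintype β]

/-- The expectation of a real function under a probability mass function on a finite type. -/
noncomputable def expect (p : PMF α) (f : α → ℝ) : ℝ := ∑ a, (p a).toReal * f a

lemma sum_toReal_eq_one (p : PMF α) : ∑ a, (p a).toReal = 1 := by
  rw [← ENNReal.toReal_sum fun a _ => p.apply_ne_top a, ← tsum_fintype (L := .unconditional α),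
    p.tsum_coe, ENNReal.toReal_one]

lemma expect_pure (a : α) (f : α → ℝ) : expect (PMF.pure a) f = f a := by
  classical
  unfold expect
  rw [Finset.sum_eq_single a]
  · simp
  · intro b _ hb
    simp [PMF.pure_apply, hb]
  · simp

lemma expect_bind (p : PMF α) (q : α → PMF β) (f : β → ℝ) :
    expect (p.bind q) f = expect p fun a => expect (q a) f := by
  unfold expect
  have h : ∀ b, ((p.bind q) b).toReal = ∑ a, (p a).toReal * (q a b).toReal := by
    intro b
    rw [PMF.bind_apply, tsum_fintype, ENNReal.toReal_sum]
    · simp [ENNReal.toReal_mul]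
    · intro a _
      exact ENNReal.mul_ne_top (p.apply_ne_top a) ((q a).apply_ne_top b)
  simp_rw [h, Finset.sum_mul, Finset.mul_sum]
  rw [Finset.sum_comm]
  simp_rw [mul_assoc]

lemma expect_mono {p : PMF α} {f g : α → ℝ} (h : ∀ a, f a ≤ g a) : expect p f ≤ expect p g :=
  Finset.sum_le_sum fun a _ => mul_le_mul_of_nonneg_left (h a) ENNReal.toReal_nonneg

lemma expect_const (p : PMF α) (c : ℝ) : expect p (fun _ => c) = c := by
  simp [expect, ← Finset.sum_mul, sum_toReal_eq_one]

lemma expect_add (p : PMF α) (f g : α → ℝ) :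
    expect p (fun a => f a + g a) = expect p f + expect p g := by
  simp [expect, mul_add, Finset.sum_add_distrib]

lemma expect_mul_left (p : PMF α) (c : ℝ) (f : α → ℝ) :
    expect p (fun a => c * f a) = c * expect p f := by
  simp only [expect, Finset.mul_sum]
  exact Finset.sum_congr rfl fun a _ => by ring

lemma expect_sum {ι : Type*} (s : Finset ι) (p : PMF α) (f : ι → α → ℝ) :
    expect p (fun a => ∑ i ∈ s, f i a) = ∑ i ∈ s, expect p (f i) := by
  simp only [expect, Finset.mul_sum]
  exact Finset.sum_comm

lemma expect_le_of_le {p : PMF α} {f : α → ℝ} {c : ℝ} (h : ∀ a, f a ≤ c) : expect p f ≤ c :=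
  (expect_mono h).trans_eq (expect_const p c)

lemma le_expect_of_le {p : PMF α} {f : α → ℝ} {c : ℝ} (h : ∀ a, c ≤ f a) : c ≤ expect p f :=
  (expect_const p c).symm.trans_le (expect_mono h)

/-- The real probability of a set. -/
noncomputable def prob (p : PMF α) (s : Set α) : ℝ := expect p (s.indicator fun _ => 1)

lemma prob_mono {p : PMF α} {s t : Set α} (h : s ⊆ t) : prob p s ≤ prob p t :=
  expect_mono fun a => Set.indicator_le_indicator_of_subset h (fun _ => zero_le_one) a

lemma prob_union_le (p : PMF α) (s t : Set α) : prob p (s ∪ t) ≤ prob p s + prob p t := by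
  unfold prob
  rw [← expect_add]
  refine expect_mono fun a => ?_
  by_cases h₁ : a ∈ s <;> by_cases h₂ : a ∈ t <;> simp [h₁, h₂]

/-- Failure probabilities are real numbers throughout the argument; this is the passage to the outer
measure of the final statement. -/
lemma ofReal_one_sub_le_toOuterMeasure {p : PMF α} {s : Set α} {δ : ℝ} (h : prob p sᶜ ≤ δ) :
    ENNReal.ofReal (1 - δ) ≤ p.toOuterMeasure s := by
  have h₁ : p.toOuterMeasure s = ENNReal.ofReal (prob p s) := by
    rw [PMF.toOuterMeasure_apply_fintype, prob, expect, ENNReal.ofReal_sum_of_nonneg]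
    · refine Finset.sum_congr rfl fun a _ => ?_
      by_cases ha : a ∈ s
      · simp [ha, ENNReal.ofReal_toReal (p.apply_ne_top a)]
      · simp [ha]
    · intro a _
      exact mul_nonneg ENNReal.toReal_nonneg (Set.indicator_nonneg (fun _ _ => zero_le_one) a)
  have h₂ : prob p s + prob p sᶜ = 1 := by
    rw [prob, prob, ← expect_add]
    refine (congrArg (expect p) (funext fun a => ?_)).trans (expect_const p 1)
    by_cases ha : a ∈ s <;> simp [ha]
  rw [h₁]
  exact ENNReal.ofReal_le_ofReal (by linarith)

end Expectation

/-! ### Conditional expectations and supermartingales along episodes and runs. -/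

section Episodes

variable {S : Type*} {A : Type*} {M H : ℕ} [Fintype S] [Fintype A]

/-- The expectation of a function of the triple and of the next state, given the history, the state
and the action. -/
noncomputable def Model.stepExp (m : Model S A M H) (h : Fin H) (τ : Fin h → Triple S A M) (s : S)
    (a : A) (F : Triple S A M → S → ℝ) : ℝ :=
  expect (m.ctxLaw h τ) fun x => expect (m.P h s a x) fun s' => F (s, a, x) s'

lemma Model.expect_prefixLaw_succ (m : Model S A M H) (π : Policy S A M H) (s₀ : S) (h : ℕ)
    (hh : h + 1 ≤ H) (F : (Fin (h + 1) → Triple S A M) × S → ℝ) :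
    expect (m.prefixLaw π s₀ (h + 1) hh) F =
      expect (m.prefixLaw π s₀ h (Nat.le_of_succ_le hh)) fun p =>
        expect (π ⟨h, hh⟩ p.1 p.2) fun a =>
          m.stepExp ⟨h, hh⟩ p.1 p.2 a fun y s' =>
            F (Fin.snoc (α := fun _ => Triple S A M) p.1 y, s') := by
  rw [Model.prefixLaw]
  simp only [expect_bind, expect_pure, Model.stepExp]

/-- Forward induction along an episode for a function that decreases in expectation. -/
lemma Model.expect_episodeLaw_le (m : Model S A M H) (π : Policy S A M H) (s₀ : S)
    (G : (h : ℕ) → h ≤ H → (Fin h → Triple S A M) → S → ℝ)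
    (hG : ∀ (h : Fin H) (τ : Fin h → Triple S A M) (s : S),
      expect (π h τ s) (fun a => m.stepExp h τ s a fun y s' =>
        G (h + 1) h.2 (Fin.snoc (α := fun _ => Triple S A M) τ y) s') ≤ G h h.2.le τ s) :
    expect (m.episodeLaw π s₀) (fun e => G H le_rfl e.1 e.2) ≤
      G 0 (Nat.zero_le _) (fun i => i.elim0) s₀ := by
  have key : ∀ (h : ℕ) (hh : h ≤ H), expect (m.prefixLaw π s₀ h hh) (fun p => G h hh p.1 p.2) ≤
      G 0 (Nat.zero_le _) (fun i => i.elim0) s₀ := by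
    intro h
    induction h with
    | zero =>
      intro hh
      rw [Model.prefixLaw, expect_pure]
    | succ h ih =>
      intro hh
      rw [Model.expect_prefixLaw_succ]
      refine le_trans (expect_mono fun p => ?_) (ih (Nat.le_of_succ_le hh))
      exact hG ⟨h, hh⟩ p.1 p.2
  exact key H le_rfl

/-- Forward induction along an episode for a function that increases in expectation. -/
lemma Model.le_expect_episodeLaw (m : Model S A M H) (π : Policy S A M H) (s₀ : S)
    (G : (h : ℕ) → h ≤ H → (Fin h → Triple S A M) → S → ℝ)
    (hG : ∀ (h : Fin H) (τ : Fin h → Triple S A M) (s : S),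
      G h h.2.le τ s ≤ expect (π h τ s) (fun a => m.stepExp h τ s a fun y s' =>
        G (h + 1) h.2 (Fin.snoc (α := fun _ => Triple S A M) τ y) s')) :
    G 0 (Nat.zero_le _) (fun i => i.elim0) s₀ ≤
      expect (m.episodeLaw π s₀) (fun e => G H le_rfl e.1 e.2) := by
  have key := m.expect_episodeLaw_le π s₀ (fun h hh τ s => -G h hh τ s) (by
    intro h τ s
    have := hG h τ s
    simp only [Model.stepExp, expect, mul_neg, Finset.sum_neg_distrib] at this ⊢
    linarith)
  simp only [expect, mul_neg, Finset.sum_neg_distrib] at key ⊢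
  linarith

/-- The sum along a history of a function of the history, the triple and the next state. -/
noncomputable def accum (D : (h : Fin H) → (Fin h → Triple S A M) → Triple S A M → S → ℝ) :
    (h : ℕ) → h ≤ H → (Fin h → Triple S A M) → S → ℝ
  | 0, _, _, _ => 0
  -- The state that follows the first `h` triples is the first component of the next triple.
  | h + 1, hh, τ, s' =>
      accum D h (Nat.le_of_succ_le hh) (fun t => τ t.castSucc) (τ (Fin.last h)).1 +
        D ⟨h, hh⟩ (fun t => τ (Fin.castSucc t)) (τ (Fin.last h)) s'

lemma accum_snoc (D : (h : Fin H) → (Fin h → Triple S A M) → Triple S A M → S → ℝ) (h : Fin H)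
    (τ : Fin h → Triple S A M) (y : Triple S A M) (s' : S) :
    accum D (h + 1) h.2 (Fin.snoc (α := fun _ => Triple S A M) τ y) s' =
      accum D h h.2.le τ y.1 + D h τ y s' := by
  simp [accum]

lemma accum_episode (D : (h : Fin H) → (Fin h → Triple S A M) → Triple S A M → S → ℝ)
    (e : Episode S A M H) :
    accum D H le_rfl e.1 e.2 = ∑ h : Fin H, D h (e.hist h) (e.1 h) (e.state (h + 1)) := by
  -- The identity is proved for all prefixes, so that the final state of a prefix can serve as the
  -- next state of its last step.
  have key : ∀ (h : ℕ) (hh : h ≤ H),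
      accum D h hh (fun t => e.1 ⟨t, t.2.trans_le hh⟩) (e.state h) =
        ∑ t : Fin h, D ⟨t, t.2.trans_le hh⟩ (e.hist ⟨t, t.2.trans_le hh⟩) (e.1 ⟨t, t.2.trans_le hh⟩)
          (e.state (t + 1)) := by
    intro h
    induction h with
    | zero => intro hh; simp [accum]
    | succ h ih =>
      intro hh
      have hst : e.state h = (e.1 ⟨h, hh⟩).1 := by
        simp [Episode.state, Nat.lt_of_succ_le hh]
      rw [accum, Fin.sum_univ_castSucc]
      have := ih (Nat.le_of_succ_le hh)
      rw [hst] at this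
      simp only [Fin.val_castSucc, Fin.val_last]
      rw [← this]
      rfl
  have h₁ : e.state H = e.2 := by simp [Episode.state]
  have := key H le_rfl
  rw [h₁] at this
  exact this

lemma Model.stepExp_mono (m : Model S A M H) (h : Fin H) (τ : Fin h → Triple S A M) (s : S)
    (a : A) {F G : Triple S A M → S → ℝ} (hFG : ∀ x s', F (s, a, x) s' ≤ G (s, a, x) s') :
    m.stepExp h τ s a F ≤ m.stepExp h τ s a G :=
  expect_mono fun x => expect_mono fun s' => hFG x s'

lemma Model.stepExp_const_add (m : Model S A M H) (h : Fin H) (τ : Fin h → Triple S A M) (s : S)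
    (a : A) (c : ℝ) (F : Triple S A M → S → ℝ) :
    m.stepExp h τ s a (fun y s' => c + F y s') = c + m.stepExp h τ s a F := by
  simp only [Model.stepExp, expect_add, expect_const]

lemma Model.stepExp_const_mul (m : Model S A M H) (h : Fin H) (τ : Fin h → Triple S A M) (s : S)
    (a : A) (c : ℝ) (F : Triple S A M → S → ℝ) :
    m.stepExp h τ s a (fun y s' => c * F y s') = c * m.stepExp h τ s a F := by
  simp only [Model.stepExp, expect_mul_left]

/-- A product of factors of conditional mean at most one has mean at most one. -/
lemma Model.expect_exp_sum_le_one (m : Model S A M H) (π : Policy S A M H) (s₀ : S)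
    (D : (h : Fin H) → (Fin h → Triple S A M) → Triple S A M → S → ℝ)
    (hD : ∀ h τ s a, m.stepExp h τ s a (fun y s' => Real.exp (D h τ y s')) ≤ 1) :
    expect (m.episodeLaw π s₀)
      (fun e => Real.exp (∑ h : Fin H, D h (e.hist h) (e.1 h) (e.state (h + 1)))) ≤ 1 := by
  have key := m.expect_episodeLaw_le π s₀ (fun h hh τ s => Real.exp (accum D h hh τ s)) (by
    intro h τ s
    refine expect_le_of_le fun a => ?_
    have h₁ : ∀ x s', Real.exp (accum D (h + 1) h.2
        (Fin.snoc (α := fun _ => Triple S A M) τ (s, a, x)) s') ≤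
        Real.exp (accum D h h.2.le τ s) * Real.exp (D h τ (s, a, x) s') := by
      intro x s'
      rw [accum_snoc, Real.exp_add]
    refine (m.stepExp_mono h τ s a (G := fun y s' =>
      Real.exp (accum D h h.2.le τ s) * Real.exp (D h τ y s')) h₁).trans ?_
    rw [m.stepExp_const_mul h τ s a _ fun y s' => Real.exp (D h τ y s')]
    exact mul_le_of_le_one_right (Real.exp_nonneg _) (hD h τ s a))
  simp only [accum, Real.exp_zero] at key
  simpa only [accum_episode] using key

/-- A function that bounds the one-step reward plus its expected next value bounds the expected sum
of the rewards. -/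
lemma Model.expect_sum_add_le (m : Model S A M H) (π : Policy S A M H) (s₀ : S)
    (D : (h : Fin H) → (Fin h → Triple S A M) → Triple S A M → S → ℝ)
    (V : (h : ℕ) → h ≤ H → (Fin h → Triple S A M) → S → ℝ)
    (hV : ∀ (h : Fin H) τ s a, m.stepExp h τ s a (fun y s' => D h τ y s' +
      V (h + 1) h.2 (Fin.snoc (α := fun _ => Triple S A M) τ y) s') ≤ V h h.2.le τ s) :
    expect (m.episodeLaw π s₀) (fun e =>
        ∑ h : Fin H, D h (e.hist h) (e.1 h) (e.state (h + 1)) + V H le_rfl e.1 e.2) ≤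
      V 0 (Nat.zero_le _) (fun i => i.elim0) s₀ := by
  have key := m.expect_episodeLaw_le π s₀ (fun h hh τ s => accum D h hh τ s + V h hh τ s) (by
    intro h τ s
    refine expect_le_of_le fun a => ?_
    refine le_trans (m.stepExp_mono h τ s a fun x s' => le_of_eq ?_)
      ((m.stepExp_const_add h τ s a (accum D h h.2.le τ s) _).trans_le
        (add_le_add_right (hV h τ s a) _))
    rw [accum_snoc, add_assoc])
  simp only [accum, zero_add] at key
  simpa only [accum_episode] using key

/-- A function that is bounded by the one-step reward plus its expected next value under a policy
is bounded by the expected sum of the rewards. -/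
lemma Model.le_expect_sum_add (m : Model S A M H) (π : Policy S A M H) (s₀ : S)
    (D : (h : Fin H) → (Fin h → Triple S A M) → Triple S A M → S → ℝ)
    (V : (h : ℕ) → h ≤ H → (Fin h → Triple S A M) → S → ℝ)
    (hV : ∀ (h : Fin H) τ s, V h h.2.le τ s ≤ expect (π h τ s) fun a =>
      m.stepExp h τ s a (fun y s' => D h τ y s' +
        V (h + 1) h.2 (Fin.snoc (α := fun _ => Triple S A M) τ y) s')) :
    V 0 (Nat.zero_le _) (fun i => i.elim0) s₀ ≤
      expect (m.episodeLaw π s₀) (fun e =>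
        ∑ h : Fin H, D h (e.hist h) (e.1 h) (e.state (h + 1)) + V H le_rfl e.1 e.2) := by
  have key := m.le_expect_episodeLaw π s₀ (fun h hh τ s => accum D h hh τ s + V h hh τ s) (by
    intro h τ s
    refine (add_le_add_right (hV h τ s) _).trans ?_
    rw [← expect_const (π h τ s) (accum D h h.2.le τ s), ← expect_add]
    refine expect_mono fun a => ?_
    rw [← m.stepExp_const_add h τ s a]
    refine m.stepExp_mono h τ s a fun x s' => le_of_eq ?_
    rw [accum_snoc, add_assoc])
  simp only [accum, zero_add] at key
  simpa only [accum_episode] using key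

/-! ### The maximal inequality for runs -/

/-- The first `k` episodes. -/
def firstEpisodes {E : Type*} {K : ℕ} (ω : Fin K → E) (k : ℕ) (hk : k ≤ K) : Fin k → E :=
  fun j => ω ⟨j, j.2.trans_le hk⟩

lemma firstEpisodes_self {E : Type*} {K : ℕ} (ω : Fin K → E) : firstEpisodes ω K le_rfl = ω := rfl

lemma firstEpisodes_snoc {E : Type*} {K : ℕ} (ω : Fin K → E) (e : E) (k : ℕ) (hk : k ≤ K)
    (hk' : k ≤ K + 1) :
    firstEpisodes (Fin.snoc (α := fun _ => E) ω e) k hk' = firstEpisodes ω k hk := by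
  funext j
  exact Fin.snoc_castSucc (α := fun _ => E) e ω ⟨j, j.2.trans_le hk⟩

lemma Model.expect_runLaw_succ (m : Model S A M H)
    (init : (k : ℕ) → (Fin k → Episode S A M H) → PMF S) (ℓ : Learner S A M H) (k : ℕ)
    (F : (Fin (k + 1) → Episode S A M H) → ℝ) :
    expect (m.runLaw init ℓ (k + 1)) F =
      expect (m.runLaw init ℓ k) fun past => expect (init k past) fun s₀ =>
        expect (m.episodeLaw (ℓ.policy k past) s₀) fun e =>
          F (Fin.snoc (α := fun _ => Episode S A M H) past e) := by
  rw [Model.runLaw]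
  simp only [expect_bind, expect_pure]

/-- Ville's maximal inequality. -/
lemma Model.prob_exists_lt_le (m : Model S A M H)
    (init : (k : ℕ) → (Fin k → Episode S A M H) → PMF S) (ℓ : Learner S A M H) (K : ℕ)
    (W : (k : ℕ) → (Fin k → Episode S A M H) → ℝ) (hW : ∀ k past, 0 ≤ W k past)
    (hstep : ∀ k past s₀, expect (m.episodeLaw (ℓ.policy k past) s₀)
      (fun e => W (k + 1) (Fin.snoc (α := fun _ => Episode S A M H) past e)) ≤ W k past)
    {c : ℝ} (hc : 0 < c) :
    prob (m.runLaw init ℓ K) {ω | ∃ k, ∃ hk : k ≤ K, c < W k (firstEpisodes ω k hk)} ≤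
      W 0 (fun i => i.elim0) / c := by
  classical
  let hit : (k : ℕ) → (Fin k → Episode S A M H) → Prop := fun k ω =>
    ∃ j, ∃ hj : j ≤ k, c < W j (firstEpisodes ω j hj)
  -- The normalized process, frozen at one from the first crossing on; it is still a supermartingale
  -- and dominates the indicator of the crossing event.
  let U : (k : ℕ) → (Fin k → Episode S A M H) → ℝ := fun k ω => if hit k ω then 1 else W k ω / c
  have hself : ∀ k (ω : Fin k → Episode S A M H), ¬ hit k ω → W k ω ≤ c := by
    intro k ω h
    by_contra! h'
    exact h ⟨k, le_rfl, h'⟩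
  have hUle : ∀ k ω, W k ω ≤ c → U k ω ≤ 1 := by
    intro k ω h
    simp only [U]
    split_ifs
    · exact le_rfl
    · exact (div_le_one hc).2 h
  have hstep' : ∀ k past s₀, expect (m.episodeLaw (ℓ.policy k past) s₀)
      (fun e => U (k + 1) (Fin.snoc (α := fun _ => Episode S A M H) past e)) ≤ U k past := by
    intro k past s₀
    by_cases h : hit k past
    · simp only [U, h, if_true]
      refine expect_le_of_le fun e => ?_
      have : hit (k + 1) (Fin.snoc (α := fun _ => Episode S A M H) past e) := by
        obtain ⟨j, hj, hlt⟩ := h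
        exact ⟨j, hj.trans (Nat.le_succ k), by rwa [firstEpisodes_snoc past e j hj]⟩
      simp [this]
    · have hU : U k past = W k past / c := by simp [U, h]
      rw [hU, div_eq_inv_mul]
      refine le_trans ?_ (mul_le_mul_of_nonneg_left (hstep k past s₀) (inv_nonneg.2 hc.le))
      rw [← expect_mul_left]
      refine expect_mono fun e => ?_
      by_cases h' : hit (k + 1) (Fin.snoc (α := fun _ => Episode S A M H) past e)
      · simp only [U, h', if_true]
        obtain ⟨j, hj, hlt⟩ := h'
        rcases Nat.lt_or_ge k j with hkj | hkj
        · obtain rfl : j = k + 1 := by omega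
          rw [firstEpisodes_self] at hlt
          rw [← div_eq_inv_mul]
          exact (one_le_div hc).2 hlt.le
        · rw [firstEpisodes_snoc past e j hkj] at hlt
          exact absurd ⟨j, hkj, hlt⟩ h
      · simp only [U, h', if_false]
        rw [div_eq_inv_mul]
  have hmono : ∀ k, expect (m.runLaw init ℓ k) (U k) ≤ U 0 (fun i => i.elim0) := by
    intro k
    induction k with
    | zero => rw [Model.runLaw, expect_pure]
    | succ k ih =>
      rw [Model.expect_runLaw_succ]
      refine le_trans (expect_mono fun past => ?_) ih
      exact expect_le_of_le fun s₀ => hstep' k past s₀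
  refine le_trans (expect_mono fun ω => ?_) ((hmono K).trans ?_)
  · by_cases h : hit K ω
    · have : ω ∈ {ω | ∃ k, ∃ hk : k ≤ K, c < W k (firstEpisodes ω k hk)} := h
      simp [U, h, this]
    · refine le_trans (le_of_eq (Set.indicator_of_notMem (s := {ω | ∃ k, ∃ hk : k ≤ K,
        c < W k (firstEpisodes ω k hk)}) h _)) ?_
      simp only [U, h, if_false]
      exact div_nonneg (hW _ _) hc.le
  · by_cases h : hit 0 (fun i => i.elim0)
    · simp only [U, h, if_true]
      obtain ⟨j, hj, hlt⟩ := h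
      obtain rfl : j = 0 := by omega
      rw [firstEpisodes_self] at hlt
      exact (one_le_div hc).2 hlt.le
    · simp only [U, h, if_false, le_refl]

/-- A union bound over a weighted family of exponential supermartingales, uniformly in time. -/
lemma Model.prob_exists_log_lt_sum_le (m : Model S A M H)
    (init : (k : ℕ) → (Fin k → Episode S A M H) → PMF S) (ℓ : Learner S A M H) (K : ℕ)
    {Ξ : Type*} (s : Finset Ξ) (ν : Ξ → ℝ) (hν : ∀ ξ ∈ s, 0 < ν ξ)
    (F : Ξ → (k : ℕ) → (Fin k → Episode S A M H) → Episode S A M H → ℝ)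
    (hF : ∀ ξ ∈ s, ∀ k past s₀, expect (m.episodeLaw (ℓ.policy k past) s₀)
      (fun e => Real.exp (F ξ k past e)) ≤ 1) (B : ℝ) :
    prob (m.runLaw init ℓ K) {ω | ∃ k, ∃ hk : k ≤ K, ∃ ξ ∈ s, B - Real.log (ν ξ) <
      ∑ j : Fin k, F ξ j (firstEpisodes ω j (j.2.le.trans hk)) (ω ⟨j, j.2.trans_le hk⟩)} ≤
      (∑ ξ ∈ s, ν ξ) * Real.exp (-B) := by
  let T : Ξ → (k : ℕ) → (Fin k → Episode S A M H) → ℝ := fun ξ k ω =>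
    ∑ j : Fin k, F ξ j (firstEpisodes ω j j.2.le) (ω j)
  have hT : ∀ ξ k past e, T ξ (k + 1) (Fin.snoc (α := fun _ => Episode S A M H) past e) =
      T ξ k past + F ξ k past e := by
    intro ξ k past e
    simp only [T]
    rw [Fin.sum_univ_castSucc]
    congr 1
    · refine Finset.sum_congr rfl fun j _ => ?_
      rw [Fin.snoc_castSucc]
      congr 1
      exact firstEpisodes_snoc past e j j.2.le _
    · rw [Fin.snoc_last]
      congr 1
      exact firstEpisodes_snoc past e k le_rfl _
  have key := m.prob_exists_lt_le init ℓ K (fun k ω => ∑ ξ ∈ s, ν ξ * Real.exp (T ξ k ω))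
    (fun k past => Finset.sum_nonneg fun ξ hξ => mul_nonneg (hν ξ hξ).le (Real.exp_nonneg _)) (by
      intro k past s₀
      rw [expect_sum]
      refine Finset.sum_le_sum fun ξ hξ => ?_
      simp only [hT, Real.exp_add]
      rw [expect_mul_left, expect_mul_left]
      refine mul_le_mul_of_nonneg_left ?_ (hν ξ hξ).le
      exact mul_le_of_le_one_right (Real.exp_nonneg _) (hF ξ hξ k past s₀)) (Real.exp_pos B)
  refine (prob_mono ?_).trans (key.trans (le_of_eq ?_))
  · rintro ω ⟨k, hk, ξ, hξ, hlt⟩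
    refine ⟨k, hk, ?_⟩
    -- A single term of the mixture already exceeds the level `exp B`.
    have h₁ : Real.exp B < ν ξ * Real.exp (T ξ k (firstEpisodes ω k hk)) := by
      rw [← Real.exp_log (hν ξ hξ), ← Real.exp_add, Real.exp_lt_exp]
      have h₂ : T ξ k (firstEpisodes ω k hk) = ∑ j : Fin k,
        F ξ j (firstEpisodes ω j (j.2.le.trans hk)) (ω ⟨j, j.2.trans_le hk⟩) := rfl
      rw [h₂]
      linarith
    exact h₁.trans_le (Finset.single_le_sum (f := fun ξ => ν ξ * Real.exp
      (T ξ k (firstEpisodes ω k hk))) (fun ξ hξ => mul_nonneg (hν ξ hξ).le (Real.exp_nonneg _)) hξ)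
  · simp [T, Real.exp_neg, div_eq_mul_inv]

end Episodes

/-! ### The softmax -/

section Softmax

variable {M : ℕ}

/-- A vector, extended by zero at the reference context. -/
def extZero (w : Fin M → ℝ) : Fin (M + 1) → ℝ := Fin.snoc (α := fun _ => ℝ) w 0

@[simp] lemma extZero_castSucc (w : Fin M → ℝ) (i : Fin M) : extZero w i.castSucc = w i := by
  simp [extZero]

@[simp] lemma extZero_last (w : Fin M → ℝ) : extZero w (Fin.last M) = 0 := by
  simp [extZero]

lemma softmax_eq (η : ℝ) (w : Fin M → ℝ) (x : Fin (M + 1)) :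
    softmax η w x = Real.exp (η * extZero w x) / ∑ y, Real.exp (η * extZero w y) := by
  induction x using Fin.lastCases with
  | last => rw [softmax_last]; simp [Fin.sum_univ_castSucc, add_comm]
  | cast i => rw [softmax_castSucc]; simp [Fin.sum_univ_castSucc, add_comm]

lemma softmax_pos (η : ℝ) (w : Fin M → ℝ) (x : Fin (M + 1)) : 0 < softmax η w x := by
  rw [softmax_eq]
  have : 0 < ∑ y, Real.exp (η * extZero w y) :=
    Finset.sum_pos (fun _ _ => Real.exp_pos _) Finset.univ_nonempty
  positivity

lemma log_softmax (η : ℝ) (w : Fin M → ℝ) (x : Fin (M + 1)) :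
    Real.log (softmax η w x) =
      η * extZero w x - Real.log (∑ y, Real.exp (η * extZero w y)) := by
  have : 0 < ∑ y, Real.exp (η * extZero w y) :=
    Finset.sum_pos (fun _ _ => Real.exp_pos _) Finset.univ_nonempty
  rw [softmax_eq, Real.log_div (Real.exp_pos _).ne' this.ne', Real.log_exp]

lemma expect_softmaxPMF (η : ℝ) (w : Fin M → ℝ) (f : Fin (M + 1) → ℝ) :
    expect (softmaxPMF η w) f = ∑ x, softmax η w x * f x := by
  simp [expect, softmaxPMF, ENNReal.toReal_ofReal (softmax_nonneg _ _ _)]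

/-- The numerator and the normalizing sum each change by a factor of at most `exp (η * ε)`; the
reference logit does not move. -/
lemma softmax_le_exp_mul {η ε : ℝ} (hη : 0 ≤ η) (hε : 0 ≤ ε) {u v : Fin M → ℝ}
    (h : ∀ i, |u i - v i| ≤ ε) (x : Fin (M + 1)) :
    softmax η u x ≤ Real.exp (2 * (η * ε)) * softmax η v x := by
  have h' : ∀ y, |extZero u y - extZero v y| ≤ ε := by
    intro y
    induction y using Fin.lastCases with
    | last => simpa using hε
    | cast i => simpa using h i
  have hu : 0 < ∑ y, Real.exp (η * extZero u y) :=
    Finset.sum_pos (fun _ _ => Real.exp_pos _) Finset.univ_nonempty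
  have hv : 0 < ∑ y, Real.exp (η * extZero v y) :=
    Finset.sum_pos (fun _ _ => Real.exp_pos _) Finset.univ_nonempty
  have h₁ : ∑ y, Real.exp (η * extZero v y) ≤
      Real.exp (η * ε) * ∑ y, Real.exp (η * extZero u y) := by
    rw [Finset.mul_sum]
    refine Finset.sum_le_sum fun y _ => ?_
    rw [← Real.exp_add, Real.exp_le_exp]
    have := mul_le_mul_of_nonneg_left ((abs_le.1 (h' y)).1) hη
    nlinarith
  have h₂ : Real.exp (η * extZero u x) ≤ Real.exp (η * ε) * Real.exp (η * extZero v x) := by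
    rw [← Real.exp_add, Real.exp_le_exp]
    have := mul_le_mul_of_nonneg_left ((abs_le.1 (h' x)).2) hη
    nlinarith
  rw [softmax_eq, softmax_eq, ← mul_div_assoc, div_le_div_iff₀ hu hv, two_mul, Real.exp_add]
  calc Real.exp (η * extZero u x) * ∑ y, Real.exp (η * extZero v y)
      ≤ (Real.exp (η * ε) * Real.exp (η * extZero v x)) *
          (Real.exp (η * ε) * ∑ y, Real.exp (η * extZero u y)) := by gcongr
    _ = _ := by ring

lemma sum_softmax_mul_le_of_le {η B : ℝ} {u : Fin M → ℝ} {Q : Fin (M + 1) → ℝ}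
    (hQ : ∀ x, Q x ≤ B) : ∑ x, softmax η u x * Q x ≤ B := by
  calc ∑ x, softmax η u x * Q x ≤ ∑ x, softmax η u x * B :=
        Finset.sum_le_sum fun x _ => mul_le_mul_of_nonneg_left (hQ x) (softmax_nonneg _ _ _)
    _ = B := by rw [← Finset.sum_mul, sum_softmax, one_mul]

/-- The expectation of a bounded function under the softmax is Lipschitz in the logits. -/
lemma sum_softmax_mul_le_add {η ε B : ℝ} (hη : 0 ≤ η) (hε : 0 ≤ ε) {u v : Fin M → ℝ}
    (h : ∀ i, |u i - v i| ≤ ε) {Q : Fin (M + 1) → ℝ} (hQ0 : ∀ x, 0 ≤ Q x) (hQ : ∀ x, Q x ≤ B) :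
    ∑ x, softmax η u x * Q x ≤ ∑ x, softmax η v x * Q x + min B (4 * B * (η * ε)) := by
  have hv0 : 0 ≤ ∑ x, softmax η v x * Q x :=
    Finset.sum_nonneg fun x _ => mul_nonneg (softmax_nonneg _ _ _) (hQ0 x)
  have hB : 0 ≤ B := (hQ0 0).trans (hQ 0)
  have hu : ∑ x, softmax η u x * Q x ≤ B := sum_softmax_mul_le_of_le hQ
  have hv : ∑ x, softmax η v x * Q x ≤ B := sum_softmax_mul_le_of_le hQ
  have hηε : 0 ≤ η * ε := mul_nonneg hη hε
  rw [← sub_le_iff_le_add', le_min_iff]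
  refine ⟨by linarith, ?_⟩
  -- For small exponents `exp x ≤ 1 + 2 * x`; for large ones the trivial bound `B` is already below
  -- `4 * B * (η * ε)`.
  rcases le_or_gt (2 * (η * ε)) 1 with hle | hgt
  · have h₁ : ∑ x, softmax η u x * Q x ≤ Real.exp (2 * (η * ε)) * ∑ x, softmax η v x * Q x := by
      rw [Finset.mul_sum]
      refine Finset.sum_le_sum fun x _ => ?_
      rw [← mul_assoc]
      exact mul_le_mul_of_nonneg_right (softmax_le_exp_mul hη hε h x) (hQ0 x)
    have h₂ : Real.exp (2 * (η * ε)) ≤ 1 + 2 * (2 * (η * ε)) := by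
      have := Real.abs_exp_sub_one_le (x := 2 * (η * ε)) (by rw [abs_of_nonneg] <;> linarith)
      rw [abs_of_nonneg (a := 2 * (η * ε)) (by linarith)] at this
      linarith [(abs_le.1 this).2]
    nlinarith [mul_le_mul_of_nonneg_right h₂ hv0, mul_le_mul_of_nonneg_left hv hηε]
  · nlinarith

end Softmax

/-! ### Threshold optimistic planning attains the maximum over a cuboid -/

section Threshold

variable {M : ℕ}

/-- At `w`, the unnormalized weights give `Q - v` the sum zero. Raising the weights where `Q ≥ v`
and lowering them where `Q < v` can only increase this sum, and a nonnegative sum means that the new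
mean is at least `v`. The threshold matters only through the split of the contexts that it induces,
hence the hypothesis `ht`. -/
lemma sum_softmax_mul_thr_ge {η : ℝ} (hη : 0 ≤ η) (Q : Fin (M + 1) → ℝ)
    {I : (Fin M → ℝ) × (Fin M → ℝ)} {w : Fin M → ℝ} (hlo : ∀ i, I.1 i ≤ w i)
    (hup : ∀ i, w i ≤ I.2 i) {t : ℝ}
    (ht : ∀ i : Fin M, Q i.castSucc < ∑ x, softmax η w x * Q x ↔ Q i.castSucc < t) :
    ∑ x, softmax η w x * Q x ≤ ∑ x, softmax η (thr t Q I) x * Q x := by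
  set v := ∑ x, softmax η w x * Q x with hv
  set w' := thr t Q I with hw'
  have hw : 0 < ∑ y, Real.exp (η * extZero w y) :=
    Finset.sum_pos (fun _ _ => Real.exp_pos _) Finset.univ_nonempty
  have hw1 : 0 < ∑ y, Real.exp (η * extZero w' y) :=
    Finset.sum_pos (fun _ _ => Real.exp_pos _) Finset.univ_nonempty
  have hrat : ∀ u : Fin M → ℝ, ∑ x, softmax η u x * Q x =
      (∑ x, Real.exp (η * extZero u x) * Q x) / ∑ y, Real.exp (η * extZero u y) := by
    intro u
    rw [Finset.sum_div]
    exact Finset.sum_congr rfl fun x _ => by rw [softmax_eq]; ring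
  have h₀ : ∑ x, Real.exp (η * extZero w x) * (Q x - v) = 0 := by
    have : v * ∑ y, Real.exp (η * extZero w y) = ∑ x, Real.exp (η * extZero w x) * Q x := by
      rw [hv, hrat w, div_mul_cancel₀ _ hw.ne']
    simp_rw [mul_sub, Finset.sum_sub_distrib, ← Finset.sum_mul]
    linarith
  have h₁ : ∑ x, Real.exp (η * extZero w x) * (Q x - v) ≤
      ∑ x, Real.exp (η * extZero w' x) * (Q x - v) := by
    refine Finset.sum_le_sum fun x _ => ?_
    induction x using Fin.lastCases with
    | last => simp
    | cast i =>
      simp only [extZero_castSucc, hw', thr]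
      split_ifs with hi
      · have hQ := (ht i).2 hi
        exact mul_le_mul_of_nonpos_right
          (Real.exp_le_exp.2 (mul_le_mul_of_nonneg_left (hlo i) hη)) (by linarith)
      · have hQ : v ≤ Q i.castSucc := not_lt.1 fun h' => hi ((ht i).1 h')
        exact mul_le_mul_of_nonneg_right
          (Real.exp_le_exp.2 (mul_le_mul_of_nonneg_left (hup i) hη)) (by linarith)
  rw [hrat w', le_div_iff₀ hw1]
  simp_rw [mul_sub, Finset.sum_sub_distrib, ← Finset.sum_mul] at h₀ h₁
  linarith

/-- The threshold set contains an optimal element of the cuboid. -/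
lemma sum_softmax_mul_le_thrMax {η : ℝ} (hη : 0 ≤ η) (hM : 1 ≤ M) (Q : Fin (M + 1) → ℝ)
    {I : (Fin M → ℝ) × (Fin M → ℝ)} {w : Fin M → ℝ} (hlo : ∀ i, I.1 i ≤ w i)
    (hup : ∀ i, w i ≤ I.2 i) : ∑ x, softmax η w x * Q x ≤ thrMax η Q I := by
  set v := ∑ x, softmax η w x * Q x with hv
  have hbdd : BddAbove (Set.range fun j : Fin M =>
      ∑ i, softmax η (thr (thrPoint Q j) Q I) i * Q i) := (Set.finite_range _).bddAbove
  have hmono : Monotone fun l => Q (Tuple.sort Q l) := Tuple.monotone_sort Q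
  have hsurj : ∀ x, ∃ l, x = Tuple.sort Q l := fun x =>
    ⟨(Tuple.sort Q).symm x, (Equiv.apply_symm_apply _ _).symm⟩
  have hlast : v ≤ Q (Tuple.sort Q (Fin.last M)) := by
    refine sum_softmax_mul_le_of_le fun x => ?_
    obtain ⟨l, rfl⟩ := hsurj x
    exact hmono (Fin.le_last l)
  -- The first sorted position at which `Q` reaches its mean `v` determines the threshold.
  have hex : ∃ n, ∃ hn : n < M + 1, v ≤ Q (Tuple.sort Q ⟨n, hn⟩) := ⟨M, Nat.lt_succ_self M, hlast⟩
  classical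
  obtain ⟨hn, hnv⟩ := Nat.find_spec hex
  have hmin := fun {n} => Nat.find_min (m := n) hex
  set n := Nat.find hex
  -- If already the least value reaches the mean, every point of the cuboid does at least as well.
  rcases Nat.eq_zero_or_pos n with h0 | hpos
  · refine le_trans ?_ (le_ciSup hbdd ⟨0, hM⟩)
    have : ∀ x, v ≤ Q x := by
      intro x
      obtain ⟨l, rfl⟩ := hsurj x
      exact hnv.trans (hmono (Fin.le_def.2 (h0.le.trans (Nat.zero_le _))))
    calc v = ∑ x, softmax η (thr (thrPoint Q ⟨0, hM⟩) Q I) x * v := by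
          rw [← Finset.sum_mul, sum_softmax, one_mul]
      _ ≤ _ := Finset.sum_le_sum fun x _ =>
          mul_le_mul_of_nonneg_left (this x) (softmax_nonneg _ _ _)
  · have hj : n - 1 < M := by omega
    let j : Fin M := ⟨n - 1, hj⟩
    have hlow : Q (Tuple.sort Q j.castSucc) < v := by
      have := hmin (n := n - 1) (by omega)
      push Not at this
      exact this (by omega)
    have hsucc : j.succ = ⟨n, hn⟩ := by
      ext
      simp [j]
      omega
    have hhigh : v ≤ Q (Tuple.sort Q j.succ) := by rw [hsucc]; exact hnv
    refine le_trans ?_ (le_ciSup hbdd j)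
    -- The midpoint lies above the last value below `v` and does not exceed the first value that
    -- reaches `v`, so it splits the contexts exactly as `v` does.
    refine sum_softmax_mul_thr_ge hη Q hlo hup fun i => ?_
    rw [← hv, thrPoint]
    obtain ⟨l, hl⟩ := hsurj i.castSucc
    rw [hl]
    rcases lt_or_ge l j.succ with hlt | hge
    · have h₁ : Q (Tuple.sort Q l) ≤ Q (Tuple.sort Q j.castSucc) :=
        hmono (Fin.le_castSucc_iff.2 hlt)
      constructor <;> intro <;> linarith
    · have h₁ : Q (Tuple.sort Q j.succ) ≤ Q (Tuple.sort Q l) := hmono hge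
      constructor <;> intro <;> linarith

lemma thrMax_le {η c : ℝ} (hM : 1 ≤ M) {Q : Fin (M + 1) → ℝ} {I : (Fin M → ℝ) × (Fin M → ℝ)}
    (h : ∀ j : Fin M, ∑ x, softmax η (thr (thrPoint Q j) Q I) x * Q x ≤ c) :
    thrMax η Q I ≤ c := by
  have : Nonempty (Fin M) := ⟨⟨0, hM⟩⟩
  exact ciSup_le h

end Threshold

/-! ### The problem dependent constant -/

section Kappa

variable {M : ℕ}

lemma sum_softmax_castSucc (η : ℝ) (w : Fin M → ℝ) :
    ∑ i : Fin M, softmax η w i.castSucc = 1 - softmax η w (Fin.last M) := by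
  have := sum_softmax η w
  rw [Fin.sum_univ_castSucc] at this
  linarith

lemma dotProduct_gradMatrix_mulVec (η : ℝ) (w v : Fin M → ℝ) :
    v ⬝ᵥ (gradMatrix η w).mulVec v = ∑ i, softmax η w i.castSucc * v i ^ 2 -
      (∑ i, softmax η w i.castSucc * v i) ^ 2 := by
  rw [gradMatrix, Matrix.sub_mulVec, dotProduct_sub]
  congr 1
  · simp only [dotProduct, Matrix.mulVec_diagonal]
    exact Finset.sum_congr rfl fun i _ => by ring
  · rw [Matrix.vecMulVec_mulVec]
    simp only [dotProduct, sq, Finset.sum_mul, Pi.smul_apply, MulOpposite.smul_eq_mul_unop,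
      MulOpposite.unop_op]
    exact Finset.sum_congr rfl fun i _ => by ring

lemma isHermitian_gradMatrix (η : ℝ) (w : Fin M → ℝ) : (gradMatrix η w).IsHermitian := by
  ext i j
  simp only [gradMatrix, Matrix.conjTranspose_apply, Matrix.sub_apply, Matrix.diagonal_apply,
    Matrix.vecMulVec_apply, star_trivial]
  by_cases h : i = j
  · simp [h]
  · simp [h, Ne.symm h, mul_comm]

/-- By Cauchy–Schwarz the subtracted square is at most `1 - z_{M+1}` times the diagonal form; the
positive mass of the reference context leaves a positive remainder. -/
lemma posDef_gradMatrix (η : ℝ) (w : Fin M → ℝ) : (gradMatrix η w).PosDef := by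
  refine Matrix.PosDef.of_dotProduct_mulVec_pos (isHermitian_gradMatrix η w) fun v hv => ?_
  rw [star_trivial, dotProduct_gradMatrix_mulVec]
  have hpos : 0 < ∑ i, softmax η w i.castSucc * v i ^ 2 := by
    obtain ⟨i, hi⟩ := Function.ne_iff.1 hv
    refine Finset.sum_pos' (fun i _ => mul_nonneg (softmax_nonneg _ _ _) (sq_nonneg _))
      ⟨i, Finset.mem_univ i, mul_pos (softmax_pos _ _ _) (by have : v i ≠ 0 := hi; positivity)⟩
  have hcs : (∑ i, softmax η w i.castSucc * v i) ^ 2 ≤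
      (∑ i : Fin M, softmax η w i.castSucc) * ∑ i, softmax η w i.castSucc * v i ^ 2 := by
    refine Finset.sum_sq_le_sum_mul_sum_of_sq_le_mul _ (fun i _ => softmax_nonneg _ _ _)
      (fun i _ => mul_nonneg (softmax_nonneg _ _ _) (sq_nonneg _)) fun i _ => le_of_eq (by ring)
  rw [sum_softmax_castSucc] at hcs
  nlinarith [mul_pos (softmax_pos η w (Fin.last M)) hpos]

/-- Subtracting the least spectral value leaves a matrix with nonnegative spectrum, hence a
nonnegative quadratic form at `v`. -/
lemma sInf_spectrum_gradMatrix_mul_le (η : ℝ) (w v : Fin M → ℝ) :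
    sInf (spectrum ℝ (gradMatrix η w)) * ∑ i, v i ^ 2 ≤
      ∑ i, softmax η w i.castSucc * v i ^ 2 - (∑ i, softmax η w i.castSucc * v i) ^ 2 := by
  set A := gradMatrix η w
  have hfin : (spectrum ℝ A).Finite := by
    rw [(isHermitian_gradMatrix η w).spectrum_real_eq_range_eigenvalues]
    exact Set.finite_range _
  set μ := sInf (spectrum ℝ A)
  have hpsd : (A - algebraMap ℝ _ μ).PosSemidef := by
    rw [Matrix.posSemidef_iff_isHermitian_and_spectrum_nonneg]
    refine ⟨(isHermitian_gradMatrix η w).sub ?_, ?_⟩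
    · ext i j
      simp [Matrix.algebraMap_matrix_apply, eq_comm]
    · rw [← spectrum.sub_singleton_eq]
      rintro _ ⟨x, hx, _, rfl, rfl⟩
      exact sub_nonneg.2 (csInf_le hfin.bddBelow hx)
  have := hpsd.dotProduct_mulVec_nonneg v
  rw [star_trivial, Matrix.sub_mulVec, dotProduct_sub, dotProduct_gradMatrix_mulVec,
    Algebra.algebraMap_eq_smul_one, Matrix.smul_mulVec, Matrix.one_mulVec, dotProduct_smul] at this
  have h₂ : v ⬝ᵥ v = ∑ i, v i ^ 2 := by simp [dotProduct, sq]
  rw [h₂, smul_eq_mul] at this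
  linarith

/-- The finite nonempty spectrum attains its infimum at an eigenvalue. For `M = 0` the spectrum is
empty and its `sInf` has the default value zero. -/
lemma sInf_spectrum_gradMatrix_pos (hM : 1 ≤ M) (η : ℝ) (w : Fin M → ℝ) :
    0 < sInf (spectrum ℝ (gradMatrix η w)) := by
  have : Nonempty (Fin M) := ⟨⟨0, hM⟩⟩
  have h := (isHermitian_gradMatrix η w).spectrum_real_eq_range_eigenvalues
  have hmem : sInf (spectrum ℝ (gradMatrix η w)) ∈ spectrum ℝ (gradMatrix η w) := by
    rw [h]
    exact (Set.range_nonempty _).csInf_mem (Set.finite_range _)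
  rw [h] at hmem
  obtain ⟨i, hi⟩ := hmem
  rw [h, ← hi]
  exact (posDef_gradMatrix η w).eigenvalues_pos i

variable {S : Type*} {A : Type*} {H : ℕ} [Finite S] [Finite A]

lemma Model.inv_kappa_le (m : Model S A M H) (h : Fin H) (τ : Fin h → Triple S A M) :
    m.kappa⁻¹ ≤ sInf (spectrum ℝ (gradMatrix (temp m.α H) (suffStat m.α m.f h τ))) := by
  rw [Model.kappa, inv_inv]
  exact ciInf_le (Set.finite_range _).bddBelow
    (⟨h, τ⟩ : (h : Fin H) × (Fin h → Triple S A M))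

lemma Model.kappa_pos (m : Model S A M H) (hM : 1 ≤ M) (hH : 1 ≤ H) : 0 < m.kappa := by
  have : Nonempty ((h : Fin H) × (Fin h → Triple S A M)) := ⟨⟨⟨0, hH⟩, fun i => i.elim0⟩⟩
  rw [Model.kappa, inv_pos]
  obtain ⟨p, hp⟩ := exists_eq_ciInf_of_finite (f := fun p : (h : Fin H) × (Fin h → Triple S A M) =>
    sInf (spectrum ℝ (gradMatrix (temp m.α H) (suffStat m.α m.f p.1 p.2))))
  rw [← hp]
  exact sInf_spectrum_gradMatrix_pos hM _ _

/-- The variance of a function of the context is at least `1 / κ` times its Euclidean norm. -/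
lemma Model.inv_kappa_mul_le (m : Model S A M H) (h : Fin H)
    (τ : Fin h → Triple S A M) (v : Fin M → ℝ) :
    m.kappa⁻¹ * ∑ i, v i ^ 2 ≤
      ∑ x, softmax (temp m.α H) (suffStat m.α m.f h τ) x * extZero v x ^ 2 -
        (∑ x, softmax (temp m.α H) (suffStat m.α m.f h τ) x * extZero v x) ^ 2 := by
  -- The reference context contributes zero to both sums, so the variance over all contexts is the
  -- quadratic form of `gradMatrix`.
  rw [Fin.sum_univ_castSucc, Fin.sum_univ_castSucc]
  simp only [extZero_castSucc, extZero_last]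
  refine (mul_le_mul_of_nonneg_right (m.inv_kappa_le h τ)
    (Finset.sum_nonneg fun i _ => sq_nonneg _)).trans ?_
  simpa using sInf_spectrum_gradMatrix_mul_le _ _ v

/-- Testing the variance bound at the empty history with a unit vector gives `1 / κ ≤ z * (1 - z) ≤
1`. -/
lemma Model.one_le_kappa (m : Model S A M H) (hM : 1 ≤ M) (hH : 1 ≤ H) : 1 ≤ m.kappa := by
  have h₁ := m.inv_kappa_mul_le ⟨0, hH⟩ (fun i => i.elim0) (fun i => if i = ⟨0, hM⟩ then 1 else 0)
  set p := softmax (temp m.α H) (suffStat m.α m.f ⟨0, hH⟩ fun i => i.elim0)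
  simp only [ite_pow, one_pow, ne_eq, OfNat.ofNat_ne_zero, not_false_eq_true, zero_pow,
    Finset.sum_ite_eq', Finset.mem_univ, if_true, mul_one, Fin.sum_univ_castSucc, extZero_castSucc,
    extZero_last, mul_ite, mul_zero, add_zero] at h₁
  have h₂ : m.kappa⁻¹ ≤ 1 := by nlinarith [sq_nonneg (p (Fin.castSucc ⟨0, hM⟩) - 1 / 2)]
  exact (inv_le_one₀ (m.kappa_pos hM hH)).1 h₂

end Kappa

/-! ### The effective horizon and the sufficient statistic -/

section Horizon

variable {α : ℝ} {H : ℕ}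

lemma one_le_effHorizon (hα : 0 ≤ α) (hH : 1 ≤ H) : 1 ≤ effHorizon α H := by
  have := Finset.single_le_sum (f := fun j => α ^ j) (s := Finset.range (2 * H))
    (fun j _ => pow_nonneg hα j) (Finset.mem_range.2 (by omega : 0 < 2 * H))
  simpa [effHorizon] using this

lemma temp_pos (hα : 0 ≤ α) (hH : 1 ≤ H) : 0 < temp α H := by
  have := one_le_effHorizon hα hH
  unfold temp
  positivity

lemma temp_sq (hα : 0 ≤ α) (hH : 1 ≤ H) : temp α H ^ 2 = (effHorizon α H)⁻¹ := by
  have := one_le_effHorizon hα hH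
  rw [temp, div_pow, Real.sq_sqrt (by linarith), one_pow, one_div]

lemma temp_mul_sqrt_effHorizon (hα : 0 ≤ α) (hH : 1 ≤ H) :
    temp α H * √(effHorizon α H) = 1 := by
  have := one_le_effHorizon hα hH
  rw [temp, one_div, inv_mul_cancel₀]
  positivity

end Horizon

section SuffStat

variable {S : Type*} {A : Type*} {M H : ℕ}

lemma suffStat_zero (α : ℝ) (f : Feature S A M H) (hH : 0 < H)
    (τ : Fin ((⟨0, hH⟩ : Fin H) : ℕ) → Triple S A M) : suffStat α f ⟨0, hH⟩ τ = f none := by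
  funext i
  simp [suffStat]

lemma suffStat_succ (α : ℝ) (f : Feature S A M H) (h : ℕ) (hh : h + 1 < H)
    (τ : Fin h → Triple S A M) (y : Triple S A M) (i : Fin M) :
    suffStat α f ⟨h + 1, hh⟩ (Fin.snoc (α := fun _ => Triple S A M) τ y) i =
      α * suffStat α f ⟨h, Nat.lt_of_succ_lt hh⟩ τ i +
        f (some (⟨h, Nat.lt_of_succ_lt hh⟩, y)) i := by
  simp only [suffStat]
  rw [Fin.sum_univ_castSucc, mul_add, Finset.mul_sum]
  -- Here `t < h`, so the truncated subtractions are exact.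
  have h₁ : ∀ t : Fin h, α ^ (h + 1 - 1 - (t : ℕ)) = α * α ^ (h - 1 - (t : ℕ)) := by
    intro t
    rw [← pow_succ']
    congr 1
    omega
  simp only [Fin.val_castSucc, Fin.val_last, Fin.snoc_castSucc, Fin.snoc_last, h₁]
  rw [add_assoc]
  congr 1
  · ring
  · congr 1
    · exact Finset.sum_congr rfl fun t _ => by ring
    · simp

/-- Only coordinates on the history need to be compared. This spares the last time step, whose
features never enter a sufficient statistic and cannot be estimated. -/
lemma suffStat_mono {α : ℝ} (hα : 0 ≤ α) {f g : Feature S A M H} (h : Fin H)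
    (τ : Fin h → Triple S A M) (i : Fin M) (h₀ : f none i ≤ g none i)
    (h₁ : ∀ t : Fin h, f (some (⟨t, t.2.trans h.2⟩, τ t)) i ≤
      g (some (⟨t, t.2.trans h.2⟩, τ t)) i) :
    suffStat α f h τ i ≤ suffStat α g h τ i :=
  add_le_add (mul_le_mul_of_nonneg_left h₀ (pow_nonneg hα _))
    (Finset.sum_le_sum fun t _ => mul_le_mul_of_nonneg_left (h₁ t) (pow_nonneg hα _))

lemma suffStat_le {α : ℝ} (hα : 0 ≤ α) (hα1 : α ≤ 1) {f : Feature S A M H}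
    (hf : ∀ c i, 0 ≤ f c i) (h : Fin H) (τ : Fin h → Triple S A M) (i : Fin M) :
    suffStat α f h τ i ≤
      f none i + ∑ t : Fin h, f (some (⟨t, t.2.trans h.2⟩, τ t)) i :=
  add_le_add (mul_le_of_le_one_left (hf _ _) (pow_le_one₀ hα hα1))
    (Finset.sum_le_sum fun _ _ => mul_le_of_le_one_left (hf _ _) (pow_le_one₀ hα hα1))

lemma suffStat_add (α : ℝ) (f g : Feature S A M H) (h : Fin H) (τ : Fin h → Triple S A M) :
    suffStat α (fun c i => f c i + g c i) h τ =
      fun i => suffStat α f h τ i + suffStat α g h τ i := by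
  funext i
  simp only [suffStat, mul_add, Finset.sum_add_distrib]
  ring

lemma suffStat_smul (α a : ℝ) (f : Feature S A M H) (h : Fin H) (τ : Fin h → Triple S A M) :
    suffStat α (fun c i => a * f c i) h τ = fun i => a * suffStat α f h τ i := by
  funext i
  simp only [suffStat, mul_add, Finset.mul_sum]
  congr 1
  · ring
  · exact Finset.sum_congr rfl fun t _ => by ring

lemma Episode.hist_succ (e : Episode S A M H) (h : ℕ) (hh : h + 1 < H) :
    e.hist ⟨h + 1, hh⟩ = Fin.snoc (α := fun _ => Triple S A M)
      (e.hist ⟨h, Nat.lt_of_succ_lt hh⟩) (e.1 ⟨h, Nat.lt_of_succ_lt hh⟩) := by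
  funext t
  induction t using Fin.lastCases with
  | last => rw [Fin.snoc_last]; rfl
  | cast t => rw [Fin.snoc_castSucc]; rfl

/-- A feature at a visited coordinate is controlled by the sufficient statistics of the episode. -/
lemma sq_feature_le_two_mul_sum {α : ℝ} (hα : 0 ≤ α) (hα1 : α ≤ 1) (f : Feature S A M H)
    (e : Episode S A M H) (t : ℕ) (ht : t + 1 < H) (i : Fin M) :
    f (some (⟨t, Nat.lt_of_succ_lt ht⟩, e.1 ⟨t, Nat.lt_of_succ_lt ht⟩)) i ^ 2 ≤
      2 * ∑ h : Fin H, suffStat α f h (e.hist h) i ^ 2 := by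
  have h₁ := suffStat_succ α f t ht (e.hist ⟨t, Nat.lt_of_succ_lt ht⟩)
    (e.1 ⟨t, Nat.lt_of_succ_lt ht⟩) i
  rw [← Episode.hist_succ e t ht] at h₁
  set u := suffStat α f ⟨t + 1, ht⟩ (e.hist ⟨t + 1, ht⟩) i
  set v := suffStat α f ⟨t, Nat.lt_of_succ_lt ht⟩ (e.hist ⟨t, Nat.lt_of_succ_lt ht⟩) i
  have h₂ : u ^ 2 + v ^ 2 ≤ ∑ h : Fin H, suffStat α f h (e.hist h) i ^ 2 := by
    have hne : (⟨t + 1, ht⟩ : Fin H) ≠ ⟨t, Nat.lt_of_succ_lt ht⟩ := by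
      simp [Fin.ext_iff]
    rw [← Finset.sum_pair (f := fun h : Fin H => suffStat α f h (e.hist h) i ^ 2) hne]
    exact Finset.sum_le_sum_of_subset_of_nonneg (Finset.subset_univ _) fun _ _ _ => sq_nonneg _
  -- Consecutive sufficient statistics isolate one feature; then `(u - α * v) ^ 2 ≤ 2 * u ^ 2 + 2 *
  -- (α * v) ^ 2`.
  have h₃ : f (some (⟨t, Nat.lt_of_succ_lt ht⟩, e.1 ⟨t, Nat.lt_of_succ_lt ht⟩)) i = u - α * v := by
    linarith
  have h₄ : (α * v) ^ 2 ≤ v ^ 2 := by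
    rw [mul_pow]
    exact mul_le_of_le_one_left (sq_nonneg v) (pow_le_one₀ hα hα1)
  rw [h₃]
  nlinarith [sq_nonneg (u + α * v)]

lemma sq_feature_none_le_sum {α : ℝ} (hH : 1 ≤ H) (f : Feature S A M H) (e : Episode S A M H)
    (i : Fin M) : f none i ^ 2 ≤ ∑ h : Fin H, suffStat α f h (e.hist h) i ^ 2 := by
  have := Finset.single_le_sum (f := fun h : Fin H => suffStat α f h (e.hist h) i ^ 2)
    (fun h _ => sq_nonneg _) (Finset.mem_univ (⟨0, hH⟩ : Fin H))
  simpa [suffStat_zero] using this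

variable [Fintype S] [Fintype A] [DecidableEq S] [DecidableEq A]

/-- The coefficient of a feature in the sufficient statistic. -/
noncomputable def coef (α : ℝ) (h : Fin H) (τ : Fin h → Triple S A M) : Coord S A M H → ℝ
  | none => α ^ (h : ℕ)
  | some c => if ht : c.1.1 < h.1 then
      if τ ⟨c.1, ht⟩ = c.2 then α ^ ((h : ℕ) - 1 - c.1) else 0 else 0

lemma suffStat_eq_sum_coef (α : ℝ) (f : Feature S A M H) (h : Fin H) (τ : Fin h → Triple S A M)
    (i : Fin M) : suffStat α f h τ i = ∑ c, coef α h τ c * f c i := by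
  rw [Fintype.sum_option, suffStat]
  congr 1
  rw [Fintype.sum_prod_type]
  have h₁ : ∀ t : Fin H, ∑ y, coef α h τ (some (t, y)) * f (some (t, y)) i =
      if ht : t.1 < h.1 then α ^ ((h : ℕ) - 1 - t) * f (some (t, τ ⟨t, ht⟩)) i else 0 := by
    intro t
    by_cases ht : t.1 < h.1
    · rw [Finset.sum_eq_single (τ ⟨t, ht⟩)]
      · simp [coef, ht]
      · intro y _ hy
        simp [coef, ht, Ne.symm hy]
      · simp
    · simp [coef, ht]
  rw [Finset.sum_congr rfl fun t _ => h₁ t]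
  have h₂ : ∀ g : ℕ → ℝ, ∑ t : Fin H, (if t.1 < h.1 then g t.1 else 0) = ∑ t : Fin h, g t.1 := by
    intro g
    rw [Fin.sum_univ_eq_sum_range (fun t => if t < h.1 then g t else 0) H,
      Fin.sum_univ_eq_sum_range g h, ← Finset.sum_filter]
    congr 1
    ext t
    simp only [Finset.mem_filter, Finset.mem_range]
    exact ⟨fun h' => h'.2, fun h' => ⟨h'.trans h.2, h'⟩⟩
  have h₃ := h₂ fun t => if ht : t < h.1 then
    α ^ ((h : ℕ) - 1 - t) * f (some (⟨t, ht.trans h.2⟩, τ ⟨t, ht⟩)) i else 0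
  have h₄ : ∀ t : Fin h, (if ht : t.1 < h.1 then
      α ^ ((h : ℕ) - 1 - t) * f (some (⟨t, ht.trans h.2⟩, τ ⟨t, ht⟩)) i else 0) =
      α ^ ((h : ℕ) - 1 - t) * f (some (⟨t, t.2.trans h.2⟩, τ t)) i := fun t => by simp [t.2]
  rw [← Finset.sum_congr rfl fun t _ => h₄ t, ← h₃]
  refine Finset.sum_congr rfl fun t _ => ?_
  by_cases ht : t.1 < h.1 <;> simp [ht]

lemma coef_sq (α : ℝ) (h : Fin H) (τ : Fin h → Triple S A M) (c : Coord S A M H) :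
    coef α h τ c ^ 2 = coef (α ^ 2) h τ c := by
  rcases c with _ | c
  · simp only [coef]; ring
  · simp only [coef]
    split_ifs
    · ring
    · simp
    · simp

/-- The nonzero coefficients are among the powers `α ^ j` with `j ≤ h`, each listed once, where
`none` supplies `j = h`; moreover `α ^ (2 * j) ≤ α ^ j`. -/
lemma sum_coef_sq_le {α : ℝ} (hα : 0 ≤ α) (hα1 : α ≤ 1) (h : Fin H) (τ : Fin h → Triple S A M) :
    ∑ c, coef α h τ c ^ 2 ≤ effHorizon α H := by
  have h₁ : ∑ c, coef α h τ c ^ 2 = ∑ j ∈ Finset.range (h + 1), (α ^ 2) ^ j := by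
    simp_rw [coef_sq]
    rw [Fintype.sum_option, Fintype.sum_prod_type, Finset.sum_range_succ, add_comm]
    congr 1
    have h₁ : ∀ t : Fin H, ∑ y, coef (α ^ 2) h τ (some (t, y)) =
        if t.1 < h.1 then (α ^ 2) ^ ((h : ℕ) - 1 - t) else 0 := by
      intro t
      by_cases ht : t.1 < h.1
      · rw [Finset.sum_eq_single (τ ⟨t, ht⟩)]
        · simp [coef, ht]
        · intro y _ hy
          simp [coef, ht, Ne.symm hy]
        · simp
      · simp [coef, ht]
    rw [Finset.sum_congr rfl fun t _ => h₁ t,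
      Fin.sum_univ_eq_sum_range (fun t => if t < h.1 then (α ^ 2) ^ ((h : ℕ) - 1 - t) else 0) H,
      ← Finset.sum_filter, ← Finset.sum_range_reflect]
    refine Finset.sum_congr ?_ fun _ _ => rfl
    ext t
    simp only [Finset.mem_filter, Finset.mem_range]
    exact ⟨fun h' => h'.2, fun h' => ⟨h'.trans h.2, h'⟩⟩
  rw [h₁, effHorizon]
  calc ∑ j ∈ Finset.range (h + 1), (α ^ 2) ^ j ≤ ∑ j ∈ Finset.range (h + 1), α ^ j := by
        refine Finset.sum_le_sum fun j _ => pow_le_pow_left₀ (sq_nonneg α) ?_ j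
        nlinarith
    _ ≤ _ := Finset.sum_le_sum_of_subset_of_nonneg
        (Finset.range_subset_range.2 (by have := h.2; omega)) fun j _ _ => pow_nonneg hα j

end SuffStat

/-! ### Optimistic planning -/

section Planner

variable {S : Type*} {A : Type*} {M H : ℕ}

lemma PlanInput.ci_zero (p : PlanInput S A M H) (α : ℝ) (hH : 0 < H)
    (τ : Fin ((⟨0, hH⟩ : Fin H) : ℕ) → Triple S A M) :
    p.ci α ⟨0, hH⟩ τ = (p.lo none, p.up none) := by
  simp [PlanInput.ci, suffStat_zero]

lemma PlanInput.ci_succ (p : PlanInput S A M H) (α : ℝ) (h : ℕ) (hh : h + 1 < H)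
    (τ : Fin h → Triple S A M) (y : Triple S A M) :
    p.ci α ⟨h + 1, hh⟩ (Fin.snoc (α := fun _ => Triple S A M) τ y) =
      p.next α (some (⟨h, Nat.lt_of_succ_lt hh⟩, y)) (p.ci α ⟨h, Nat.lt_of_succ_lt hh⟩ τ) := by
  refine Prod.ext ?_ ?_ <;> funext i <;> exact suffStat_succ _ _ _ _ _ _ _

variable [Fintype S]

lemma Model.stepExp_eq (m : Model S A M H) (h : Fin H) (τ : Fin h → Triple S A M) (s : S)
    (a : A) (F : Triple S A M → S → ℝ) :
    m.stepExp h τ s a F = ∑ x, softmax (temp m.α H) (suffStat m.α m.f h τ) x *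
      expect (m.P h s a x) fun s' => F (s, a, x) s' :=
  expect_softmaxPMF _ _ _

lemma PlanInput.vBar_of_lt (p : PlanInput S A M H) (α : ℝ) {h : ℕ} (hh : h < H) (s : S)
    (I : (Fin M → ℝ) × (Fin M → ℝ)) :
    p.vBar α h s I =
      min (⨆ a : A, thrMax (temp α H) (p.qBar α (p.vBar α (h + 1)) ⟨h, hh⟩ s a I) I) H := by
  rw [PlanInput.vBar, dif_pos hh]

lemma PlanInput.vBar_of_ge (p : PlanInput S A M H) (α : ℝ) {h : ℕ} (hh : H ≤ h) (s : S)
    (I : (Fin M → ℝ) × (Fin M → ℝ)) : p.vBar α h s I = 0 := by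
  rw [PlanInput.vBar, dif_neg hh.not_gt]

lemma PlanInput.vBar_le (p : PlanInput S A M H) (α : ℝ) (h : ℕ) (s : S)
    (I : (Fin M → ℝ) × (Fin M → ℝ)) : p.vBar α h s I ≤ H := by
  rcases lt_or_ge h H with hh | hh
  · rw [p.vBar_of_lt α hh]
    exact min_le_right _ _
  · rw [p.vBar_of_ge α hh]
    positivity

variable [Fintype A] [Nonempty A]

lemma PlanInput.vBar_nonneg (p : PlanInput S A M H) (α : ℝ)
    (hr : ∀ h s a x, 0 ≤ p.rbar h s a x) (hP : ∀ h s a x s', 0 ≤ p.phat h s a x s') (h : ℕ) (s : S)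
    (I : (Fin M → ℝ) × (Fin M → ℝ)) : 0 ≤ p.vBar α h s I := by
  have key : ∀ n h : ℕ, H - h ≤ n → ∀ s I, 0 ≤ p.vBar α h s I := by
    intro n
    induction n with
    | zero =>
      intro h hn s I
      rw [p.vBar_of_ge α (by omega)]
    | succ n ih =>
      intro h hn s I
      rcases lt_or_ge h H with hh | hh
      · rw [p.vBar_of_lt α hh]
        refine le_min ?_ (Nat.cast_nonneg H)
        refine Real.iSup_nonneg fun a => Real.iSup_nonneg fun j =>
          Finset.sum_nonneg fun x _ => mul_nonneg (softmax_nonneg _ _ _) ?_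
        exact add_nonneg (hr _ _ _ _) (Finset.sum_nonneg fun s' _ =>
          mul_nonneg (hP _ _ _ _ _) (ih (h + 1) (by omega) s' _))
      · rw [p.vBar_of_ge α hh]
  exact key _ h le_rfl s I

/-- The optimistic value along a history. -/
noncomputable def PlanInput.histValue (p : PlanInput S A M H) (α : ℝ) (h : ℕ) (_ : h ≤ H)
    (τ : Fin h → Triple S A M) (s : S) : ℝ :=
  if hlt : h < H then p.vBar α h s (p.ci α ⟨h, hlt⟩ τ) else 0

lemma PlanInput.histValue_succ (p : PlanInput S A M H) (α : ℝ) (h : Fin H)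
    (τ : Fin h → Triple S A M) (y : Triple S A M) (s' : S) :
    p.histValue α (h + 1) h.2 (Fin.snoc (α := fun _ => Triple S A M) τ y) s' =
      p.vBar α (h + 1) s' (p.next α (some (h, y)) (p.ci α h τ)) := by
  obtain ⟨h, hh⟩ := h
  by_cases hlt : h + 1 < H
  · rw [PlanInput.histValue, dif_pos hlt, PlanInput.ci_succ]
  · rw [PlanInput.histValue, dif_neg hlt, p.vBar_of_ge α (not_lt.1 hlt)]

/-- The planner's input is consistent with the model: the optimistic rewards compensate the
errors of the transitions and the confidence intervals contain the features that matter. -/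
structure PlanInput.IsValid (p : PlanInput S A M H) (m : Model S A M H)
    (D : Fin H → Triple S A M → ℝ) (wd : Coord S A M H → ℝ) : Prop where
  rbar_nonneg : ∀ h s a x, 0 ≤ p.rbar h s a x
  phat_nonneg : ∀ h s a x s', 0 ≤ p.phat h s a x s'
  le_optimistic : ∀ h s a x (V : S → ℝ), (∀ s', 0 ≤ V s') → (∀ s', V s' ≤ H) →
    m.r h s a x + expect (m.P h s a x) V ≤ p.rbar h s a x + ∑ s', p.phat h s a x s' * V s'
  optimistic_le : ∀ h s a x (V : S → ℝ), (∀ s', 0 ≤ V s') → (∀ s', V s' ≤ H) →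
    p.rbar h s a x + ∑ s', p.phat h s a x s' * V s' ≤
      m.r h s a x + expect (m.P h s a x) V + D h (s, a, x)
  optimistic_le_const : ∀ h s a x (V : S → ℝ), (∀ s', 0 ≤ V s') → (∀ s', V s' ≤ H) →
    p.rbar h s a x + ∑ s', p.phat h s a x s' * V s' ≤ 5 * H
  -- The intervals need to be correct only at coordinates that enter a sufficient statistic: time
  -- zero and the times before the last step.
  lo_none_le : ∀ i, p.lo none i ≤ m.f none i
  le_up_none : ∀ i, m.f none i ≤ p.up none i
  lo_le : ∀ (h : Fin H) y i, (h : ℕ) + 1 < H → p.lo (some (h, y)) i ≤ m.f (some (h, y)) i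
  le_up : ∀ (h : Fin H) y i, (h : ℕ) + 1 < H → m.f (some (h, y)) i ≤ p.up (some (h, y)) i
  width_nonneg : ∀ c, 0 ≤ wd c
  up_eq : ∀ c i, p.up c i = p.lo c i + 2 * wd c

variable {p : PlanInput S A M H} {m : Model S A M H} {D : Fin H → Triple S A M → ℝ}
  {wd : Coord S A M H → ℝ}

lemma PlanInput.IsValid.ci_le (hp : p.IsValid m D wd) (h : Fin H) (τ : Fin h → Triple S A M)
    (i : Fin M) : (p.ci m.α h τ).1 i ≤ suffStat m.α m.f h τ i :=
  suffStat_mono m.α_nonneg h τ i (hp.lo_none_le i) fun t =>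
    hp.lo_le _ _ _ ((Nat.succ_le_of_lt t.2).trans_lt h.2)

lemma PlanInput.IsValid.le_ci (hp : p.IsValid m D wd) (h : Fin H) (τ : Fin h → Triple S A M)
    (i : Fin M) : suffStat m.α m.f h τ i ≤ (p.ci m.α h τ).2 i :=
  suffStat_mono m.α_nonneg h τ i (hp.le_up_none i) fun t =>
    hp.le_up _ _ _ ((Nat.succ_le_of_lt t.2).trans_lt h.2)

/-- The width of the interval is itself a sufficient statistic, of the nonnegative widths `2 * wd`;
the discount powers are then bounded by one. -/
lemma PlanInput.IsValid.ci_sub_le (hp : p.IsValid m D wd) (h : Fin H) (τ : Fin h → Triple S A M)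
    (i : Fin M) : (p.ci m.α h τ).2 i - (p.ci m.α h τ).1 i ≤
      2 * (wd none + ∑ t : Fin h, wd (some (⟨t, t.2.trans h.2⟩, τ t))) := by
  have h₁ : p.up = fun c i => p.lo c i + (fun c (_ : Fin M) => 2 * wd c) c i := by
    funext c i
    exact hp.up_eq c i
  have h₂ := suffStat_add m.α p.lo (fun c (_ : Fin M) => 2 * wd c) h τ
  rw [← h₁] at h₂
  have h₃ := suffStat_le (f := fun c (_ : Fin M) => 2 * wd c) m.α_nonneg m.α_le_one
    (fun c _ => mul_nonneg zero_le_two (hp.width_nonneg c)) h τ i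
  simp only [PlanInput.ci, h₂]
  rw [mul_add, Finset.mul_sum]
  linarith

/-- The value of every policy is at most the optimistic value. -/
lemma PlanInput.IsValid.value_le (hp : p.IsValid m D wd) (hM : 1 ≤ M) (hH : 1 ≤ H)
    (π : Policy S A M H) (s₀ : S) : m.value π s₀ ≤ p.vBar m.α 0 s₀ (p.lo none, p.up none) := by
  have hη : 0 ≤ temp m.α H := (temp_pos m.α_nonneg hH).le
  have hV0 := p.vBar_nonneg m.α hp.rbar_nonneg hp.phat_nonneg
  have key := m.expect_sum_add_le π s₀ (fun h _ y _ => m.r h y.1 y.2.1 y.2.2)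
    -- The cap `H - h` bounds the reward that remains; it carries the induction through the
    -- truncation of the optimistic value at `H`.
    (fun h hh τ s => min (p.histValue m.α h hh τ s) ((H : ℝ) - h)) (by
      intro h τ s a
      rw [m.stepExp_eq]
      refine le_min ?_ ?_
      · have hv : p.histValue m.α h h.2.le τ s = p.vBar m.α h s (p.ci m.α h τ) := by
          rw [PlanInput.histValue, dif_pos h.2]
        rw [hv, p.vBar_of_lt m.α h.2, le_min_iff]
        have hin : ∀ x, expect (m.P h s a x) (fun s' => m.r h s a x + min (p.histValue m.α (h + 1) h.2
            (Fin.snoc (α := fun _ => Triple S A M) τ (s, a, x)) s') ((H : ℝ) - ((h : ℕ) + 1 : ℕ))) ≤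
            p.qBar m.α (p.vBar m.α (h + 1)) h s a (p.ci m.α h τ) x := by
          intro x
          rw [expect_add, expect_const]
          refine le_trans ?_ (hp.le_optimistic h s a x
            (fun s' => p.vBar m.α (h + 1) s' (p.next m.α (some (h, s, a, x)) (p.ci m.α h τ)))
            (fun s' => hV0 _ _ _) fun s' => p.vBar_le _ _ _ _)
          refine add_le_add_right (expect_mono fun s' => ?_) _
          rw [← p.histValue_succ]
          exact min_le_left _ _
        constructor
        · refine le_trans ?_ (le_ciSup (Set.finite_range _).bddAbove a)
          refine le_trans ?_ (sum_softmax_mul_le_thrMax hη hM _ (hp.ci_le h τ) (hp.le_ci h τ))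
          exact Finset.sum_le_sum fun x _ => mul_le_mul_of_nonneg_left (hin x) (softmax_nonneg _ _ _)
        · refine sum_softmax_mul_le_of_le fun x => ?_
          refine expect_le_of_le fun s' => ?_
          have h₁ := min_le_right (p.histValue m.α (h + 1) h.2
            (Fin.snoc (α := fun _ => Triple S A M) τ (s, a, x)) s') ((H : ℝ) - ((h : ℕ) + 1 : ℕ))
          have h₂ := m.r_le_one h s a x
          push_cast at h₁ ⊢
          have h₃ : (0 : ℝ) ≤ (h : ℕ) := Nat.cast_nonneg _
          linarith
      · refine sum_softmax_mul_le_of_le fun x => ?_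
        refine expect_le_of_le fun s' => ?_
        have h₁ := min_le_right (p.histValue m.α (h + 1) h.2
          (Fin.snoc (α := fun _ => Triple S A M) τ (s, a, x)) s') ((H : ℝ) - ((h : ℕ) + 1 : ℕ))
        have h₂ := m.r_le_one h s a x
        push_cast at h₁ ⊢
        linarith)
  have h₁ : ∀ e : Episode S A M H, (∑ h : Fin H, m.r h (e.1 h).1 (e.1 h).2.1 (e.1 h).2.2 +
      min (p.histValue m.α H le_rfl e.1 e.2) ((H : ℝ) - (H : ℕ))) = m.totalReward e := by
    intro e
    rw [PlanInput.histValue, dif_neg (lt_irrefl H)]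
    simp [Model.totalReward]
  simp only [h₁] at key
  refine key.trans ((min_le_left _ _).trans_eq ?_)
  rw [PlanInput.histValue, dif_pos (show 0 < H from hH), PlanInput.ci_zero]

/-- The error of the optimistic planner at one step. -/
noncomputable def stepError (α : ℝ) (D : Fin H → Triple S A M → ℝ) (wd : Coord S A M H → ℝ)
    (h : Fin H) (τ : Fin h → Triple S A M) (y : Triple S A M) : ℝ :=
  D h y + min (5 * (H : ℝ)) (40 * H * temp α H *
    (wd none + ∑ t : Fin h, wd (some (⟨t, t.2.trans h.2⟩, τ t))))

/-- The sum of the errors of the optimistic planner along an episode. -/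
noncomputable def episodeError (α : ℝ) (D : Fin H → Triple S A M → ℝ) (wd : Coord S A M H → ℝ)
    (e : Episode S A M H) : ℝ :=
  ∑ h : Fin H, stepError α D wd h (e.hist h) (e.1 h)

/-- The optimistic value exceeds the value of the greedy policy by at most the expected error. -/
lemma PlanInput.IsValid.vBar_le (hp : p.IsValid m D wd) (hM : 1 ≤ M) (hH : 1 ≤ H)
    (g : (h : Fin H) → (Fin h → Triple S A M) → S → A)
    (hg : ∀ h τ s a, p.score m.α h τ s a ≤ p.score m.α h τ s (g h τ s)) (s₀ : S) :
    p.vBar m.α 0 s₀ (p.lo none, p.up none) ≤ m.value (fun h τ s => PMF.pure (g h τ s)) s₀ +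
      expect (m.episodeLaw (fun h τ s => PMF.pure (g h τ s)) s₀) (episodeError m.α D wd) := by
  have hη : 0 ≤ temp m.α H := (temp_pos m.α_nonneg hH).le
  have hV0 := p.vBar_nonneg m.α hp.rbar_nonneg hp.phat_nonneg
  have key := m.le_expect_sum_add (fun h τ s => PMF.pure (g h τ s)) s₀
    (fun h τ y _ => m.r h y.1 y.2.1 y.2.2 + stepError m.α D wd h τ y)
    (fun h hh τ s => p.histValue m.α h hh τ s) (by
      intro h τ s
      rw [expect_pure, m.stepExp_eq]
      set a := g h τ s
      set Q := p.qBar m.α (p.vBar m.α (h + 1)) h s a (p.ci m.α h τ) with hQ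
      have hv : p.histValue m.α h h.2.le τ s = p.vBar m.α h s (p.ci m.α h τ) := by
        rw [PlanInput.histValue, dif_pos h.2]
      rw [hv, p.vBar_of_lt m.α h.2]
      refine (min_le_left _ _).trans ((ciSup_le (hg h τ s)).trans ?_)
      set E := min (5 * (H : ℝ)) (40 * H * temp m.α H *
        (wd none + ∑ t : Fin h, wd (some (⟨t, t.2.trans h.2⟩, τ t)))) with hE
      have hQ0 : ∀ x, 0 ≤ Q x := fun x => add_nonneg (hp.rbar_nonneg _ _ _ _)
        (Finset.sum_nonneg fun s' _ => mul_nonneg (hp.phat_nonneg _ _ _ _ _) (hV0 _ _ _))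
      have hQ5 : ∀ x, Q x ≤ 5 * H := fun x => hp.optimistic_le_const h s a x
        (fun s' => p.vBar m.α (h + 1) s' (p.next m.α (some (h, s, a, x)) (p.ci m.α h τ)))
        (fun s' => hV0 _ _ _) fun s' => p.vBar_le _ _ _ _
      have hthr : thrMax (temp m.α H) Q (p.ci m.α h τ) ≤
          ∑ x, softmax (temp m.α H) (suffStat m.α m.f h τ) x * Q x + E := by
        -- The threshold vector and the true statistic lie in the same cuboid, so they differ by at
        -- most its width. With the bound `5 * H` for `Q`, the Lipschitz constant is `4 * 5 * 2 =
        -- 40` times `H * temp`.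
        refine thrMax_le hM fun j => ?_
        refine (sum_softmax_mul_le_add hη (v := suffStat m.α m.f h τ)
          (ε := 2 * (wd none + ∑ t : Fin h, wd (some (⟨t, t.2.trans h.2⟩, τ t)))) ?_ ?_ hQ0
          hQ5).trans ?_
        · exact mul_nonneg zero_le_two (add_nonneg (hp.width_nonneg _)
            (Finset.sum_nonneg fun t _ => hp.width_nonneg _))
        · intro i
          have h₁ := hp.ci_le h τ i
          have h₂ := hp.le_ci h τ i
          have h₃ := hp.ci_sub_le h τ i
          rw [abs_le, thr]
          split_ifs <;> constructor <;> linarith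
        · rw [hE]
          refine add_le_add_right (min_le_min le_rfl (le_of_eq ?_)) _
          ring
      refine hthr.trans ?_
      have hsum : E = ∑ x, softmax (temp m.α H) (suffStat m.α m.f h τ) x * E := by
        rw [← Finset.sum_mul, sum_softmax, one_mul]
      conv_lhs => rw [hsum]
      rw [← Finset.sum_add_distrib]
      refine Finset.sum_le_sum fun x _ => ?_
      rw [← mul_add]
      refine mul_le_mul_of_nonneg_left ?_ (softmax_nonneg _ _ _)
      simp only [p.histValue_succ]
      rw [expect_add, expect_const, stepError, ← hE]
      have := hp.optimistic_le h s a x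
        (fun s' => p.vBar m.α (h + 1) s' (p.next m.α (some (h, s, a, x)) (p.ci m.α h τ)))
        (fun s' => hV0 _ _ _) fun s' => p.vBar_le _ _ _ _
      rw [hQ, PlanInput.qBar]
      linarith)
  have h₁ : ∀ e : Episode S A M H, (∑ h : Fin H, (m.r h (e.1 h).1 (e.1 h).2.1 (e.1 h).2.2 +
      stepError m.α D wd h (e.hist h) (e.1 h)) +
      p.histValue m.α H le_rfl e.1 e.2) = m.totalReward e + episodeError m.α D wd e := by
    intro e
    rw [PlanInput.histValue, dif_neg (lt_irrefl H), Finset.sum_add_distrib, add_zero]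
    rfl
  simp only [h₁] at key
  rw [expect_add] at key
  refine le_trans (le_of_eq ?_) key
  rw [PlanInput.histValue, dif_pos (show 0 < H from hH), PlanInput.ci_zero]

/-- The regret of the greedy policy is at most the expected error of the planner. -/
lemma PlanInput.IsValid.optimalValue_sub_le (hp : p.IsValid m D wd) (hM : 1 ≤ M) (hH : 1 ≤ H)
    (g : (h : Fin H) → (Fin h → Triple S A M) → S → A)
    (hg : ∀ h τ s a, p.score m.α h τ s a ≤ p.score m.α h τ s (g h τ s)) (s₀ : S) :
    m.optimalValue s₀ - m.value (fun h τ s => PMF.pure (g h τ s)) s₀ ≤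
      expect (m.episodeLaw (fun h τ s => PMF.pure (g h τ s)) s₀) (episodeError m.α D wd) := by
  have : Nonempty (Policy S A M H) := ⟨fun h τ s => PMF.pure (g h τ s)⟩
  have h₁ : m.optimalValue s₀ ≤ p.vBar m.α 0 s₀ (p.lo none, p.up none) :=
    ciSup_le fun π => hp.value_le hM hH π s₀
  linarith [hp.vBar_le hM hH g hg s₀]

end Planner

/-! ### Concentration of the empirical transitions -/

section Hoeffding

variable {α : Type*} [Fintype α]

/-- The exponential moments of a centred variable with values in `[-1, 1]`. -/
lemma expect_exp_mul_le {p : PMF α} {X : α → ℝ} (hX : ∀ a, |X a| ≤ 1) (hp : expect p X = 0)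
    (t : ℝ) : expect p (fun a => Real.exp (t * X a)) ≤ Real.exp (t ^ 2 / 2) := by
  calc expect p (fun a => Real.exp (t * X a))
      ≤ expect p (fun a => Real.cosh t + Real.sinh t * X a) := by
        refine expect_mono fun a => ?_
        rw [mul_comm t, mul_comm (Real.sinh t)]
        exact Real.exp_mul_le_cosh_add_mul_sinh (hX a) t
    _ = Real.cosh t := by rw [expect_add, expect_const, expect_mul_left, hp]; ring
    _ ≤ _ := Real.cosh_le_exp_half_sq t

end Hoeffding

section Transitions

variable {S : Type*} {A : Type*} {M H : ℕ} [Fintype S] [Fintype A] [DecidableEq S]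
  [DecidableEq A]

/-- The exponent of the exponential supermartingale of the transitions into a set. -/
noncomputable def Model.transExponent (m : Model S A M H) (h₀ : Fin H) (y₀ : Triple S A M)
    (B : Finset S) (u : ℝ) (h : Fin H) (y : Triple S A M) (s' : S) : ℝ :=
  if h = h₀ ∧ y = y₀ then u * ((if s' ∈ B then 1 else 0) -
    ∑ b ∈ B, (m.P h₀ y₀.1 y₀.2.1 y₀.2.2 b).toReal) - u ^ 2 / 2 else 0

/-- At the tracked triple the centred indicator has values in `[-1, 1]` and conditional mean zero,
so Hoeffding's bound cancels the compensator `u ^ 2 / 2`; at all other triples the exponent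
vanishes. -/
lemma Model.stepExp_transExponent_le (m : Model S A M H) (h₀ : Fin H) (y₀ : Triple S A M)
    (B : Finset S) (u : ℝ) (h : Fin H) (τ : Fin h → Triple S A M) (s : S) (a : A) :
    m.stepExp h τ s a (fun y s' => Real.exp (m.transExponent h₀ y₀ B u h y s')) ≤ 1 := by
  refine expect_le_of_le fun x => ?_
  by_cases hc : h = h₀ ∧ (s, a, x) = y₀
  · obtain ⟨rfl, rfl⟩ := hc
    simp only [transExponent, and_self, if_true]
    set q := m.P h s a x with hq
    set c := ∑ b ∈ B, (q b).toReal with hc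
    have hmean : expect q (fun s' => (if s' ∈ B then (1 : ℝ) else 0)) = c := by
      simp [expect, hc]
    have hc0 : 0 ≤ c := Finset.sum_nonneg fun _ _ => ENNReal.toReal_nonneg
    have hc1 : c ≤ 1 := by
      rw [← hmean]
      refine expect_le_of_le fun s' => ?_
      split_ifs <;> norm_num
    have h₁ := expect_exp_mul_le (p := q) (X := fun s' => (if s' ∈ B then (1 : ℝ) else 0) + -c)
      (by intro s'; rw [abs_le]; split_ifs <;> constructor <;> linarith)
      (by rw [expect_add, expect_const, hmean]; ring) u
    simp only [sub_eq_add_neg, Real.exp_add]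
    have h₂ : ∀ s', Real.exp (u * ((if s' ∈ B then (1 : ℝ) else 0) + -c)) *
        Real.exp (-(u ^ 2 / 2)) = Real.exp (-(u ^ 2 / 2)) *
        Real.exp (u * ((if s' ∈ B then (1 : ℝ) else 0) + -c)) := fun s' => mul_comm _ _
    simp only [h₂]
    rw [expect_mul_left]
    calc _ ≤ Real.exp (-(u ^ 2 / 2)) * Real.exp (u ^ 2 / 2) := by gcongr
      _ = 1 := by rw [← Real.exp_add]; simp
  · simp only [transExponent, hc, if_false, Real.exp_zero]
    rw [expect_const]

/-- The deviation of an empirical transition probability, in terms of the exponents. -/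
lemma Model.sum_transExponent (m : Model S A M H) {k : ℕ} (past : Fin k → Episode S A M H)
    (h : Fin H) (s : S) (a : A) (x : Fin (M + 1)) (B : Finset S) (u : ℝ)
    (hv : 0 < visits past (some (h, s, a, x))) :
    ∑ j, ∑ t : Fin H, m.transExponent h (s, a, x) B u t ((past j).1 t) ((past j).state (t + 1)) =
      visits past (some (h, s, a, x)) *
        (u * ∑ b ∈ B, (pHat past h s a x b - (m.P h s a x b).toReal) - u ^ 2 / 2) := by
  set n := visits past (some (h, s, a, x)) with hn
  have h₁ : ∀ j, ∑ t : Fin H, m.transExponent h (s, a, x) B u t ((past j).1 t)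
      ((past j).state (t + 1)) =
      u * (∑ b ∈ B, if (past j).1 h = (s, a, x) ∧ (past j).state (h + 1) = b then (1 : ℝ) else 0) -
        (if (past j).1 h = (s, a, x) then (1 : ℝ) else 0) *
        (u * ∑ b ∈ B, (m.P h s a x b).toReal + u ^ 2 / 2) := by
    intro j
    rw [Finset.sum_eq_single h]
    · by_cases hc : (past j).1 h = (s, a, x)
      · simp only [transExponent, hc, and_self, if_true, true_and, Finset.sum_ite_eq]
        ring
      · simp [transExponent, hc]
    · intro t _ ht
      simp [transExponent, ht]
    · simp
  have h₂ : ∑ j, (if (past j).1 h = (s, a, x) then (1 : ℝ) else 0) = n := by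
    simp [hn, visits]
  have h₃ : ∀ b, ∑ j, (if (past j).1 h = (s, a, x) ∧ (past j).state (h + 1) = b then (1 : ℝ)
      else 0) = n * pHat past h s a x b := by
    intro b
    rw [pHat, ← hn, mul_div_cancel₀]
    exact (Nat.cast_pos.2 hv).ne'
  rw [Finset.sum_congr rfl fun j _ => h₁ j, Finset.sum_sub_distrib, ← Finset.mul_sum,
    Finset.sum_comm, Finset.sum_congr rfl fun b _ => h₃ b, ← Finset.sum_mul, h₂,
    Finset.sum_sub_distrib, ← Finset.mul_sum]
  ring

/-- The event that all the empirical transition probabilities of sets are accurate. -/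
def Model.TransAccurate (m : Model S A M H) (ε : ℝ) {k : ℕ} (past : Fin k → Episode S A M H) :
    Prop :=
  ∀ (h : Fin H) (s : S) (a : A) (x : Fin (M + 1)) (B : Finset S),
    0 < visits past (some (h, s, a, x)) →
      ∑ b ∈ B, (pHat past h s a x b - (m.P h s a x b).toReal) ≤
        √(ε / visits past (some (h, s, a, x)))

lemma visits_le {k : ℕ} (past : Fin k → Episode S A M H) (c : Coord S A M H) :
    visits past c ≤ k := by
  rcases c with _ | c
  · exact le_rfl
  · exact (Finset.card_filter_le _ _).trans_eq (by simp)

/-- A Chernoff bound with tilt `√(ε / n)`, adapted to `n` visits. Since the number of visits is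
random, the union runs over its `K` possible positive values, besides the times, the triples and the
`2 ^ |S|` sets of states. -/
lemma Model.prob_not_transAccurate_le (m : Model S A M H)
    (init : (k : ℕ) → (Fin k → Episode S A M H) → PMF S) (ℓ : Learner S A M H) (K : ℕ) {ε : ℝ}
    (hε : 0 < ε) :
    prob (m.runLaw init ℓ K) {ω | ∃ k, ∃ hk : k ≤ K, ¬ m.TransAccurate ε (firstEpisodes ω k hk)} ≤
      (H * (Fintype.card S * (Fintype.card A * (M + 1))) * (2 ^ Fintype.card S * K) : ℝ) *
        Real.exp (-(ε / 2)) := by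
  have key := m.prob_exists_log_lt_sum_le init ℓ K
    (Finset.univ : Finset ((Fin H × Triple S A M) × (Finset S × Fin K))) (fun _ => 1)
    (fun _ _ => one_pos)
    (fun ξ _ _ e => ∑ t : Fin H, m.transExponent ξ.1.1 ξ.1.2 ξ.2.1 √(ε / (ξ.2.2 + 1 : ℕ)) t (e.1 t)
      (e.state (t + 1)))
    (fun ξ _ k past s₀ => m.expect_exp_sum_le_one (ℓ.policy k past) s₀
      (fun h _ y s' => m.transExponent ξ.1.1 ξ.1.2 ξ.2.1 √(ε / (ξ.2.2 + 1 : ℕ)) h y s')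
      (fun h τ s a => m.stepExp_transExponent_le _ _ _ _ h τ s a)) (ε / 2)
  refine (prob_mono ?_).trans (key.trans (le_of_eq ?_))
  · rintro ω ⟨k, hk, hω⟩
    simp only [TransAccurate, not_forall, not_le] at hω
    obtain ⟨h, s, a, x, B, hv, hlt⟩ := hω
    have hvk := (visits_le (firstEpisodes ω k hk) (some (h, s, a, x))).trans hk
    -- The element `n - 1` of `Fin K` encodes `n` visits.
    refine ⟨k, hk, ⟨(h, s, a, x), B, ⟨visits (firstEpisodes ω k hk) (some (h, s, a, x)) - 1,
      by omega⟩⟩, Finset.mem_univ _, ?_⟩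
    have h₁ := m.sum_transExponent (firstEpisodes ω k hk) h s a x B
      √(ε / visits (firstEpisodes ω k hk) (some (h, s, a, x))) hv
    simp only [Nat.sub_add_cancel (Nat.succ_le_of_lt hv), Real.log_one, sub_zero]
    refine lt_of_lt_of_eq ?_ h₁.symm
    set n := visits (firstEpisodes ω k hk) (some (h, s, a, x))
    have hn : (0 : ℝ) < n := Nat.cast_pos.2 hv
    set u := √(ε / n) with hu
    have hu0 : 0 < u := by positivity
    have hsq : n * u ^ 2 = ε := by
      rw [hu, Real.sq_sqrt (by positivity), mul_div_cancel₀ _ hn.ne']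
    have := mul_lt_mul_of_pos_left hlt (mul_pos hn hu0)
    nlinarith
  · simp

lemma pHat_nonneg {k : ℕ} (past : Fin k → Episode S A M H) (h : Fin H) (s : S) (a : A)
    (x : Fin (M + 1)) (s' : S) : 0 ≤ pHat past h s a x s' := by
  refine div_nonneg (Finset.sum_nonneg fun j _ => ?_) (Nat.cast_nonneg _)
  split_ifs <;> norm_num

lemma sum_pHat {k : ℕ} (past : Fin k → Episode S A M H) (h : Fin H) (s : S) (a : A)
    (x : Fin (M + 1)) (hv : 0 < visits past (some (h, s, a, x))) :
    ∑ s', pHat past h s a x s' = 1 := by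
  have hnr : (visits past (some (h, s, a, x)) : ℝ) ≠ 0 := (Nat.cast_pos.2 hv).ne'
  simp only [pHat]
  rw [← Finset.sum_div, Finset.sum_comm, div_eq_one_iff_eq hnr, visits]
  rw [Finset.card_filter, Nat.cast_sum]
  refine Finset.sum_congr rfl fun j _ => ?_
  by_cases hc : (past j).1 h = (s, a, x) <;> simp [hc]

lemma sum_pHat_mul_le {k : ℕ} (past : Fin k → Episode S A M H) (h : Fin H) (s : S) (a : A)
    (x : Fin (M + 1)) {V : S → ℝ} {c : ℝ} (hc : 0 ≤ c) (hV : ∀ s', V s' ≤ c) :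
    ∑ s', pHat past h s a x s' * V s' ≤ c := by
  rcases Nat.eq_zero_or_pos (visits past (some (h, s, a, x))) with h0 | hpos
  · have h₁ : ∀ s', pHat past h s a x s' = 0 := by
      intro s'
      rw [pHat, h0]
      simp
    simpa [h₁] using hc
  · calc _ ≤ ∑ s', pHat past h s a x s' * c := Finset.sum_le_sum fun s' _ =>
          mul_le_mul_of_nonneg_left (hV s') (pHat_nonneg past h s a x s')
      _ = c := by rw [← Finset.sum_mul, sum_pHat past h s a x hpos, one_mul]

/-- The error of an expectation under the empirical transition probabilities. -/
lemma Model.TransAccurate.abs_sub_le {m : Model S A M H} {ε : ℝ} {k : ℕ}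
    {past : Fin k → Episode S A M H} (hm : m.TransAccurate ε past) (hε : 1 ≤ ε)
    (h : Fin H) (s : S) (a : A) (x : Fin (M + 1)) {V : S → ℝ} (hV0 : ∀ s', 0 ≤ V s')
    (hV : ∀ s', V s' ≤ H) :
    |∑ s', pHat past h s a x s' * V s' - expect (m.P h s a x) V| ≤
      min (H * √(ε / (max (visits past (some (h, s, a, x))) 1 : ℕ))) (2 * H) := by
  set n := visits past (some (h, s, a, x)) with hn
  set P := fun s' => (m.P h s a x s').toReal with hP
  have hHr : (0 : ℝ) ≤ H := Nat.cast_nonneg H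
  have hE0 : 0 ≤ expect (m.P h s a x) V := le_expect_of_le hV0
  have hE1 : expect (m.P h s a x) V ≤ H := expect_le_of_le hV
  rcases Nat.eq_zero_or_pos n with h0 | hpos
  · have h₁ : ∀ s', pHat past h s a x s' = 0 := by
      intro s'
      rw [pHat, ← hn, h0]
      simp
    -- Without visits the estimate is zero and the error is at most `H`, which `1 ≤ ε` makes smaller
    -- than the bonus.
    have h₂ : 1 ≤ √ε := Real.one_le_sqrt.2 hε
    simp only [h₁, zero_mul, Finset.sum_const_zero, zero_sub, abs_neg, abs_of_nonneg hE0, h0]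
    simp only [zero_le, sup_of_le_right, Nat.cast_one, div_one]
    exact le_min (by nlinarith) (by linarith)
  · have hsum : ∑ s', pHat past h s a x s' = 1 := sum_pHat past h s a x hpos
    have hsumP : ∑ s', P s' = 1 := sum_toReal_eq_one _
    have hph0 : ∀ s', 0 ≤ pHat past h s a x s' := pHat_nonneg past h s a x
    have hmax : max n 1 = n := max_eq_left hpos
    rw [hmax]
    have hdiff : ∑ s', pHat past h s a x s' * V s' - expect (m.P h s a x) V =
        ∑ s', (pHat past h s a x s' - P s') * V s' := by
      rw [expect, ← Finset.sum_sub_distrib]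
      exact Finset.sum_congr rfl fun s' _ => by rw [hP]; ring
    -- On `B` the estimate is at least the truth. The positive and negative parts of the difference
    -- have equal mass, so for `0 ≤ V ≤ H` one set controls the error in both directions.
    have hup : ∀ B : Finset S, (∀ s', s' ∈ B ↔ 0 ≤ pHat past h s a x s' - P s') →
        |∑ s', (pHat past h s a x s' - P s') * V s'| ≤
          H * ∑ b ∈ B, (pHat past h s a x b - P b) := by
      intro B hB
      have hB' : ∑ b ∈ B, (pHat past h s a x b - P b) +
          ∑ b ∈ Bᶜ, (pHat past h s a x b - P b) = 0 := by
        rw [Finset.sum_add_sum_compl, Finset.sum_sub_distrib, hsum, hsumP, sub_self]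
      rw [← Finset.sum_add_sum_compl B]
      have h₁ : ∑ b ∈ B, (pHat past h s a x b - P b) * V b ≤
          ∑ b ∈ B, (pHat past h s a x b - P b) * H := Finset.sum_le_sum fun b hb =>
        mul_le_mul_of_nonneg_left (hV b) ((hB b).1 hb)
      have h₂ : 0 ≤ ∑ b ∈ B, (pHat past h s a x b - P b) * V b := Finset.sum_nonneg fun b hb =>
        mul_nonneg ((hB b).1 hb) (hV0 b)
      have hneg : ∀ b ∈ Bᶜ, pHat past h s a x b - P b ≤ 0 := fun b hb =>
        (not_le.1 fun h' => Finset.mem_compl.1 hb ((hB b).2 h')).le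
      have h₃ : ∑ b ∈ Bᶜ, (pHat past h s a x b - P b) * V b ≤ 0 := Finset.sum_nonpos fun b hb =>
        mul_nonpos_of_nonpos_of_nonneg (hneg b hb) (hV0 b)
      have h₄ : ∑ b ∈ Bᶜ, (pHat past h s a x b - P b) * H ≤
          ∑ b ∈ Bᶜ, (pHat past h s a x b - P b) * V b := Finset.sum_le_sum fun b hb =>
        mul_le_mul_of_nonpos_left (hV b) (hneg b hb)
      rw [← Finset.sum_mul] at h₁ h₄
      rw [abs_le]
      constructor <;> nlinarith
    rw [hdiff]
    refine le_min ?_ ?_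
    · refine (hup (Finset.univ.filter fun s' => 0 ≤ pHat past h s a x s' - P s')
        (by simp)).trans ?_
      exact mul_le_mul_of_nonneg_left (hm h s a x _ hpos) hHr
    · rw [← hdiff]
      have h₁ : ∑ s', pHat past h s a x s' * V s' ≤ H := sum_pHat_mul_le past h s a x hHr hV
      have h₂ : 0 ≤ ∑ s', pHat past h s a x s' * V s' :=
        Finset.sum_nonneg fun s' _ => mul_nonneg (hph0 s') (hV0 s')
      rw [abs_le]
      constructor <;> linarith

end Transitions

/-! ### A lower bound of Hellinger type for cumulant generating functions -/

section Hellinger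

/-- For `z ≥ 0` use `exp z ≥ 1 + z`; for `z < 0` use `exp z ≤ 1 / (1 - z)`. The loss is only linear
in `R`, which keeps the estimation radius polynomial in `L`. -/
lemma div_le_abs_one_sub_exp {z R : ℝ} (hz : |z| ≤ R) : |z| / (1 + R) ≤ |1 - Real.exp z| := by
  have hR : 0 ≤ R := (abs_nonneg z).trans hz
  rw [div_le_iff₀ (by linarith)]
  rcases le_or_gt 0 z with h | h
  · rw [abs_of_nonneg h] at hz ⊢
    have h₁ := Real.add_one_le_exp z
    rw [abs_of_nonpos (by linarith)]
    nlinarith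
  · rw [abs_of_neg h] at hz ⊢
    have h₁ := Real.add_one_le_exp (-z)
    have h₂ : Real.exp z * Real.exp (-z) = 1 := by rw [← Real.exp_add]; simp
    have h₃ := Real.exp_pos z
    have h₄ : Real.exp z * (1 - z) ≤ 1 := by nlinarith
    have h₅ : Real.exp z ≤ 1 := Real.exp_le_one_iff.2 h.le
    rw [abs_of_nonneg (by linarith)]
    nlinarith

variable {ι : Type*} [Fintype ι] [Nonempty ι]

/-- The convexity gap of a cumulant generating function dominates the variance. -/
lemma variance_le_cgf_gap {p w : ι → ℝ} (hp : ∀ x, 0 < p x) (hp1 : ∑ x, p x = 1) {R : ℝ}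
    (hw : ∀ x, |w x| ≤ R) :
    (∑ x, p x * w x ^ 2 - (∑ x, p x * w x) ^ 2) / (2 * (2 + 2 * R) ^ 2) ≤
      1 / 2 * Real.log (∑ x, p x * Real.exp (w x)) -
        Real.log (∑ x, p x * Real.exp (1 / 2 * w x)) := by
  have hR : 0 ≤ R := (abs_nonneg _).trans (hw (Classical.arbitrary ι))
  set Z := ∑ x, p x * Real.exp (w x) with hZ
  have hZpos : 0 < Z := Finset.sum_pos (fun x _ => mul_pos (hp x) (Real.exp_pos _))
    Finset.univ_nonempty
  -- After the shift by `w₀` the weights `p * exp u` form a probability vector, and the gap becomes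
  -- `-log c`, where `c` is the Hellinger affinity of `p` and `p * exp u`.
  set w₀ := Real.log Z with hw₀
  have hZexp : Z = Real.exp w₀ := (Real.exp_log hZpos).symm
  have hup : w₀ ≤ R := by
    rw [← Real.exp_le_exp, ← hZexp]
    calc Z ≤ ∑ x, p x * Real.exp R := Finset.sum_le_sum fun x _ =>
          mul_le_mul_of_nonneg_left (Real.exp_le_exp.2 (abs_le.1 (hw x)).2) (hp x).le
      _ = Real.exp R := by rw [← Finset.sum_mul, hp1, one_mul]
  have hlo : -R ≤ w₀ := by
    rw [← Real.exp_le_exp, ← hZexp]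
    calc Real.exp (-R) = ∑ x, p x * Real.exp (-R) := by rw [← Finset.sum_mul, hp1, one_mul]
      _ ≤ Z := Finset.sum_le_sum fun x _ =>
          mul_le_mul_of_nonneg_left (Real.exp_le_exp.2 (abs_le.1 (hw x)).1) (hp x).le
  set u : ι → ℝ := fun x => w x - w₀ with hu
  have hub : ∀ x, |1 / 2 * u x| ≤ R := by
    intro x
    have := abs_le.1 (hw x)
    rw [abs_le]
    constructor <;> simp only [hu] <;> linarith
  set c := ∑ x, p x * Real.exp (1 / 2 * u x) with hc
  have hcpos : 0 < c := Finset.sum_pos (fun x _ => mul_pos (hp x) (Real.exp_pos _))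
    Finset.univ_nonempty
  have hhalf : ∑ x, p x * Real.exp (1 / 2 * w x) = Real.exp (1 / 2 * w₀) * c := by
    rw [hc, Finset.mul_sum]
    refine Finset.sum_congr rfl fun x _ => ?_
    rw [mul_left_comm, ← Real.exp_add]
    congr 2
    simp only [hu]
    ring
  have hexpu : ∑ x, p x * Real.exp (u x) = 1 := by
    have : ∀ x, p x * Real.exp (u x) = Real.exp (-w₀) * (p x * Real.exp (w x)) := by
      intro x
      rw [mul_left_comm, ← Real.exp_add]
      congr 2
      simp only [hu]
      ring
    rw [Finset.sum_congr rfl fun x _ => this x, ← Finset.mul_sum, ← hZ, hZexp, ← Real.exp_add]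
    simp
  -- A squared Hellinger distance: it is bounded below by the second moment of `u`, and its half `1
  -- - c` is at most `-log c`.
  have hsq : ∑ x, p x * (1 - Real.exp (1 / 2 * u x)) ^ 2 = 2 - 2 * c := by
    have : ∀ x, p x * (1 - Real.exp (1 / 2 * u x)) ^ 2 =
        p x - 2 * (p x * Real.exp (1 / 2 * u x)) + p x * Real.exp (u x) := by
      intro x
      have : Real.exp (u x) = Real.exp (1 / 2 * u x) ^ 2 := by
        rw [sq, ← Real.exp_add]
        congr 1
        ring
      rw [this]
      ring
    rw [Finset.sum_congr rfl fun x _ => this x, Finset.sum_add_distrib, Finset.sum_sub_distrib,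
      ← Finset.mul_sum, hexpu, hp1]
    ring
  have hlow : ∑ x, p x * (u x ^ 2 / (2 + 2 * R) ^ 2) ≤
      ∑ x, p x * (1 - Real.exp (1 / 2 * u x)) ^ 2 := by
    refine Finset.sum_le_sum fun x _ => mul_le_mul_of_nonneg_left ?_ (hp x).le
    have h₁ := div_le_abs_one_sub_exp (hub x)
    rw [← sq_abs (1 - Real.exp (1 / 2 * u x))]
    refine le_trans (le_of_eq ?_) (pow_le_pow_left₀ (by positivity) h₁ 2)
    rw [div_pow, sq_abs]
    field_simp
  have hvar : ∑ x, p x * u x ^ 2 = (∑ x, p x * w x ^ 2 - (∑ x, p x * w x) ^ 2) +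
      (∑ x, p x * w x - w₀) ^ 2 := by
    have : ∀ x, p x * u x ^ 2 = p x * w x ^ 2 - 2 * w₀ * (p x * w x) + w₀ ^ 2 * p x := by
      intro x
      simp only [hu]
      ring
    rw [Finset.sum_congr rfl fun x _ => this x, Finset.sum_add_distrib, Finset.sum_sub_distrib,
      ← Finset.mul_sum, ← Finset.mul_sum, hp1]
    ring
  have hlog : Real.log c ≤ c - 1 := Real.log_le_sub_one_of_pos hcpos
  rw [hhalf, Real.log_mul (Real.exp_pos _).ne' hcpos.ne', Real.log_exp]
  have hpos : (0 : ℝ) < (2 + 2 * R) ^ 2 := by positivity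
  simp_rw [← mul_div_assoc] at hlow
  rw [← Finset.sum_div, hsq, div_le_iff₀ hpos] at hlow
  rw [div_le_iff₀ (by positivity)]
  nlinarith [sq_nonneg (∑ x, p x * w x - w₀)]

end Hellinger

/-! ### Randomized rounding to a grid -/

section Rounding

universe u

lemma sum_bool_prod {ι : Type*} [Fintype ι] [DecidableEq ι] (g : ι → Bool → ℝ) :
    ∑ ε : ι → Bool, ∏ i, g i (ε i) = ∏ i, (g i true + g i false) := by
  have := Finset.prod_univ_sum (fun _ : ι => (Finset.univ : Finset Bool)) g
  rw [Fintype.piFinset_univ] at this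
  rw [← this]
  exact Finset.prod_congr rfl fun i _ => by simp

/-- Every vector is the mean of a random point of the grid of mesh `r` with independent
coordinates, next to the vector. -/
lemma exists_grid_rounding {ι : Type u} [Fintype ι] [DecidableEq ι] {r : ℝ} (hr : 0 < r)
    (v : ι → ℝ) :
    ∃ (E : Type u) (_ : Fintype E) (ρ : E → ℝ) (n : E → ι → ℤ), (∀ ε, 0 ≤ ρ ε) ∧ ∑ ε, ρ ε = 1 ∧
      (∀ i, ∑ ε, ρ ε * (r * n ε i) = v i) ∧
      (∀ i, ∑ ε, ρ ε * (r * n ε i) ^ 2 ≤ v i ^ 2 + r ^ 2 / 4) ∧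
      (∀ X : ι → ℝ, ∑ ε, ρ ε * Real.exp (∑ i, X i * (r * n ε i)) ≤
        Real.exp (∑ i, X i * v i + r ^ 2 / 2 * ∑ i, X i ^ 2)) ∧
      ∀ ε i, |r * n ε i - v i| ≤ r := by
  -- Each coordinate is rounded up with probability equal to its fractional part, which makes the
  -- rounding unbiased.
  set θ : ι → ℝ := fun i => Int.fract (v i / r) with hθ
  set q : ι → Bool → ℝ := fun i b => if b then θ i else 1 - θ i with hq
  set n : ι → Bool → ℤ := fun i b => ⌊v i / r⌋ + if b then 1 else 0 with hn
  have hθ0 : ∀ i, 0 ≤ θ i := fun i => Int.fract_nonneg _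
  have hθ1 : ∀ i, θ i ≤ 1 := fun i => (Int.fract_lt_one _).le
  have hq0 : ∀ i b, 0 ≤ q i b := by
    intro i b
    cases b
    · simpa [hq] using hθ1 i
    · simpa [hq] using hθ0 i
  have hqs : ∀ i, q i true + q i false = 1 := by
    intro i
    simp [hq]
  have hv : ∀ i, v i = r * (⌊v i / r⌋ + θ i) := by
    intro i
    rw [hθ, Int.floor_add_fract, mul_div_cancel₀ _ hr.ne']
  have hmarg : ∀ i (g : Bool → ℝ), ∑ ε : ι → Bool, (∏ j, q j (ε j)) * g (ε i) =
      θ i * g true + (1 - θ i) * g false := by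
    intro i g
    have h₁ : ∀ ε : ι → Bool, (∏ j, q j (ε j)) * g (ε i) =
        ∏ j, (q j (ε j) * if j = i then g (ε j) else 1) := by
      intro ε
      rw [Finset.prod_mul_distrib, Finset.prod_ite_eq' Finset.univ i fun j => g (ε j)]
      simp
    rw [Finset.sum_congr rfl fun ε _ => h₁ ε,
      sum_bool_prod fun j b => q j b * if j = i then g b else 1, Finset.prod_eq_single i]
    · simp [hq]
    · intro j _ hj
      simp [hj, hqs]
    · simp
  refine ⟨ι → Bool, inferInstance, fun ε => ∏ i, q i (ε i), fun ε i => n i (ε i),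
    fun ε => Finset.prod_nonneg fun i _ => hq0 i _, ?_, ?_, ?_, ?_, ?_⟩
  · rw [sum_bool_prod q]
    exact Finset.prod_eq_one fun i _ => hqs i
  · intro i
    rw [hmarg i fun b => r * n i b]
    simp only [hn, if_true, Bool.false_eq_true, if_false]
    push_cast
    conv_rhs => rw [hv i]
    ring
  · intro i
    rw [hmarg i fun b => (r * n i b) ^ 2]
    simp only [hn, if_true, Bool.false_eq_true, if_false]
    push_cast
    have h₁ : v i ^ 2 = (r * (⌊v i / r⌋ + θ i)) ^ 2 := by rw [← hv i]
    rw [h₁]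
    -- The variance of a rounded coordinate is `r ^ 2 * θ * (1 - θ) ≤ r ^ 2 / 4`.
    nlinarith [mul_nonneg (sq_nonneg r) (sq_nonneg (θ i - 1 / 2))]
  · intro X
    have h₁ : ∀ ε : ι → Bool, (∏ j, q j (ε j)) * Real.exp (∑ i, X i * (r * n i (ε i))) =
        ∏ j, (q j (ε j) * Real.exp (X j * (r * n j (ε j)))) := by
      intro ε
      rw [Finset.prod_mul_distrib, Real.exp_sum]
    rw [Finset.sum_congr rfl fun ε _ => h₁ ε,
      sum_bool_prod fun j b => q j b * Real.exp (X j * (r * n j b)), Finset.mul_sum,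
      ← Finset.sum_add_distrib, Real.exp_sum]
    refine Finset.prod_le_prod (fun i _ => add_nonneg (mul_nonneg (hq0 _ _) (Real.exp_nonneg _))
      (mul_nonneg (hq0 _ _) (Real.exp_nonneg _))) fun i _ => ?_
    simp only [hq, hn, if_true, Bool.false_eq_true, if_false]
    push_cast
    set t := X i * r with ht
    -- Hoeffding's lemma for the two-point rounding error: in the average of the two chord bounds
    -- the `sinh` terms cancel, since the error is centred.
    have e₁ := Real.exp_mul_le_cosh_add_mul_sinh (t := 1 - θ i)
      (by rw [abs_le]; constructor <;> linarith [hθ0 i, hθ1 i]) t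
    have e₂ := Real.exp_mul_le_cosh_add_mul_sinh (t := -θ i)
      (by rw [abs_le]; constructor <;> linarith [hθ0 i, hθ1 i]) t
    have e₃ := Real.cosh_le_exp_half_sq t
    have f₁ : X i * (r * ((⌊v i / r⌋ : ℝ) + 1)) = X i * v i + (1 - θ i) * t := by
      conv_rhs => rw [hv i]
      rw [ht]
      ring
    have f₂ : X i * (r * ((⌊v i / r⌋ : ℝ) + 0)) = X i * v i + -θ i * t := by
      conv_rhs => rw [hv i]
      rw [ht]
      ring
    have f₃ : r ^ 2 / 2 * X i ^ 2 = t ^ 2 / 2 := by rw [ht]; ring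
    rw [f₁, f₂, f₃, Real.exp_add, Real.exp_add, Real.exp_add]
    have g₁ := mul_le_mul_of_nonneg_left e₁ (hθ0 i)
    have g₂ := mul_le_mul_of_nonneg_left e₂ (sub_nonneg.2 (hθ1 i))
    calc _ = Real.exp (X i * v i) * (θ i * Real.exp ((1 - θ i) * t) +
          (1 - θ i) * Real.exp (-θ i * t)) := by ring
      _ ≤ _ := mul_le_mul_of_nonneg_left (by linarith) (Real.exp_nonneg _)
  · intro ε i
    conv_lhs => rw [hv i]
    have : r * (n i (ε i) : ℝ) - r * (⌊v i / r⌋ + θ i) = r * ((if ε i then 1 else 0) - θ i) := by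
      simp only [hn]
      push_cast
      ring
    rw [this, abs_mul, abs_of_pos hr]
    refine mul_le_of_le_one_right hr.le ?_
    rw [abs_le]
    split_ifs <;> constructor <;> linarith [hθ0 i, hθ1 i]

/-- Normalization of discrete Laplace weights: the two geometric tails sum to at most `2 / (exp b -
1) ≤ 2 / b`. -/
lemma sum_exp_neg_mul_abs_le {b : ℝ} (hb : 0 < b) (N : ℕ) :
    ∑ n ∈ Finset.Icc (-(N : ℤ)) N, Real.exp (-(b * |(n : ℝ)|)) ≤ 1 + 2 / b := by
  set x := Real.exp (-b) with hx
  have hx0 : 0 < x := Real.exp_pos _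
  have hx1 : x < 1 := by
    rw [hx, Real.exp_lt_one_iff]
    linarith
  have key : ∀ N : ℕ, ∑ n ∈ Finset.Icc (-(N : ℤ)) N, Real.exp (-(b * |(n : ℝ)|)) =
      1 + 2 * ∑ j ∈ Finset.range N, x ^ (j + 1) := by
    intro N
    induction N with
    | zero => simp
    | succ N ih =>
      have h₁ : Finset.Icc (-((N + 1 : ℕ) : ℤ)) ((N + 1 : ℕ) : ℤ) =
          insert (-((N : ℤ) + 1)) (insert ((N : ℤ) + 1) (Finset.Icc (-(N : ℤ)) N)) := by
        ext z
        simp only [Finset.mem_insert, Finset.mem_Icc]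
        push_cast
        omega
      rw [h₁, Finset.sum_insert, Finset.sum_insert, ih, Finset.sum_range_succ]
      · have h₂ : Real.exp (-(b * ((N : ℝ) + 1))) = x ^ (N + 1) := by
          rw [hx, ← Real.exp_nat_mul]
          congr 1
          push_cast
          ring
        push_cast
        rw [abs_neg, abs_of_nonneg (by positivity : (0 : ℝ) ≤ (N : ℝ) + 1), h₂]
        ring
      · simp
      · simp only [Finset.mem_insert, Finset.mem_Icc]
        omega
  rw [key]
  have h₁ : ∑ j ∈ Finset.range N, x ^ (j + 1) ≤ x / (1 - x) := by
    simp_rw [pow_succ']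
    rw [← Finset.mul_sum, div_eq_mul_inv]
    refine mul_le_mul_of_nonneg_left ?_ hx0.le
    rw [geom_sum_eq hx1.ne, ← neg_div_neg_eq, neg_sub, neg_sub, ← one_div]
    exact div_le_div_of_nonneg_right (by linarith [pow_pos hx0 N]) (by linarith)
  have h₂ : x / (1 - x) ≤ 1 / b := by
    rw [div_le_div_iff₀ (by linarith) hb]
    have h₃ := Real.add_one_le_exp b
    have h₄ : x * Real.exp b = 1 := by rw [hx, ← Real.exp_add]; simp
    nlinarith
  have : 2 / b = 2 * (1 / b) := by ring
  linarith

end Rounding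

/-! ### Concentration of the feature estimates -/

section Features

variable {S : Type*} {A : Type*} {M H : ℕ}

/-- The logits that a feature adds at a history. -/
noncomputable def Model.logit (m : Model S A M H) (v : Feature S A M H) (h : Fin H)
    (τ : Fin h → Triple S A M) (x : Fin (M + 1)) : ℝ :=
  temp m.α H * extZero (suffStat m.α v h τ) x

/-- The conditional probabilities of the contexts. -/
noncomputable def Model.ctxProb (m : Model S A M H) (h : Fin H) (τ : Fin h → Triple S A M) :
    Fin (M + 1) → ℝ :=
  softmax (temp m.α H) (suffStat m.α m.f h τ)

/-- The cumulant generating function of the logits of a feature. -/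
noncomputable def Model.cgf (m : Model S A M H) (v : Feature S A M H) (h : Fin H)
    (τ : Fin h → Triple S A M) : ℝ :=
  Real.log (∑ x, m.ctxProb h τ x * Real.exp (m.logit v h τ x))

/-- The logarithmic likelihood ratio of a perturbation of the true feature. -/
noncomputable def Model.logRatio (m : Model S A M H) (v : Feature S A M H) (h : Fin H)
    (τ : Fin h → Triple S A M) (y : Triple S A M) : ℝ :=
  m.logit v h τ y.2.2 - m.cgf v h τ

/-- The logarithmic likelihood ratio of the contexts of the past episodes. -/
noncomputable def Model.pastLogRatio (m : Model S A M H) (v : Feature S A M H) {k : ℕ}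
    (past : Fin k → Episode S A M H) : ℝ :=
  ∑ j, ∑ h : Fin H, m.logRatio v h ((past j).hist h) ((past j).1 h)

lemma Model.sum_ctxProb_mul_exp_pos (m : Model S A M H) (w : Fin (M + 1) → ℝ) (h : Fin H)
    (τ : Fin h → Triple S A M) : 0 < ∑ x, m.ctxProb h τ x * Real.exp (w x) :=
  Finset.sum_pos (fun _ _ => mul_pos (softmax_pos _ _ _) (Real.exp_pos _)) Finset.univ_nonempty

lemma extZero_add (u v : Fin M → ℝ) (x : Fin (M + 1)) :
    extZero (fun i => u i + v i) x = extZero u x + extZero v x := by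
  induction x using Fin.lastCases <;> simp

lemma extZero_smul (a : ℝ) (v : Fin M → ℝ) (x : Fin (M + 1)) :
    extZero (fun i => a * v i) x = a * extZero v x := by
  induction x using Fin.lastCases <;> simp

lemma Model.logit_smul (m : Model S A M H) (a : ℝ) (v : Feature S A M H) (h : Fin H)
    (τ : Fin h → Triple S A M) (x : Fin (M + 1)) :
    m.logit (fun c i => a * v c i) h τ x = a * m.logit v h τ x := by
  rw [Model.logit, suffStat_smul, extZero_smul, Model.logit]
  ring

/-- Adding `v` to the feature tilts the law of the context by the exponential of its logit. The
log-likelihood changes by a part linear in `v` minus a convex normalizer. -/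
lemma Model.log_softmax_add (m : Model S A M H) (v : Feature S A M H) (h : Fin H)
    (τ : Fin h → Triple S A M) (x : Fin (M + 1)) :
    Real.log (softmax (temp m.α H) (suffStat m.α (fun c i => m.f c i + v c i) h τ) x) =
      Real.log (softmax (temp m.α H) (suffStat m.α m.f h τ) x) +
        (m.logit v h τ x - m.cgf v h τ) := by
  have hZ : 0 < ∑ y, Real.exp (temp m.α H * extZero (suffStat m.α m.f h τ) y) :=
    Finset.sum_pos (fun _ _ => Real.exp_pos _) Finset.univ_nonempty
  have hexp : ∀ y, temp m.α H * extZero (suffStat m.α (fun c i => m.f c i + v c i) h τ) y =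
      temp m.α H * extZero (suffStat m.α m.f h τ) y + m.logit v h τ y := by
    intro y
    rw [suffStat_add, extZero_add, mul_add, Model.logit]
  have hsum : ∑ y, Real.exp (temp m.α H *
      extZero (suffStat m.α (fun c i => m.f c i + v c i) h τ) y) =
      (∑ y, Real.exp (temp m.α H * extZero (suffStat m.α m.f h τ) y)) *
        ∑ y, m.ctxProb h τ y * Real.exp (m.logit v h τ y) := by
    rw [Finset.mul_sum]
    refine Finset.sum_congr rfl fun y _ => ?_
    rw [hexp, Real.exp_add, Model.ctxProb, softmax_eq]
    field_simp
  rw [log_softmax, log_softmax, hsum, Real.log_mul hZ.ne' (m.sum_ctxProb_mul_exp_pos _ h τ).ne',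
    hexp, Model.cgf]
  ring

variable [Fintype S] [Fintype A]

/-- A likelihood ratio has mean exactly one under the true law. It does not depend on the next
state, so the transitions play no role. -/
lemma Model.stepExp_logRatio_le (m : Model S A M H) (v : Feature S A M H) (h : Fin H)
    (τ : Fin h → Triple S A M) (s : S) (a : A) :
    m.stepExp h τ s a (fun y _ => Real.exp (m.logRatio v h τ y)) ≤ 1 := by
  rw [m.stepExp_eq]
  have hpos := m.sum_ctxProb_mul_exp_pos (m.logit v h τ) h τ
  have h₁ : ∀ x, softmax (temp m.α H) (suffStat m.α m.f h τ) x *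
      expect (m.P h s a x) (fun _ => Real.exp (m.logRatio v h τ (s, a, x))) =
      (m.ctxProb h τ x * Real.exp (m.logit v h τ x)) /
        ∑ x, m.ctxProb h τ x * Real.exp (m.logit v h τ x) := by
    intro x
    rw [expect_const, Model.logRatio, Real.exp_sub, Model.cgf, Real.exp_log hpos, mul_div_assoc,
      Model.ctxProb]
  rw [Finset.sum_congr rfl fun x _ => h₁ x, ← Finset.sum_div, div_self hpos.ne']

variable [DecidableEq S] [DecidableEq A]

/-- The gradient of a logit with respect to the feature. -/
noncomputable def Model.logitGrad (m : Model S A M H) (h : Fin H) (τ : Fin h → Triple S A M)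
    (x : Fin (M + 1)) (c : Coord S A M H × Fin M) : ℝ :=
  temp m.α H * coef m.α h τ c.1 * if x = c.2.castSucc then 1 else 0

lemma Model.logit_eq_sum (m : Model S A M H) (v : Feature S A M H) (h : Fin H)
    (τ : Fin h → Triple S A M) (x : Fin (M + 1)) :
    m.logit v h τ x = ∑ c : Coord S A M H × Fin M, m.logitGrad h τ x c * v c.1 c.2 := by
  rw [Fintype.sum_prod_type, Finset.sum_comm]
  induction x using Fin.lastCases with
  | last =>
    have : ∀ i : Fin M, Fin.last M ≠ i.castSucc := fun i => (Fin.castSucc_ne_last i).symm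
    simp [Model.logit, Model.logitGrad, this]
  | cast i =>
    rw [Finset.sum_eq_single i]
    · rw [Model.logit, extZero_castSucc, suffStat_eq_sum_coef, Finset.mul_sum]
      refine Finset.sum_congr rfl fun c _ => ?_
      simp [Model.logitGrad, mul_assoc]
    · intro j _ hj
      simp [Model.logitGrad, Ne.symm hj]
    · simp

/-- The temperature is chosen for this: its square is the inverse of the effective horizon, which
bounds the squared coefficients. Only the block of the observed context is nonzero, and for the
reference context no block is. -/
lemma Model.sum_logitGrad_sq_le (m : Model S A M H) (h : Fin H) (τ : Fin h → Triple S A M)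
    (x : Fin (M + 1)) : ∑ c, m.logitGrad h τ x c ^ 2 ≤ 1 := by
  have hH : 1 ≤ H := (Nat.zero_le _).trans_lt h.2
  have hE := one_le_effHorizon m.α_nonneg hH
  have hmain : temp m.α H ^ 2 * ∑ c, coef m.α h τ c ^ 2 ≤ 1 := by
    rw [temp_sq m.α_nonneg hH, inv_mul_le_iff₀ (by linarith), mul_one]
    exact sum_coef_sq_le m.α_nonneg m.α_le_one h τ
  rw [Fintype.sum_prod_type]
  refine le_trans ?_ hmain
  rw [Finset.mul_sum]
  refine Finset.sum_le_sum fun c _ => ?_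
  have h₁ : ∀ i : Fin M, m.logitGrad h τ x (c, i) ^ 2 =
      temp m.α H ^ 2 * coef m.α h τ c ^ 2 * if x = i.castSucc then 1 else 0 := by
    intro i
    rw [Model.logitGrad]
    split_ifs <;> ring
  rw [Finset.sum_congr rfl fun i _ => h₁ i, ← Finset.mul_sum]
  refine mul_le_of_le_one_right (by positivity) ?_
  induction x using Fin.lastCases with
  | last =>
    have : ∀ i : Fin M, Fin.last M ≠ i.castSucc := fun i => (Fin.castSucc_ne_last i).symm
    simp [this]
  | cast i => simp

/-- Cauchy–Schwarz against the gradient, whose norm is at most one. -/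
lemma Model.abs_logit_le (m : Model S A M H) (v : Feature S A M H) (h : Fin H)
    (τ : Fin h → Triple S A M) (x : Fin (M + 1)) {R : ℝ} (hR : 0 ≤ R)
    (hv : ∑ c, ∑ i, v c i ^ 2 ≤ R ^ 2) : |m.logit v h τ x| ≤ R := by
  refine abs_le_of_sq_le_sq ?_ hR
  rw [m.logit_eq_sum]
  refine (Finset.sum_mul_sq_le_sq_mul_sq _ _ _).trans ?_
  rw [Fintype.sum_prod_type (f := fun c : Coord S A M H × Fin M => v c.1 c.2 ^ 2)]
  refine le_trans ?_ hv
  exact mul_le_of_le_one_left (Finset.sum_nonneg fun _ _ => Finset.sum_nonneg fun _ _ =>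
    sq_nonneg _) (m.sum_logitGrad_sq_le h τ x)

/-- The mesh of the grid is proportional to `(1 / 2) ^ j`. -/
noncomputable def gridFeature (lam : ℝ) (j : ℕ) (n : Coord S A M H × Fin M → ℤ) :
    Feature S A M H :=
  fun c i => √(2 / lam) * (1 / 2) ^ j * n (c, i)

/-- The event that the likelihood ratios at all the points of the grid are controlled. -/
def Model.FeatAccurate (m : Model S A M H) (lam B : ℝ) (J N : ℕ) {k : ℕ}
    (past : Fin k → Episode S A M H) : Prop :=
  ∀ j ≤ J, ∀ n : Coord S A M H × Fin M → ℤ, (∀ c, |n c| ≤ N) →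
    m.pastLogRatio (gridFeature lam j n) past ≤ B + (j + 1) * Real.log 2 +
      ∑ c, ((1 / 2) ^ j * |(n c : ℝ)| + Real.log (1 + 2 / (1 / 2) ^ j))

/-- The method of mixtures. The prior gives mass `(1 / 2) ^ (j + 1)` to level `j`, spread there by a
product of discrete Laplace weights, and its negative logarithm is the penalty in
`Model.FeatAccurate`. The cutoffs `J` and `N` only keep the mixture finite and do not enter the
probability. -/
lemma Model.prob_not_featAccurate_le (m : Model S A M H)
    (init : (k : ℕ) → (Fin k → Episode S A M H) → PMF S) (ℓ : Learner S A M H) (K : ℕ)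
    (lam B : ℝ) (J N : ℕ) :
    prob (m.runLaw init ℓ K)
      {ω | ∃ k, ∃ hk : k ≤ K, ¬ m.FeatAccurate lam B J N (firstEpisodes ω k hk)} ≤
      Real.exp (-B) := by
  set Ξ : Finset (ℕ × (Coord S A M H × Fin M → ℤ)) := Finset.range (J + 1) ×ˢ
    Fintype.piFinset fun _ => Finset.Icc (-(N : ℤ)) N with hΞ
  set ν : ℕ × (Coord S A M H × Fin M → ℤ) → ℝ := fun ξ => (1 / 2) ^ (ξ.1 + 1) *
    ∏ c, (Real.exp (-((1 / 2) ^ ξ.1 * |(ξ.2 c : ℝ)|)) / (1 + 2 / (1 / 2) ^ ξ.1)) with hν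
  have hZ : ∀ j : ℕ, (0 : ℝ) < 1 + 2 / (1 / 2) ^ j := fun j => by positivity
  have hνpos : ∀ ξ, 0 < ν ξ := fun ξ => mul_pos (by positivity)
    (Finset.prod_pos fun c _ => div_pos (Real.exp_pos _) (hZ _))
  have hlog : ∀ ξ, Real.log (ν ξ) = -((ξ.1 + 1) * Real.log 2 +
      ∑ c, ((1 / 2) ^ ξ.1 * |(ξ.2 c : ℝ)| + Real.log (1 + 2 / (1 / 2) ^ ξ.1))) := by
    intro ξ
    have hne : ∀ c ∈ Finset.univ, (Real.exp (-((1 / 2) ^ ξ.1 * |(ξ.2 c : ℝ)|)) /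
        (1 + 2 / (1 / 2) ^ ξ.1)) ≠ 0 := fun c _ => (div_pos (Real.exp_pos _) (hZ _)).ne'
    rw [hν, Real.log_mul (by positivity) (Finset.prod_ne_zero_iff.2 hne), Real.log_prod hne,
      Real.log_pow, neg_add, ← Finset.sum_neg_distrib]
    congr 1
    · rw [one_div, Real.log_inv]
      push_cast
      ring
    · refine Finset.sum_congr rfl fun c _ => ?_
      rw [Real.log_div (Real.exp_pos _).ne' (hZ _).ne', Real.log_exp]
      ring
  have hsum : ∑ ξ ∈ Ξ, ν ξ ≤ 1 := by
    rw [hΞ, Finset.sum_product]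
    have h₁ : ∀ j ∈ Finset.range (J + 1), ∑ n ∈ Fintype.piFinset fun _ : Coord S A M H × Fin M =>
        Finset.Icc (-(N : ℤ)) N, ν (j, n) ≤ (1 / 2) ^ (j + 1) := by
      intro j _
      simp only [hν]
      rw [← Finset.mul_sum, ← Finset.prod_univ_sum (fun _ : Coord S A M H × Fin M =>
        Finset.Icc (-(N : ℤ)) N) fun _ n =>
          Real.exp (-((1 / 2 : ℝ) ^ j * |(n : ℝ)|)) / (1 + 2 / (1 / 2) ^ j)]
      refine mul_le_of_le_one_right (by positivity) (Finset.prod_le_one (fun c _ =>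
        Finset.sum_nonneg fun n _ => (div_pos (Real.exp_pos _) (hZ _)).le) fun c _ => ?_)
      rw [← Finset.sum_div, div_le_one (hZ j)]
      exact sum_exp_neg_mul_abs_le (by positivity) N
    refine (Finset.sum_le_sum h₁).trans ?_
    have h₂ : ∀ n : ℕ, ∑ j ∈ Finset.range n, (1 / 2 : ℝ) ^ (j + 1) = 1 - (1 / 2) ^ n := by
      intro n
      induction n with
      | zero => simp
      | succ n ih => rw [Finset.sum_range_succ, ih]; ring
    rw [h₂]
    have : (0 : ℝ) ≤ (1 / 2) ^ (J + 1) := by positivity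
    linarith
  have key := m.prob_exists_log_lt_sum_le init ℓ K Ξ ν (fun ξ _ => hνpos ξ)
    (fun ξ _ _ e => ∑ h : Fin H, m.logRatio (gridFeature lam ξ.1 ξ.2) h (e.hist h) (e.1 h))
    (fun ξ _ k past s₀ => m.expect_exp_sum_le_one (ℓ.policy k past) s₀
      (fun h τ y _ => m.logRatio (gridFeature lam ξ.1 ξ.2) h τ y)
      (fun h τ s a => m.stepExp_logRatio_le _ h τ s a)) B
  refine (prob_mono ?_).trans (key.trans (mul_le_of_le_one_left (Real.exp_nonneg _) hsum))
  rintro ω ⟨k, hk, hω⟩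
  simp only [FeatAccurate, not_forall, not_le] at hω
  obtain ⟨j, hj, n, hn, hlt⟩ := hω
  refine ⟨k, hk, (j, n), ?_, ?_⟩
  · simp only [hΞ, Finset.mem_product, Finset.mem_range, Fintype.mem_piFinset, Finset.mem_Icc]
    exact ⟨by omega, fun c => abs_le.1 (hn c)⟩
  · rw [hlog]
    refine lt_of_le_of_lt (le_of_eq ?_) hlt
    ring

/-- By Jensen for the logarithm, the average over `ρ` can be moved inside to the exponentials of the
logits, where the hypothesis applies context by context. -/
lemma Model.sum_mul_cgf_le (m : Model S A M H) {ε : Type*} [Fintype ε] {ρ : ε → ℝ}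
    (hρ : ∀ e, 0 ≤ ρ e) (hρ1 : ∑ e, ρ e = 1) {v : Feature S A M H} {ξ : ε → Feature S A M H}
    {b : ℝ} (h : Fin H) (τ : Fin h → Triple S A M)
    (hξ : ∀ x, ∑ e, ρ e * Real.exp (m.logit (ξ e) h τ x) ≤ Real.exp (m.logit v h τ x + b)) :
    ∑ e, ρ e * m.cgf (ξ e) h τ ≤ m.cgf v h τ + b := by
  have hj := strictConcaveOn_log_Ioi.concaveOn.le_map_sum (t := Finset.univ) (w := ρ)
    (p := fun e => ∑ x, m.ctxProb h τ x * Real.exp (m.logit (ξ e) h τ x)) (fun e _ => hρ e) hρ1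
    (fun e _ => m.sum_ctxProb_mul_exp_pos _ h τ)
  simp only [smul_eq_mul] at hj
  refine hj.trans ?_
  have hpos := m.sum_ctxProb_mul_exp_pos (m.logit v h τ) h τ
  have h₁ : ∑ e, ρ e * ∑ x, m.ctxProb h τ x * Real.exp (m.logit (ξ e) h τ x) ≤
      (∑ x, m.ctxProb h τ x * Real.exp (m.logit v h τ x)) * Real.exp b := by
    simp_rw [Finset.mul_sum]
    rw [Finset.sum_comm, Finset.sum_mul]
    refine Finset.sum_le_sum fun x _ => ?_
    rw [mul_assoc, ← Real.exp_add]
    refine le_trans (le_of_eq ?_) (mul_le_mul_of_nonneg_left (hξ x) (softmax_nonneg _ _ _))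
    rw [Finset.mul_sum]
    exact Finset.sum_congr rfl fun e _ => mul_left_comm _ _ _
  have h₂ : 0 < ∑ e, ρ e * ∑ x, m.ctxProb h τ x * Real.exp (m.logit (ξ e) h τ x) := by
    obtain ⟨e, he⟩ : ∃ e, ρ e ≠ 0 := by
      by_contra! hc
      simp [hc] at hρ1
    exact Finset.sum_pos' (fun e _ => mul_nonneg (hρ e) (m.sum_ctxProb_mul_exp_pos _ h τ).le)
      ⟨e, Finset.mem_univ e, mul_pos ((hρ e).lt_of_ne' he) (m.sum_ctxProb_mul_exp_pos _ h τ)⟩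
  refine (Real.log_le_log h₂ h₁).trans_eq ?_
  rw [Real.log_mul hpos.ne' (Real.exp_pos _).ne', Real.log_exp, Model.cgf]

/-- On the good event, the likelihood ratios of all features are controlled. -/
lemma Model.FeatAccurate.pastLogRatio_le {m : Model S A M H} {lam B : ℝ} {J N k : ℕ}
    {past : Fin k → Episode S A M H} (hm : m.FeatAccurate lam B J N past) (hlam : 0 < lam) {j : ℕ}
    (hj : j ≤ J) (v : Feature S A M H)
    (hv : ∀ c i, |v c i| + √(2 / lam) * (1 / 2) ^ j ≤ √(2 / lam) * (1 / 2) ^ j * N) :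
    m.pastLogRatio v past ≤ k * H * ((1 / 2) ^ j) ^ 2 / lam + B + (j + 1) * Real.log 2 +
      lam / 2 * ∑ c, ∑ i, v c i ^ 2 + Fintype.card (Coord S A M H × Fin M) *
        (((1 / 2) ^ j) ^ 2 / 4 + 1 / 4 + Real.log (1 + 2 / (1 / 2) ^ j)) := by
  set b : ℝ := (1 / 2) ^ j with hb
  have hb0 : 0 < b := by positivity
  set r := √(2 / lam) * b with hr
  have hr0 : 0 < r := by positivity
  have hr2 : r ^ 2 = 2 * b ^ 2 / lam := by
    rw [hr, mul_pow, Real.sq_sqrt (by positivity)]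
    ring
  obtain ⟨E, _, ρ, n, hρ, hρ1, hmean, hsq, hexp, hclose⟩ :=
    exists_grid_rounding hr0 fun c : Coord S A M H × Fin M => v c.1 c.2
  have hn : ∀ ε c, |n ε c| ≤ N := by
    intro ε c
    have h₁ := hclose ε c
    have h₂ := hv c.1 c.2
    have h₃ : |r * n ε c| ≤ r * N := by
      calc |r * n ε c| = |(r * n ε c - v c.1 c.2) + v c.1 c.2| := by ring_nf
        _ ≤ _ := (abs_add_le _ _).trans (by linarith)
    rw [abs_mul, abs_of_pos hr0] at h₃
    have h₄ := le_of_mul_le_mul_left h₃ hr0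
    exact_mod_cast h₄
  have hlogit : ∀ ε h τ x, m.logit (gridFeature lam j (n ε)) h τ x =
      ∑ c, m.logitGrad h τ x c * (r * n ε c) := fun ε h τ x => m.logit_eq_sum _ h τ x
  have hElogit : ∀ h τ x, ∑ ε, ρ ε * m.logit (gridFeature lam j (n ε)) h τ x =
      m.logit v h τ x := by
    intro h τ x
    simp_rw [hlogit, Finset.mul_sum]
    rw [Finset.sum_comm, m.logit_eq_sum]
    refine Finset.sum_congr rfl fun c _ => ?_
    rw [← hmean c, Finset.mul_sum]
    exact Finset.sum_congr rfl fun ε _ => mul_left_comm _ _ _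
  -- The linear part keeps its mean under unbiased rounding; only the normalizer pays, with the
  -- factor `r ^ 2 / 2` times a squared gradient norm of at most one.
  have hEcgf : ∀ h τ, ∑ ε, ρ ε * m.cgf (gridFeature lam j (n ε)) h τ ≤
      m.cgf v h τ + r ^ 2 / 2 := by
    intro h τ
    refine m.sum_mul_cgf_le hρ hρ1 h τ fun x => ?_
    simp_rw [hlogit]
    refine (hexp _).trans (Real.exp_le_exp.2 ?_)
    rw [← m.logit_eq_sum]
    have := mul_le_mul_of_nonneg_left (m.sum_logitGrad_sq_le h τ x)
      (by positivity : 0 ≤ r ^ 2 / 2)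
    linarith
  have hEratio : ∀ h τ y, m.logRatio v h τ y - r ^ 2 / 2 ≤
      ∑ ε, ρ ε * m.logRatio (gridFeature lam j (n ε)) h τ y := by
    intro h τ y
    simp only [Model.logRatio, mul_sub, Finset.sum_sub_distrib]
    rw [hElogit]
    linarith [hEcgf h τ]
  have hEpast : m.pastLogRatio v past - k * H * (r ^ 2 / 2) ≤
      ∑ ε, ρ ε * m.pastLogRatio (gridFeature lam j (n ε)) past := by
    have h₁ : ∑ ε, ρ ε * m.pastLogRatio (gridFeature lam j (n ε)) past =
        ∑ j', ∑ h : Fin H, ∑ ε, ρ ε * m.logRatio (gridFeature lam j (n ε)) h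
          ((past j').hist h) ((past j').1 h) := by
      simp only [Model.pastLogRatio, Finset.mul_sum]
      rw [Finset.sum_comm]
      exact Finset.sum_congr rfl fun _ _ => Finset.sum_comm
    have h₂ : m.pastLogRatio v past - k * H * (r ^ 2 / 2) = ∑ j', ∑ h : Fin H,
        (m.logRatio v h ((past j').hist h) ((past j').1 h) - r ^ 2 / 2) := by
      simp [Model.pastLogRatio, Finset.sum_sub_distrib]
      ring
    rw [h₁, h₂]
    exact Finset.sum_le_sum fun _ _ => Finset.sum_le_sum fun _ _ => hEratio _ _ _
  -- The scale `√(2 / lam)` of the mesh is chosen so that `lam / 2 * r ^ 2 = b ^ 2`: the Laplace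
  -- penalty is absorbed by a ridge penalty up to `1 / 4`.
  have hterm : ∀ ε c, b * |(n ε c : ℝ)| ≤ lam / 2 * (r * n ε c) ^ 2 + 1 / 4 := by
    intro ε c
    rw [mul_pow, hr2]
    have : lam / 2 * (2 * b ^ 2 / lam * (n ε c : ℝ) ^ 2) = (b * |(n ε c : ℝ)|) ^ 2 := by
      rw [mul_pow, sq_abs]
      field_simp
    rw [this]
    nlinarith [sq_nonneg (b * |(n ε c : ℝ)| - 1 / 2)]
  have hacc : ∀ ε, m.pastLogRatio (gridFeature lam j (n ε)) past ≤ B + (j + 1) * Real.log 2 +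
      ∑ c, (lam / 2 * (r * n ε c) ^ 2 + (1 / 4 + Real.log (1 + 2 / b))) := by
    intro ε
    refine (hm j hj (n ε) (hn ε)).trans (add_le_add_right (Finset.sum_le_sum fun c _ => ?_) _)
    linarith [hterm ε c]
  have hEsq : ∑ ε, ρ ε * ∑ c, (lam / 2 * (r * n ε c) ^ 2 + (1 / 4 + Real.log (1 + 2 / b))) ≤
      ∑ c : Coord S A M H × Fin M, (lam / 2 * (v c.1 c.2 ^ 2 + r ^ 2 / 4) +
        (1 / 4 + Real.log (1 + 2 / b))) := by
    simp_rw [Finset.mul_sum]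
    rw [Finset.sum_comm]
    refine Finset.sum_le_sum fun c _ => ?_
    simp_rw [mul_add (ρ _), Finset.sum_add_distrib, ← Finset.sum_mul, hρ1]
    have h₁ : ∑ ε, ρ ε * (lam / 2 * (r * n ε c) ^ 2) = lam / 2 * ∑ ε, ρ ε * (r * n ε c) ^ 2 := by
      rw [Finset.mul_sum]
      exact Finset.sum_congr rfl fun ε _ => mul_left_comm _ _ _
    rw [h₁]
    have := mul_le_mul_of_nonneg_left (hsq c) (by positivity : 0 ≤ lam / 2)
    linarith
  have hfinal : ∑ ε, ρ ε * m.pastLogRatio (gridFeature lam j (n ε)) past ≤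
      B + (j + 1) * Real.log 2 + ∑ c : Coord S A M H × Fin M,
        (lam / 2 * (v c.1 c.2 ^ 2 + r ^ 2 / 4) + (1 / 4 + Real.log (1 + 2 / b))) := by
    refine (Finset.sum_le_sum fun ε _ => mul_le_mul_of_nonneg_left (hacc ε) (hρ ε)).trans ?_
    simp_rw [mul_add (ρ _) (B + _), Finset.sum_add_distrib, ← Finset.sum_mul, hρ1, one_mul]
    rw [Finset.sum_add_distrib] at hEsq
    simp_rw [Finset.sum_add_distrib] at hEsq ⊢
    exact add_le_add_right hEsq _
  have hcard : ∑ c : Coord S A M H × Fin M,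
      (lam / 2 * (v c.1 c.2 ^ 2 + r ^ 2 / 4) + (1 / 4 + Real.log (1 + 2 / b))) =
      lam / 2 * ∑ c, ∑ i, v c i ^ 2 + Fintype.card (Coord S A M H × Fin M) *
        (b ^ 2 / 4 + 1 / 4 + Real.log (1 + 2 / b)) := by
    have hlr : lam / 2 * (r ^ 2 / 4) = b ^ 2 / 4 := by
      rw [hr2]
      field_simp
    rw [← Fintype.sum_prod_type (f := fun c : Coord S A M H × Fin M => v c.1 c.2 ^ 2)]
    simp_rw [mul_add, hlr]
    rw [Finset.sum_add_distrib, Finset.sum_add_distrib, ← Finset.mul_sum, Finset.sum_const,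
      Finset.sum_const, Finset.card_univ]
    simp only [nsmul_eq_mul]
    ring
  rw [hcard] at hfinal
  have hkr : (k : ℝ) * H * (r ^ 2 / 2) = k * H * b ^ 2 / lam := by
    rw [hr2]
    ring
  linarith

end Features

/-! ### The error of the constrained regularized maximum likelihood estimator. -/

section Estimate

variable {S : Type*} {A : Type*} {M H : ℕ} [Fintype S] [Fintype A]

lemma l2norm_sq (f : Feature S A M H) : l2norm f ^ 2 = ∑ c, ∑ i, f c i ^ 2 :=
  Real.sq_sqrt (Finset.sum_nonneg fun _ _ => Finset.sum_nonneg fun _ _ => sq_nonneg _)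

lemma sum_sq_sub_le {b f g : Feature S A M H} {L : ℝ} (hf : f ∈ rectSet b) (hg : g ∈ rectSet b)
    (hb : l2norm b ≤ L) : ∑ c, ∑ i, (f c i - g c i) ^ 2 ≤ (2 * L) ^ 2 := by
  have h₁ : ∑ c, ∑ i, (f c i - g c i) ^ 2 ≤ ∑ c, ∑ i, 4 * b c i ^ 2 := by
    refine Finset.sum_le_sum fun c _ => Finset.sum_le_sum fun i _ => ?_
    have hfc := abs_le.1 (hf c i)
    have hgc := abs_le.1 (hg c i)
    nlinarith
  simp_rw [← Finset.mul_sum] at h₁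
  rw [← l2norm_sq b] at h₁
  have h₂ : l2norm b ^ 2 ≤ L ^ 2 := pow_le_pow_left₀ (Real.sqrt_nonneg _) hb 2
  nlinarith

lemma abs_le_of_mem_rectSet {b f : Feature S A M H} {L : ℝ} (hf : f ∈ rectSet b)
    (hb : l2norm b ≤ L) (c : Coord S A M H) (i : Fin M) : |f c i| ≤ L := by
  refine (hf c i).trans (le_trans ?_ hb)
  refine Real.le_sqrt_of_sq_le ?_
  exact (Finset.single_le_sum (f := fun i => b c i ^ 2) (fun _ _ => sq_nonneg _)
    (Finset.mem_univ i)).trans (Finset.single_le_sum (f := fun c => ∑ i, b c i ^ 2)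
    (fun _ _ => Finset.sum_nonneg fun _ _ => sq_nonneg _) (Finset.mem_univ c))

/-- Writes the objective through the likelihood ratio of the displacement from the truth, so that
optimality of the estimate becomes a lower bound for that ratio. -/
lemma Model.logLik_eq (m : Model S A M H) (lam : ℝ) {k : ℕ} (past : Fin k → Episode S A M H)
    (g : Feature S A M H) : logLik m.α lam past g = logLik m.α lam past m.f +
      m.pastLogRatio (fun c i => g c i - m.f c i) past -
        lam * (∑ c, ∑ i, g c i ^ 2 - ∑ c, ∑ i, m.f c i ^ 2) := by
  have hg : g = fun c i => m.f c i + (fun c i => g c i - m.f c i) c i := by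
    funext c i
    ring
  have h₁ : ∀ j (h : Fin H), Real.log (softmax (temp m.α H) (suffStat m.α g h ((past j).hist h))
      ((past j).1 h).2.2) = Real.log (softmax (temp m.α H) (suffStat m.α m.f h ((past j).hist h))
      ((past j).1 h).2.2) + m.logRatio (fun c i => g c i - m.f c i) h ((past j).hist h)
        ((past j).1 h) := by
    intro j h
    conv_lhs => rw [hg]
    exact m.log_softmax_add _ h _ _
  rw [logLik, logLik, l2norm_sq, l2norm_sq, Model.pastLogRatio]
  simp_rw [h₁, Finset.sum_add_distrib]
  ring

/-- The sum of the squared sufficient statistics along the past episodes. -/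
noncomputable def Model.pastSq (m : Model S A M H) (v : Feature S A M H) {k : ℕ}
    (past : Fin k → Episode S A M H) : ℝ :=
  ∑ j, ∑ h : Fin H, ∑ i, suffStat m.α v h ((past j).hist h) i ^ 2

variable [DecidableEq S] [DecidableEq A]

/-- The variance of the logits is dominated by the convexity gap of the likelihood. -/
lemma Model.pastSq_le (m : Model S A M H) (v : Feature S A M H) {k : ℕ}
    (past : Fin k → Episode S A M H) {R : ℝ} (hR : 0 ≤ R) (hv : ∑ c, ∑ i, v c i ^ 2 ≤ R ^ 2) :
    m.kappa⁻¹ * temp m.α H ^ 2 * m.pastSq v past / (2 * (2 + 2 * R) ^ 2) ≤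
      m.pastLogRatio (fun c i => 1 / 2 * v c i) past - 1 / 2 * m.pastLogRatio v past := by
  have h₁ : ∀ (h : Fin H) τ y, m.kappa⁻¹ * temp m.α H ^ 2 * (∑ i, suffStat m.α v h τ i ^ 2) /
      (2 * (2 + 2 * R) ^ 2) ≤
      m.logRatio (fun c i => 1 / 2 * v c i) h τ y - 1 / 2 * m.logRatio v h τ y := by
    intro h τ y
    have hgap := variance_le_cgf_gap (p := m.ctxProb h τ) (w := m.logit v h τ)
      (fun x => softmax_pos _ _ _) (sum_softmax _ _) (fun x => m.abs_logit_le v h τ x hR hv)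
    have hk := mul_le_mul_of_nonneg_left (m.inv_kappa_mul_le h τ (suffStat m.α v h τ))
      (sq_nonneg (temp m.α H))
    have hvar : temp m.α H ^ 2 * (∑ x, softmax (temp m.α H) (suffStat m.α m.f h τ) x *
        extZero (suffStat m.α v h τ) x ^ 2 - (∑ x, softmax (temp m.α H) (suffStat m.α m.f h τ) x *
        extZero (suffStat m.α v h τ) x) ^ 2) = ∑ x, m.ctxProb h τ x * m.logit v h τ x ^ 2 -
        (∑ x, m.ctxProb h τ x * m.logit v h τ x) ^ 2 := by
      rw [mul_sub, ← mul_pow, Finset.mul_sum, Finset.mul_sum]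
      congr 1
      · exact Finset.sum_congr rfl fun x _ => by rw [Model.logit, Model.ctxProb]; ring
      · congr 1
        exact Finset.sum_congr rfl fun x _ => by rw [Model.logit, Model.ctxProb]; ring
    rw [hvar] at hk
    refine le_trans (div_le_div_of_nonneg_right (le_trans (le_of_eq ?_) hk) (by positivity))
      (hgap.trans (le_of_eq ?_))
    · ring
    -- The linear parts cancel, and the convexity gap of the cumulant generating function remains.
    · simp only [Model.logRatio, Model.cgf, m.logit_smul]
      ring
  have h₂ : m.kappa⁻¹ * temp m.α H ^ 2 * m.pastSq v past / (2 * (2 + 2 * R) ^ 2) =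
      ∑ j, ∑ h : Fin H, m.kappa⁻¹ * temp m.α H ^ 2 *
        (∑ i, suffStat m.α v h ((past j).hist h) i ^ 2) / (2 * (2 + 2 * R) ^ 2) := by
    simp only [Model.pastSq, Finset.mul_sum, Finset.sum_div]
  have h₃ : m.pastLogRatio (fun c i => 1 / 2 * v c i) past - 1 / 2 * m.pastLogRatio v past =
      ∑ j, ∑ h : Fin H, (m.logRatio (fun c i => 1 / 2 * v c i) h ((past j).hist h) ((past j).1 h) -
        1 / 2 * m.logRatio v h ((past j).hist h) ((past j).1 h)) := by
    simp only [Model.pastLogRatio, Finset.mul_sum, Finset.sum_sub_distrib]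
  rw [h₂, h₃]
  exact Finset.sum_le_sum fun j _ => Finset.sum_le_sum fun h _ => h₁ _ _ _

/-- The estimation error of the constrained regularized maximum likelihood estimator. -/
lemma Model.FeatAccurate.pastSq_le {m : Model S A M H} {lam B L : ℝ} {J N k : ℕ}
    {past : Fin k → Episode S A M H} (hm : m.FeatAccurate lam B J N past) (hlam : 0 < lam)
    (hL : 0 ≤ L) {b fhat : Feature S A M H} (hf : m.f ∈ rectSet b) (hb : l2norm b ≤ L)
    (hmem : fhat ∈ rectSet b) (hmax : IsMaxOn (logLik m.α lam past) (rectSet b) fhat) {j : ℕ}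
    (hj : j ≤ J) (hN : L + √(2 / lam) * (1 / 2) ^ j ≤ √(2 / lam) * (1 / 2) ^ j * N) :
    m.kappa⁻¹ * temp m.α H ^ 2 * m.pastSq (fun c i => fhat c i - m.f c i) past ≤
      2 * (2 + 4 * L) ^ 2 * (k * H * ((1 / 2) ^ j) ^ 2 / lam + B + (j + 1) * Real.log 2 +
        Fintype.card (Coord S A M H × Fin M) *
          (((1 / 2) ^ j) ^ 2 / 4 + 1 / 4 + Real.log (1 + 2 / (1 / 2) ^ j)) +
        2 / 3 * lam * L ^ 2) := by
  set v : Feature S A M H := fun c i => fhat c i - m.f c i with hv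
  have hvsq : ∑ c, ∑ i, v c i ^ 2 ≤ (2 * L) ^ 2 := sum_sq_sub_le hmem hf hb
  have h₁ := m.pastSq_le v past (R := 2 * L) (by positivity) hvsq
  -- The upper bound is used at half the displacement, whose entries are at most `L`; at the full
  -- displacement optimality gives a lower bound.
  have h₂ := hm.pastLogRatio_le hlam hj (fun c i => 1 / 2 * v c i) (by
    intro c i
    refine le_trans (add_le_add_left ?_ _) hN
    have e₁ := abs_le.1 (abs_le_of_mem_rectSet hmem hb c i)
    have e₂ := abs_le.1 (abs_le_of_mem_rectSet hf hb c i)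
    rw [abs_le]
    simp only [hv]
    constructor <;> linarith)
  have h₃ : logLik m.α lam past m.f ≤ logLik m.α lam past fhat := hmax hf
  rw [m.logLik_eq lam past fhat] at h₃
  have hfsq : ∑ c, ∑ i, m.f c i ^ 2 ≤ L ^ 2 := by
    refine le_trans ?_ (pow_le_pow_left₀ (Real.sqrt_nonneg _) hb 2)
    change _ ≤ l2norm b ^ 2
    rw [l2norm_sq]
    refine Finset.sum_le_sum fun c _ => Finset.sum_le_sum fun i _ => ?_
    exact sq_le_sq.2 ((hf c i).trans (le_abs_self _))
  -- Entrywise the two sides differ by `(3 * f̂ + f*) ^ 2 / 12`. Thus the regularizer of the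
  -- estimate absorbs the ridge term of the mixture, at the cost of `2 / 3 * lam * L ^ 2`.
  have h₄ : 1 / 4 * ∑ c, ∑ i, v c i ^ 2 - 1 / 3 * ∑ c, ∑ i, m.f c i ^ 2 ≤
      ∑ c, ∑ i, fhat c i ^ 2 := by
    simp_rw [Finset.mul_sum]
    rw [← Finset.sum_sub_distrib]
    refine Finset.sum_le_sum fun c _ => ?_
    rw [← Finset.sum_sub_distrib]
    refine Finset.sum_le_sum fun i _ => ?_
    simp only [hv]
    nlinarith [sq_nonneg (3 * fhat c i + m.f c i)]
  have h₅ : ∑ c, ∑ i, (1 / 2 * v c i) ^ 2 = 1 / 4 * ∑ c, ∑ i, v c i ^ 2 := by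
    simp_rw [Finset.mul_sum]
    exact Finset.sum_congr rfl fun c _ => Finset.sum_congr rfl fun i _ => by ring
  rw [h₅] at h₂
  have h₆ := mul_le_mul_of_nonneg_left h₄ hlam.le
  have h₇ := mul_le_mul_of_nonneg_left hfsq hlam.le
  have hpos : 0 < 2 * (2 + 4 * L) ^ 2 := by positivity
  rw [show 2 + 2 * (2 * L) = 2 + 4 * L by ring, div_le_iff₀ hpos, mul_comm _ (2 * _)] at h₁
  refine h₁.trans (mul_le_mul_of_nonneg_left ?_ (by positivity))
  linarith

end Estimate

/-! ### Comparison of the grid complexity with the radius of the algorithm. -/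

section Radius

/-- The choice of the level of the grid. -/
lemma exists_grid_level {X : ℝ} (hX : 0 ≤ X) {J : ℕ} (hJ : 1 + X ≤ 4 ^ J) :
    ∃ j ≤ J, 1 + X ≤ 4 ^ j ∧ (4 : ℝ) ^ j ≤ 4 * (1 + X) := by
  classical
  have hex : ∃ j : ℕ, 1 + X ≤ 4 ^ j := ⟨J, hJ⟩
  refine ⟨Nat.find hex, Nat.find_min' hex hJ, Nat.find_spec hex, ?_⟩
  rcases Nat.eq_zero_or_pos (Nat.find hex) with h | h
  · rw [h]
    linarith
  · have := Nat.find_min hex (m := Nat.find hex - 1) (by omega)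
    rw [not_le] at this
    obtain ⟨i, hi⟩ := Nat.exists_eq_succ_of_ne_zero h.ne'
    rw [hi] at this ⊢
    rw [pow_succ]
    simp only [Nat.succ_eq_add_one, Nat.add_sub_cancel] at this
    linarith

/-- The complexity of the grid at the level adapted to the number of episodes. -/
lemma grid_complexity_le {d d' X δ : ℝ} {j : ℕ} (hd : 2 ≤ d) (hd' : d' ≤ 3 / 2 * d)
    (hX : 0 ≤ X) (hδ : 0 < δ) (hδ1 : δ < 1) (h₁ : 1 + X ≤ 4 ^ j)
    (h₂ : (4 : ℝ) ^ j ≤ 4 * (1 + X)) :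
    d * X * ((1 / 2) ^ j) ^ 2 + Real.log (2 / δ) + (j + 1) * Real.log 2 +
      d' * (((1 / 2) ^ j) ^ 2 / 4 + 1 / 4 + Real.log (1 + 2 / (1 / 2) ^ j)) ≤
      7 / 5 * (d * (Real.log (1 + X) + 2 * Real.log (8 / δ))) := by
  have hb : ((1 / 2 : ℝ) ^ j) ^ 2 * 4 ^ j = 1 := by
    rw [← pow_mul, mul_comm j 2, pow_mul, ← mul_pow]
    norm_num
  set b2 := ((1 / 2 : ℝ) ^ j) ^ 2 with hb2
  have hb20 : 0 < b2 := by positivity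
  have hbX : b2 * (1 + X) ≤ 1 := by nlinarith
  set l2 := Real.log 2 with hl2
  set lX := Real.log (1 + X) with hlX
  have hl2lo : 0.69 < l2 := by linarith [Real.log_two_gt_d9]
  have hl2hi : l2 < 0.7 := by linarith [Real.log_two_lt_d9]
  have hlX0 : 0 ≤ lX := Real.log_nonneg (by linarith)
  have hlog4 : Real.log 4 = 2 * l2 := by
    rw [show (4 : ℝ) = 2 ^ 2 by norm_num, Real.log_pow]
    norm_num [hl2]
  have hlog8 : Real.log 8 = 3 * l2 := by
    rw [show (8 : ℝ) = 2 ^ 3 by norm_num, Real.log_pow]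
    norm_num [hl2]
  have hjl : j * (2 * l2) ≤ 2 * l2 + lX := by
    have := Real.log_le_log (by positivity) h₂
    rwa [Real.log_pow, Real.log_mul (by norm_num) (by linarith), hlog4] at this
  have h2j : 2 / (1 / 2 : ℝ) ^ j = 2 * 2 ^ j := by
    rw [one_div, inv_pow, div_inv_eq_mul]
  have hlogZ : Real.log (1 + 2 / (1 / 2) ^ j) ≤ 3 * l2 + 1 / 2 * lX := by
    rw [h2j]
    have hs : (2 * 2 ^ j : ℝ) ≤ 4 * √(1 + X) := by
      have : ((2 : ℝ) ^ j) ≤ 2 * √(1 + X) := by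
        refine le_of_sq_le_sq ?_ (by positivity)
        rw [mul_pow, Real.sq_sqrt (by linarith), ← pow_mul, mul_comm j 2, pow_mul]
        norm_num
        linarith
      linarith
    have hs1 : 1 ≤ √(1 + X) := Real.one_le_sqrt.2 (by linarith)
    calc Real.log (1 + 2 * 2 ^ j) ≤ Real.log (8 * √(1 + X)) :=
          Real.log_le_log (by positivity) (by linarith)
      _ = 3 * l2 + 1 / 2 * lX := by
          rw [Real.log_mul (by norm_num) (by positivity), hlog8, Real.log_sqrt (by linarith)]
          ring
  rw [Real.log_div (by norm_num) hδ.ne', Real.log_div (by norm_num) hδ.ne', hlog8]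
  have hD : Real.log δ < 0 := Real.log_neg hδ hδ1
  set D := Real.log δ
  have e₁ : d' * (b2 / 4 + 1 / 4 + Real.log (1 + 2 / (1 / 2) ^ j)) ≤
      3 / 2 * d * (b2 / 4 + 1 / 4 + (3 * l2 + 1 / 2 * lX)) :=
    mul_le_mul hd' (by linarith) (add_nonneg (by positivity) (Real.log_nonneg
      (by rw [h2j]; have : (0:ℝ) < 2 ^ j := by positivity
          linarith))) (by linarith)
  -- At the chosen level `b2 * (1 + X) ≤ 1`, so the discretization costs at most the dimension `d`.
  have e₂ : d * X * b2 + 3 / 2 * d * (b2 / 4) ≤ d := by nlinarith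
  -- The remaining inequality is bilinear in `d` and the logarithms; these products make it linear.
  have f₁ := mul_nonneg (sub_nonneg.2 hd) hlX0
  have f₂ := mul_nonneg (by linarith : 0 ≤ 3.9 * d - 3) (sub_nonneg.2 hl2lo.le)
  have f₃ := mul_nonneg (sub_nonneg.2 hd) (neg_nonneg.2 hD.le)
  linarith

/-- Here `y = 1 + L`: the factor `(4 * y - 2) ^ 2 = (2 + 4 * L) ^ 2` is the curvature loss of the
likelihood, and `2 * y + √(2 * y) * y` is a lower bound for `γ / β`. The first inequality pays for
the terms in `lam * L ^ 2`, the second for the logarithmic ones, where `β ^ 2` gains a factor `2 * y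
- 1 = 1 + 2 * L`. -/
lemma radius_poly {y : ℝ} (hy : 1 ≤ y) :
    4 / 3 * (4 * y - 2) ^ 2 + 4 ≤ (2 * y + √(2 * y) * y) ^ 2 ∧
      14 / 5 * (4 * y - 2) ^ 2 ≤ (2 * y + √(2 * y) * y) ^ 2 * (2 * y - 1) := by
  have hs : √(2 * y) ^ 2 = 2 * y := Real.sq_sqrt (by linarith)
  have hs1 : 1.414 ≤ √(2 * y) := Real.le_sqrt_of_sq_le (by norm_num; linarith)
  have hG : y ^ 2 * (9.656 + 2 * y) ≤ (2 * y + √(2 * y) * y) ^ 2 := by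
    have : (2 * y + √(2 * y) * y) ^ 2 = y ^ 2 * (4 + 4 * √(2 * y) + √(2 * y) ^ 2) := by ring
    rw [this, hs]
    exact mul_le_mul_of_nonneg_left (by linarith) (sq_nonneg y)
  constructor
  · refine le_trans ?_ hG
    nlinarith [sq_nonneg (y - 2.4), mul_nonneg (sub_nonneg.2 hy) (sq_nonneg (y - 2.4))]
  · refine le_trans ?_ (mul_le_mul_of_nonneg_right hG (by linarith))
    have : 14 / 5 * (4 * y - 2) ^ 2 = (56 / 5 * (2 * y - 1)) * (2 * y - 1) := by ring
    rw [this]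
    refine mul_le_mul_of_nonneg_right ?_ (by linarith)
    nlinarith [sq_nonneg (y - 1), mul_nonneg (sq_nonneg y) (sub_nonneg.2 hy)]

/-- The radius `γ` dominates the estimation error. -/
lemma le_gamma_sq {nS nA M H k : ℕ} {L lam δ X B : ℝ} (hS : 1 ≤ nS) (hA : 1 ≤ nA) (hM : 1 ≤ M)
    (hH : 1 ≤ H) (hL : 0 ≤ L) (hlam : 0 < lam) (hδ : 0 < δ) (hδ1 : δ < 1) (hX0 : 0 ≤ X)
    (hX : X ≤ k / ((M + 1) * nS * nA * lam))
    (hB : B ≤ 7 / 5 * ((M * (M + 1) * nS * nA * H) *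
      (Real.log (1 + X) + 2 * Real.log (8 / δ)))) :
    2 * (2 + 4 * L) ^ 2 * (B + 2 / 3 * lam * L ^ 2) + 4 * lam * L ^ 2 ≤
      gamma nS nA M H L lam (δ / 4) k ^ 2 := by
  have hMr : (1 : ℝ) ≤ M := by exact_mod_cast hM
  have hHr : (1 : ℝ) ≤ H := by exact_mod_cast hH
  have hSr : (1 : ℝ) ≤ nS := by exact_mod_cast hS
  have hAr : (1 : ℝ) ≤ nA := by exact_mod_cast hA
  set d : ℝ := M * (M + 1) * nS * nA * H with hd
  have hd0 : 0 < d := by positivity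
  set ell := Real.log (1 + k / ((M + 1) * nS * nA * lam)) + 2 * Real.log (2 / (δ / 4)) with hell
  have h8 : 2 / (δ / 4) = 8 / δ := by field_simp; norm_num
  have hle : Real.log (1 + X) + 2 * Real.log (8 / δ) ≤ ell := by
    rw [hell, h8]
    have := Real.log_le_log (by linarith : 0 < 1 + X) (add_le_add_right hX 1)
    linarith
  have hl0 : 0 ≤ Real.log (1 + X) + 2 * Real.log (8 / δ) := by
    have e₁ := Real.log_nonneg (by linarith : 1 ≤ 1 + X)
    have e₂ : 0 ≤ Real.log (8 / δ) := Real.log_nonneg (by rw [le_div_iff₀ hδ]; linarith)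
    linarith
  have hell0 : 0 ≤ ell := hl0.trans hle
  set sl := √lam with hsl
  have hsl0 : 0 < sl := Real.sqrt_pos.2 hlam
  have hsl2 : sl ^ 2 = lam := Real.sq_sqrt hlam.le
  set sM := √(M : ℝ) with hsM
  have hsM2 : sM ^ 2 = M := Real.sq_sqrt (by linarith)
  have hsM1 : 1 ≤ sM := Real.one_le_sqrt.2 hMr
  have hM32 : (M : ℝ) ^ (3 / 2 : ℝ) = M * sM := by
    rw [show (3 / 2 : ℝ) = 1 + 1 / 2 by norm_num, Real.rpow_add (by linarith), Real.rpow_one,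
      ← Real.sqrt_eq_rpow]
  have hb1 : √(lam / (4 * M)) = sl / (2 * sM) := by
    rw [Real.sqrt_div hlam.le, Real.sqrt_mul (by norm_num)]
    congr 2
    rw [show (4 : ℝ) = 2 ^ 2 by norm_num, Real.sqrt_sq (by norm_num)]
  set β := beta nS nA M H L lam (δ / 4) k with hβ
  have hβeq : β = sM * d / sl * ell + sl / (2 * sM) + sl * L := by
    rw [hβ, beta, hM32, hb1, ← hsl, ← hell]
    congr 3
    rw [hd]
    ring
  have hβlow : sl * L ≤ β := by
    have : 0 ≤ sM * d / sl * ell + sl / (2 * sM) := by positivity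
    linarith
  have hβ0 : 0 ≤ β := le_trans (by positivity) hβlow
  have hβsq : lam * L ^ 2 + d * ell * (1 + 2 * L) ≤ β ^ 2 := by
    -- Besides the square of `√lam * L`, the two cross terms with `a` are used: in them the factors
    -- `√lam` cancel, and together they give `d * ell * (1 + 2 * L)`.
    set a := sM * d / sl * ell with ha
    have ha0 : 0 ≤ a := by positivity
    have h₁ : 2 * a * (sl / (2 * sM)) = d * ell := by
      rw [ha]
      field_simp
    have h₂ : a * sl = sM * (d * ell) := by
      rw [ha]
      field_simp
    have h₃ : d * ell ≤ a * sl := by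
      rw [h₂]
      exact le_mul_of_one_le_left (by positivity) hsM1
    have h₄ : d * ell * L ≤ a * sl * L := mul_le_mul_of_nonneg_right h₃ hL
    have h₆ : 0 ≤ sl / (2 * sM) * (sl * L) := by positivity
    have h₇ : (a + sl / (2 * sM) + sl * L) ^ 2 = a ^ 2 + (sl / (2 * sM)) ^ 2 + sl ^ 2 * L ^ 2 +
        2 * a * (sl / (2 * sM)) + 2 * (a * sl * L) + 2 * (sl / (2 * sM) * (sl * L)) := by ring
    rw [hβeq, h₇, hsl2, h₁]
    linarith [sq_nonneg a, sq_nonneg (sl / (2 * sM))]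
  set y := 1 + L with hy
  have hy1 : 1 ≤ y := by linarith
  set G := 2 * y + √(2 * y) * y with hG
  have hG0 : 0 ≤ G := by positivity
  have hγ : G * β ≤ gamma nS nA M H L lam (δ / 4) k := by
    rw [gamma, ← hβ]
    -- One of the two factors `β` in the quadratic term of `γ` is replaced by its summand `√lam *
    -- L`, which removes `lam`.
    have h₁ : √(2 * y) ≤ √(2 * (1 + L) * H * M / lam) * sl := by
      rw [hsl, ← Real.sqrt_mul (by positivity), div_mul_cancel₀ _ hlam.ne']
      refine Real.sqrt_le_sqrt ?_
      rw [← hy, mul_assoc]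
      exact le_mul_of_one_le_right (by positivity) (one_le_mul_of_one_le_of_one_le hHr hMr)
    have h₂ : √(2 * y) * L ≤ √(2 * (1 + L) * H * M / lam) * β := by
      calc √(2 * y) * L ≤ √(2 * (1 + L) * H * M / lam) * sl * L :=
            mul_le_mul_of_nonneg_right h₁ hL
        _ = √(2 * (1 + L) * H * M / lam) * (sl * L) := by ring
        _ ≤ _ := mul_le_mul_of_nonneg_left hβlow (Real.sqrt_nonneg _)
    have h₃ := mul_le_mul_of_nonneg_right h₂ hβ0
    have h₄ : G = 2 + 2 * L + √(2 * y) + √(2 * y) * L := by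
      rw [hG, hy]
      ring
    rw [h₄, ← hy]
    linarith
  have hγ2 : (G * β) ^ 2 ≤ gamma nS nA M H L lam (δ / 4) k ^ 2 :=
    pow_le_pow_left₀ (by positivity) hγ 2
  refine le_trans ?_ hγ2
  obtain ⟨p₁, p₂⟩ := radius_poly hy1
  rw [← hG] at p₁ p₂
  have hy4 : 4 * y - 2 = 2 + 4 * L := by rw [hy]; ring
  have hy2 : 2 * y - 1 = 1 + 2 * L := by rw [hy]; ring
  rw [hy4] at p₁ p₂
  rw [hy2] at p₂
  have hB' : B ≤ 7 / 5 * (d * ell) := hB.trans (by gcongr)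
  have q₁ := mul_le_mul_of_nonneg_right p₁ (by positivity : 0 ≤ lam * L ^ 2)
  have q₂ := mul_le_mul_of_nonneg_right p₂ (by positivity : 0 ≤ d * ell)
  have q₃ := mul_le_mul_of_nonneg_left hB' (by positivity : 0 ≤ 2 * (2 + 4 * L) ^ 2)
  have q₄ := mul_le_mul_of_nonneg_left hβsq (sq_nonneg G)
  rw [mul_pow]
  linarith

end Radius

/-! ### Correctness of the planner's input on the good event. -/

section Validity

variable {S : Type*} {A : Type*} {M H : ℕ} [Fintype S] [Fintype A] [DecidableEq S]
  [DecidableEq A]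

/-- The coordinates that appear in the sufficient statistics. -/
def Coord.IsUsed : Coord S A M H → Prop
  | none => True
  | some c => (c.1 : ℕ) + 1 < H

/-- In every episode that visits `c`, the feature at `c` is controlled by two consecutive sufficient
statistics, or is itself the first one when `c = none`. Summing over the episodes brings in the
visit count. -/
lemma Model.visits_mul_sq_le (m : Model S A M H) (hH : 1 ≤ H) (v : Feature S A M H) {k : ℕ}
    (past : Fin k → Episode S A M H) {c : Coord S A M H} (hc : Coord.IsUsed c) (i : Fin M) :
    visits past c * v c i ^ 2 ≤ 2 * m.pastSq v past := by
  have h₁ : ∀ j, ∑ h : Fin H, suffStat m.α v h ((past j).hist h) i ^ 2 ≤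
      ∑ h : Fin H, ∑ i, suffStat m.α v h ((past j).hist h) i ^ 2 := fun j =>
    Finset.sum_le_sum fun h _ => Finset.single_le_sum
      (f := fun i => suffStat m.α v h ((past j).hist h) i ^ 2) (fun _ _ => sq_nonneg _)
      (Finset.mem_univ i)
  have h₀ : ∀ j, 0 ≤ ∑ h : Fin H, suffStat m.α v h ((past j).hist h) i ^ 2 := fun j =>
    Finset.sum_nonneg fun _ _ => sq_nonneg _
  rw [Model.pastSq, Finset.mul_sum]
  rcases c with _ | ⟨t, y⟩
  · have h₂ : (visits past (none : Coord S A M H) : ℝ) * v none i ^ 2 =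
        ∑ _j : Fin k, v none i ^ 2 := by simp [visits]
    rw [h₂]
    refine Finset.sum_le_sum fun j _ => ?_
    linarith [sq_feature_none_le_sum (α := m.α) hH v (past j) i, h₁ j, h₀ j]
  · have h₂ : (visits past (some (t, y)) : ℝ) * v (some (t, y)) i ^ 2 =
        ∑ j : Fin k, if (past j).1 t = y then v (some (t, y)) i ^ 2 else 0 := by
      rw [visits, Finset.card_filter, Nat.cast_sum, Finset.sum_mul]
      exact Finset.sum_congr rfl fun j _ => by split_ifs <;> simp
    rw [h₂]
    refine Finset.sum_le_sum fun j _ => ?_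
    split_ifs with hj
    · have h₃ := sq_feature_le_two_mul_sum m.α_nonneg m.α_le_one v (past j) t hc i
      subst hj
      refine h₃.trans ?_
      linarith [h₁ j]
    · linarith [h₁ j, h₀ j]

/-- There are at least two coordinates besides `none`, so `none` raises the dimension by at most one
half. -/
lemma card_coord_prod (hM : 1 ≤ M) (hH : 1 ≤ H) (hS : 1 ≤ Fintype.card S)
    (hA : 1 ≤ Fintype.card A) :
    (Fintype.card (Coord S A M H × Fin M) : ℝ) ≤
      3 / 2 * (M * (M + 1) * Fintype.card S * Fintype.card A * H) := by
  have h₁ : Fintype.card (Coord S A M H × Fin M) =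
      (H * (Fintype.card S * (Fintype.card A * (M + 1))) + 1) * M := by
    simp [Fintype.card_option]
  have hSr : (1 : ℝ) ≤ Fintype.card S := by exact_mod_cast hS
  have hAr : (1 : ℝ) ≤ Fintype.card A := by exact_mod_cast hA
  have hMr : (1 : ℝ) ≤ M := by exact_mod_cast hM
  have hHr : (1 : ℝ) ≤ H := by exact_mod_cast hH
  have h₂ : (2 : ℝ) ≤ H * (Fintype.card S * (Fintype.card A * (M + 1))) := by
    have e₁ : (2 : ℝ) ≤ M + 1 := by linarith
    have e₂ := mul_le_mul hAr e₁ (by norm_num) (by linarith)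
    have e₃ := mul_le_mul hSr e₂ (by norm_num) (by linarith)
    have e₄ := mul_le_mul hHr e₃ (by norm_num) (by linarith)
    linarith
  rw [h₁]
  push_cast
  nlinarith

lemma beta_nonneg {nS nA M H k : ℕ} {L lam δ : ℝ} (hL : 0 ≤ L) (hlam : 0 < lam) (hδ : 0 < δ)
    (hδ1 : δ ≤ 1) : 0 ≤ beta nS nA M H L lam δ k := by
  have h₁ : 0 ≤ Real.log (2 / δ) := Real.log_nonneg (by rw [le_div_iff₀ hδ]; linarith)
  have h₂ : 0 ≤ Real.log (1 + k / ((M + 1) * nS * nA * lam)) :=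
    Real.log_nonneg (by linarith [show 0 ≤ (k : ℝ) / ((M + 1) * nS * nA * lam) by positivity])
  unfold beta
  positivity

lemma gamma_nonneg {nS nA M H k : ℕ} {L lam δ : ℝ} (hL : 0 ≤ L) (hlam : 0 < lam) (hδ : 0 < δ)
    (hδ1 : δ ≤ 1) : 0 ≤ gamma nS nA M H L lam δ k := by
  have := beta_nonneg (nS := nS) (nA := nA) (M := M) (H := H) (k := k) hL hlam hδ hδ1
  unfold gamma
  positivity

lemma Model.featBonus_nonneg (m : Model S A M H) {L lam δ : ℝ} (hL : 0 ≤ L) (hlam : 0 < lam)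
    (hδ : 0 < δ) (hδ1 : δ < 1) (k n : ℕ) : 0 ≤ m.featBonus L lam δ k n := by
  have := gamma_nonneg (nS := Fintype.card S) (nA := Fintype.card A) (M := M) (H := H) (k := k)
    (δ := δ / 4) hL hlam (by linarith) (by linarith)
  unfold Model.featBonus
  positivity

variable [Nonempty S] [Nonempty A]

/-- On the good event the confidence intervals contain all the features that matter. -/
lemma Model.FeatAccurate.abs_sub_le_featBonus {m : Model S A M H} {lam L δ : ℝ} {J N k : ℕ}
    {past : Fin k → Episode S A M H} (hm : m.FeatAccurate lam (Real.log (2 / δ)) J N past)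
    (hM : 1 ≤ M) (hH : 1 ≤ H) (hlam : 0 < lam) (hL : 0 ≤ L) (hδ : 0 < δ) (hδ1 : δ < 1)
    {b fhat : Feature S A M H} (hf : m.f ∈ rectSet b) (hb : l2norm b ≤ L)
    (hmem : fhat ∈ rectSet b) (hmax : IsMaxOn (logLik m.α lam past) (rectSet b) fhat)
    (hJ : 1 + (k : ℝ) * H / (M * (M + 1) * Fintype.card S * Fintype.card A * H * lam) ≤ 4 ^ J)
    (hN : ∀ j ≤ J, L + √(2 / lam) * (1 / 2) ^ j ≤ √(2 / lam) * (1 / 2) ^ j * N)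
    {c : Coord S A M H} (hc : Coord.IsUsed c) (i : Fin M) :
    |fhat c i - m.f c i| ≤ m.featBonus L lam δ (k + 1) (visits past c) := by
  have hS : 1 ≤ Fintype.card S := Fintype.card_pos
  have hA : 1 ≤ Fintype.card A := Fintype.card_pos
  have hSr : (1 : ℝ) ≤ Fintype.card S := by exact_mod_cast hS
  have hAr : (1 : ℝ) ≤ Fintype.card A := by exact_mod_cast hA
  have hMr : (1 : ℝ) ≤ M := by exact_mod_cast hM
  have hHr : (1 : ℝ) ≤ H := by exact_mod_cast hH
  set nS := Fintype.card S
  set nA := Fintype.card A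
  set d : ℝ := M * (M + 1) * nS * nA * H with hd
  have hd2 : 2 ≤ d := by
    have e₁ : (2 : ℝ) ≤ M * (M + 1) := by nlinarith
    have e₂ := mul_le_mul e₁ hSr (by norm_num) (by positivity)
    have e₃ := mul_le_mul e₂ hAr (by norm_num) (by positivity)
    have e₄ := mul_le_mul e₃ hHr (by norm_num) (by positivity)
    linarith
  set X : ℝ := (k : ℝ) * H / (d * lam) with hX
  have hX0 : 0 ≤ X := by positivity
  obtain ⟨j, hj, h₁, h₂⟩ := exists_grid_level hX0 hJ
  have hB := grid_complexity_le hd2 (card_coord_prod (S := S) (A := A) hM hH hS hA) hX0 hδ hδ1 h₁ h₂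
  have hdX : d * X * ((1 / 2) ^ j) ^ 2 = k * H * ((1 / 2) ^ j) ^ 2 / lam := by
    rw [hX]
    field_simp
  rw [hdX] at hB
  have hXle : X ≤ ((k + 1 : ℕ) : ℝ) / ((M + 1) * nS * nA * lam) := by
    have e : X = k / (M * ((M + 1) * nS * nA * lam)) := by
      rw [hX, hd]
      field_simp
    rw [e]
    refine div_le_div₀ (by positivity) (by push_cast; linarith) (by positivity) ?_
    exact le_mul_of_one_le_left (by positivity) hMr
  have hγ := le_gamma_sq (L := L) (lam := lam) hS hA hM hH hL hlam hδ hδ1 hX0 hXle hB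
  have hQ := hm.pastSq_le hlam hL hf hb hmem hmax hj (hN j hj)
  set v : Feature S A M H := fun c i => fhat c i - m.f c i with hv
  have hvis := m.visits_mul_sq_le hH v past hc i
  have hvc : v c i ^ 2 ≤ 4 * L ^ 2 := by
    have e₁ : ∑ c, ∑ i, v c i ^ 2 ≤ (2 * L) ^ 2 := sum_sq_sub_le hmem hf hb
    have e₂ := (Finset.single_le_sum (f := fun i => v c i ^ 2) (fun _ _ => sq_nonneg _)
      (Finset.mem_univ i)).trans (Finset.single_le_sum (f := fun c => ∑ i, v c i ^ 2)
      (fun _ _ => Finset.sum_nonneg fun _ _ => sq_nonneg _) (Finset.mem_univ c))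
    linarith
  have hκ := m.one_le_kappa hM hH
  have hE := one_le_effHorizon m.α_nonneg hH
  set κ := m.kappa
  set E := effHorizon m.α H
  set n : ℝ := ((visits past c : ℕ) : ℝ) with hn
  have hn0 : 0 ≤ n := Nat.cast_nonneg _
  set g := gamma nS nA M H L lam (δ / 4) (k + 1) with hg
  rw [temp_sq m.α_nonneg hH] at hQ
  -- The likelihood bound supplies the term with the visits, and the trivial bound `|v| ≤ 2 * L`
  -- supplies the regularizing term `4 * lam * E` of the denominator.
  have hmain : κ⁻¹ * E⁻¹ * (n * v c i ^ 2 / 2) + lam * v c i ^ 2 ≤ g ^ 2 := by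
    refine le_trans (add_le_add ?_ ?_) hγ
    · refine le_trans (mul_le_mul_of_nonneg_left ?_ (by positivity)) hQ
      linarith
    · nlinarith
  have hfin : v c i ^ 2 * (n + 4 * lam * E) ≤ 4 * (κ * E) * g ^ 2 := by
    have e₁ := mul_le_mul_of_nonneg_left hmain (by positivity : 0 ≤ 4 * (κ * E))
    have e₂ : 4 * (κ * E) * (κ⁻¹ * E⁻¹ * (n * v c i ^ 2 / 2) + lam * v c i ^ 2) =
        2 * (n * v c i ^ 2) + 4 * lam * E * κ * v c i ^ 2 := by
      have : κ ≠ 0 := by positivity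
      have : E ≠ 0 := by positivity
      field_simp
      ring
    rw [e₂] at e₁
    have e₃ : 0 ≤ n * v c i ^ 2 := by positivity
    have e₄ : 4 * lam * E * v c i ^ 2 ≤ 4 * lam * E * κ * v c i ^ 2 := by
      have : 4 * lam * E * κ * v c i ^ 2 = κ * (4 * lam * E * v c i ^ 2) := by ring
      rw [this]
      exact le_mul_of_one_le_left (by positivity) hκ
    linarith
  have hden : 0 < n + 4 * lam * E := by positivity
  refine abs_le_of_sq_le_sq ?_ (m.featBonus_nonneg hL hlam hδ hδ1 _ _)
  change v c i ^ 2 ≤ _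
  rw [Model.featBonus, div_pow, mul_pow, mul_pow, Real.sq_sqrt (by positivity),
    Real.sq_sqrt hden.le, le_div_iff₀ hden]
  linarith

/-- `N` is chosen for the finest level and suffices for the coarser ones, whose mesh is larger. The
additional mesh leaves room for the rounding. -/
lemma exists_grid_size {lam L : ℝ} (hlam : 0 < lam) (x : ℝ) :
    ∃ J N : ℕ, x ≤ 4 ^ J ∧
      ∀ j ≤ J, L + √(2 / lam) * (1 / 2) ^ j ≤ √(2 / lam) * (1 / 2) ^ j * N := by
  obtain ⟨J, hJ⟩ := pow_unbounded_of_one_lt x (by norm_num : (1 : ℝ) < 4)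
  have hr : 0 < √(2 / lam) := by positivity
  obtain ⟨N, hN⟩ := exists_nat_ge (|L| / (√(2 / lam) * (1 / 2) ^ J) + 1)
  refine ⟨J, N, hJ.le, fun j hj => ?_⟩
  have h₁ : √(2 / lam) * (1 / 2) ^ J ≤ √(2 / lam) * (1 / 2) ^ j :=
    mul_le_mul_of_nonneg_left (pow_le_pow_of_le_one (by norm_num) (by norm_num) hj) hr.le
  have h₂ : |L| ≤ √(2 / lam) * (1 / 2) ^ J * (N - 1) := by
    have h₃ : |L| / (√(2 / lam) * (1 / 2) ^ J) ≤ N - 1 := by linarith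
    rwa [div_le_iff₀' (by positivity)] at h₃
  have h₄ : (0 : ℝ) ≤ N - 1 := by
    have : 0 ≤ |L| / (√(2 / lam) * (1 / 2) ^ J) := by positivity
    linarith
  have h₅ := mul_le_mul_of_nonneg_right h₁ h₄
  linarith [le_abs_self L]

/-- The bonus of a triple after `n` visits. -/
noncomputable def bonus (nS nA M H K : ℕ) (δ : ℝ) (n : ℕ) : ℝ :=
  rewardBonus nS nA M H K δ n + transBonus nS nA M H K δ n

/-- Rewards are deterministic functions of the triple, so one visit reveals them and no
concentration is needed. -/
lemma rHat_eq (m : Model S A M H) {k : ℕ} (past : Fin k → Episode S A M H) (h : Fin H) (s : S)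
    (a : A) (x : Fin (M + 1)) : rHat m past h s a x =
      if visits past (some (h, s, a, x)) = 0 then 0 else m.r h s a x := by
  have h₁ : ∑ j, (if (past j).1 h = (s, a, x)
      then m.r h ((past j).1 h).1 ((past j).1 h).2.1 ((past j).1 h).2.2 else 0) =
      visits past (some (h, s, a, x)) * m.r h s a x := by
    rw [visits, Finset.card_filter, Nat.cast_sum, Finset.sum_mul]
    refine Finset.sum_congr rfl fun j _ => ?_
    by_cases hj : (past j).1 h = (s, a, x) <;> simp [hj]
  rw [rHat, h₁]
  split_ifs with h0
  · simp [h0]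
  · rw [mul_div_cancel_left₀ _ (Nat.cast_ne_zero.2 h0)]

/-- On the good event the planner's input is valid. -/
lemma Model.isValid_planInput {m : Model S A M H} {lam L δ : ℝ} {J N k K : ℕ}
    {past : Fin k → Episode S A M H} (hm : m.FeatAccurate lam (Real.log (2 / δ)) J N past)
    (ht : m.TransAccurate (4 * Fintype.card S * Real.log (8 * Fintype.card S * Fintype.card A *
      M * H * K / δ)) past)
    (hM : 1 ≤ M) (hH : 1 ≤ H) (hlam : 0 < lam) (hL : 0 ≤ L) (hδ : 0 < δ) (hδ1 : δ < 1)
    {b fhat : Feature S A M H} (hf : m.f ∈ rectSet b) (hb : l2norm b ≤ L)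
    (hmem : fhat ∈ rectSet b) (hmax : IsMaxOn (logLik m.α lam past) (rectSet b) fhat)
    (hJ : 1 + (k : ℝ) * H / (M * (M + 1) * Fintype.card S * Fintype.card A * H * lam) ≤ 4 ^ J)
    (hN : ∀ j ≤ J, L + √(2 / lam) * (1 / 2) ^ j ≤ √(2 / lam) * (1 / 2) ^ j * N)
    (hι : 1 ≤ Real.log (8 * Fintype.card S * Fintype.card A * M * H * K / δ)) :
    (m.planInput K L lam δ past fhat).IsValid m
      (fun h y => 2 * bonus (Fintype.card S) (Fintype.card A) M H K δ (visits past (some (h, y))))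
      (fun c => m.featBonus L lam δ (k + 1) (visits past c)) := by
  have hHr : (1 : ℝ) ≤ H := by exact_mod_cast hH
  have hSr : (1 : ℝ) ≤ Fintype.card S := by exact_mod_cast (Fintype.card_pos : 0 < Fintype.card S)
  set ι := Real.log (8 * Fintype.card S * Fintype.card A * M * H * K / δ) with hιdef
  have hfeat : ∀ c : Coord S A M H, Coord.IsUsed c → ∀ i, |fhat c i - m.f c i| ≤
      m.featBonus L lam δ (k + 1) (visits past c) := fun c hc i =>
    hm.abs_sub_le_featBonus hM hH hlam hL hδ hδ1 hf hb hmem hmax hJ hN hc i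
  have hrb0 : ∀ n, 0 ≤ rewardBonus (Fintype.card S) (Fintype.card A) M H K δ n := fun n =>
    le_min (Real.sqrt_nonneg _) zero_le_one
  have htb0 : ∀ n, 0 ≤ transBonus (Fintype.card S) (Fintype.card A) M H K δ n := fun n =>
    le_min (by positivity) (by positivity)
  have hrHat0 : ∀ h s a x, 0 ≤ rHat m past h s a x := by
    intro h s a x
    rw [rHat_eq]
    split_ifs
    · exact le_rfl
    · exact m.r_nonneg h s a x
  have hrHat1 : ∀ h s a x, rHat m past h s a x ≤ m.r h s a x := by
    intro h s a x
    rw [rHat_eq]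
    split_ifs
    · exact m.r_nonneg h s a x
    · exact le_rfl
  have hrle : ∀ h s a x, m.r h s a x ≤ rHat m past h s a x +
      rewardBonus (Fintype.card S) (Fintype.card A) M H K δ (visits past (some (h, s, a, x))) := by
    intro h s a x
    rw [rHat_eq]
    split_ifs with h0
    -- Without visits the bonus is one, because `1 ≤ ι`, and this covers any reward.
    · rw [h0, rewardBonus, ← hιdef]
      have : 1 ≤ √(ι / (max 0 1 : ℕ)) := by
        rw [Real.one_le_sqrt]
        simpa using hι
      rw [min_eq_right this]
      linarith [m.r_le_one h s a x]
    · linarith [hrb0 (visits past (some (h, s, a, x)))]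
  have htrans : ∀ h s a x (V : S → ℝ), (∀ s', 0 ≤ V s') → (∀ s', V s' ≤ H) →
      |∑ s', pHat past h s a x s' * V s' - expect (m.P h s a x) V| ≤
      transBonus (Fintype.card S) (Fintype.card A) M H K δ (visits past (some (h, s, a, x))) :=
    fun h s a x V hV0 hV => ht.abs_sub_le (by nlinarith) h s a x hV0 hV
  constructor
  · intro h s a x
    exact add_nonneg (hrHat0 h s a x) (add_nonneg (hrb0 _) (htb0 _))
  · intro h s a x s'
    exact pHat_nonneg past h s a x s'
  · intro h s a x V hV0 hV
    have h₁ := (abs_le.1 (htrans h s a x V hV0 hV)).1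
    have h₂ := hrle h s a x
    simp only [Model.planInput]
    linarith
  · intro h s a x V hV0 hV
    have h₁ := (abs_le.1 (htrans h s a x V hV0 hV)).2
    have h₂ := hrHat1 h s a x
    have h₃ := hrb0 (visits past (some (h, s, a, x)))
    simp only [Model.planInput, bonus]
    linarith
  · intro h s a x V hV0 hV
    -- The total is at most `1 + 1 + 2 * H + H ≤ 5 * H`.
    have h₁ := sum_pHat_mul_le past h s a x (Nat.cast_nonneg H) hV
    have h₂ := (hrHat1 h s a x).trans (m.r_le_one h s a x)
    have h₃ : rewardBonus (Fintype.card S) (Fintype.card A) M H K δ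
      (visits past (some (h, s, a, x))) ≤ 1 := min_le_right _ _
    have h₄ : transBonus (Fintype.card S) (Fintype.card A) M H K δ
      (visits past (some (h, s, a, x))) ≤ 2 * H := min_le_right _ _
    simp only [Model.planInput]
    linarith
  · intro i
    have := abs_le.1 (hfeat none trivial i)
    simp only [Model.planInput]
    linarith
  · intro i
    have := abs_le.1 (hfeat none trivial i)
    simp only [Model.planInput]
    linarith
  · intro h y i hlt
    have := abs_le.1 (hfeat (some (h, y)) hlt i)
    simp only [Model.planInput]
    linarith
  · intro h y i hlt
    have := abs_le.1 (hfeat (some (h, y)) hlt i)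
    simp only [Model.planInput]
    linarith
  · intro c
    exact m.featBonus_nonneg hL hlam hδ hδ1 _ _
  · intro c i
    simp only [Model.planInput]
    ring

end Validity

/-! ### From observed to expected errors -/

section Martingale

variable {S : Type*} {A : Type*} {M H : ℕ}

/-- A run records only episodes; the initial state, on which the regret depends, is read off as the
first recorded state. -/
lemma Model.state_zero_of_mem_support (m : Model S A M H) (π : Policy S A M H) (s₀ : S)
    {e : Episode S A M H} (he : e ∈ (m.episodeLaw π s₀).support) : e.state 0 = s₀ := by
  have key : ∀ (h : ℕ) (hh : h ≤ H), ∀ p ∈ (m.prefixLaw π s₀ h hh).support,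
      (if h0 : 0 < h then (p.1 ⟨0, h0⟩).1 else p.2) = s₀ := by
    intro h
    induction h with
    | zero =>
      intro hh p hp
      rw [Model.prefixLaw, PMF.mem_support_pure_iff] at hp
      simp [hp]
    | succ h ih =>
      intro hh p hp
      simp only [Model.prefixLaw, PMF.mem_support_bind_iff, PMF.mem_support_pure_iff] at hp
      obtain ⟨p', hp', a, -, x, -, s', -, rfl⟩ := hp
      have := ih (Nat.le_of_succ_le hh) p' hp'
      rw [dif_pos (Nat.succ_pos h)]
      rcases Nat.eq_zero_or_pos h with h0 | h0
      · subst h0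
        rw [dif_neg (lt_irrefl 0)] at this
        rw [← this]
        rfl
      · rw [dif_pos h0] at this
        rw [← this]
        have h₁ : (⟨0, Nat.succ_pos h⟩ : Fin (h + 1)) = Fin.castSucc ⟨0, h0⟩ := rfl
        rw [h₁]
        exact congrArg Prod.fst
          (Fin.snoc_castSucc (α := fun _ => Triple S A M) (p'.2, a, x) p'.1 ⟨0, h0⟩)
  have := key H le_rfl e he
  exact this

variable [Fintype S] [Fintype A]

lemma Model.expect_episodeLaw_congr (m : Model S A M H) (π : Policy S A M H) (s₀ : S)
    {F G : Episode S A M H → ℝ} (hFG : ∀ e, e.state 0 = s₀ → F e = G e) :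
    expect (m.episodeLaw π s₀) F = expect (m.episodeLaw π s₀) G := by
  refine Finset.sum_congr rfl fun e _ => ?_
  by_cases he : e ∈ (m.episodeLaw π s₀).support
  · rw [hFG e (m.state_zero_of_mem_support π s₀ he)]
  · rw [PMF.mem_support_iff, not_not] at he
    simp [he]

/-- The chord of the convex exponential over `[-1, 0]`. -/
lemma exp_neg_le_one_sub {y : ℝ} (hy0 : 0 ≤ y) (hy1 : y ≤ 1) :
    Real.exp (-y) ≤ 1 - (1 - Real.exp (-1)) * y := by
  have h := convexOn_exp.2 (Set.mem_univ (0 : ℝ)) (Set.mem_univ (-1 : ℝ)) (sub_nonneg.2 hy1) hy0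
    (by ring)
  simp only [smul_eq_mul, mul_zero, zero_add, mul_neg, mul_one, Real.exp_zero] at h
  linarith

/-- The sum of the conditional expectations of bounded nonnegative errors is bounded by twice their
sum, up to a constant, with high probability. -/
lemma Model.prob_lt_sum_expect_le (m : Model S A M H)
    (init : (k : ℕ) → (Fin k → Episode S A M H) → PMF S) (ℓ : Learner S A M H) (K : ℕ)
    (Y : (k : ℕ) → (Fin k → Episode S A M H) → Episode S A M H → ℝ) {B : ℝ} (hB : 0 < B)
    (hY0 : ∀ k past e, 0 ≤ Y k past e) (hYB : ∀ k past e, Y k past e ≤ B) (t : ℝ) :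
    prob (m.runLaw init ℓ K) {ω | 2 * (∑ j : Fin K, Y j (firstEpisodes ω j j.2.le) (ω j) + B * t) <
      ∑ j : Fin K, expect (m.episodeLaw (ℓ.policy j (firstEpisodes ω j j.2.le)) ((ω j).state 0))
        (Y j (firstEpisodes ω j j.2.le))} ≤ Real.exp (-t) := by
  set c : ℝ := 1 - Real.exp (-1) with hc
  have hc2 : 1 / 2 ≤ c := by
    have h₁ : Real.exp (-1) ≤ 1 / 2 := by
      rw [Real.exp_neg, inv_le_comm₀ (Real.exp_pos 1) (by norm_num)]
      have := Real.add_one_le_exp (1 : ℝ)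
      norm_num at this ⊢
      exact this
    linarith
  let E : (k : ℕ) → (Fin k → Episode S A M H) → S → ℝ := fun k past s₀ =>
    expect (m.episodeLaw (ℓ.policy k past) s₀) (Y k past)
  have hE0 : ∀ k past s₀, 0 ≤ E k past s₀ := fun k past s₀ => le_expect_of_le (hY0 k past)
  -- For `0 ≤ Y ≤ B` the chord bound gives `E exp (-Y / B) ≤ exp (-c * E Y / B)`, which needs no
  -- variance term; `1 / 2 ≤ c` accounts for the factor two.
  have key := m.prob_exists_log_lt_sum_le init ℓ K ({()} : Finset Unit) (fun _ => 1)
    (fun _ _ => one_pos) (fun _ k past e => c * (E k past (e.state 0) / B) + -(Y k past e / B))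
    (by
      intro _ _ k past s₀
      rw [m.expect_episodeLaw_congr _ s₀ (G := fun e => Real.exp (c * (E k past s₀ / B)) *
        Real.exp (-(Y k past e / B))) fun e he => by rw [he, Real.exp_add], expect_mul_left]
      have h₁ : expect (m.episodeLaw (ℓ.policy k past) s₀) (fun e => Real.exp (-(Y k past e / B))) ≤
          1 + -(c / B) * E k past s₀ := by
        rw [← expect_const (m.episodeLaw (ℓ.policy k past) s₀) 1, ← expect_mul_left, ← expect_add]
        refine expect_mono fun e => ?_
        refine (exp_neg_le_one_sub (div_nonneg (hY0 k past e) hB.le)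
          ((div_le_one hB).2 (hYB k past e))).trans (le_of_eq ?_)
        rw [← hc]
        ring
      have h₂ : 1 + -(c / B) * E k past s₀ ≤ Real.exp (-(c * (E k past s₀ / B))) := by
        refine le_trans (le_of_eq ?_) (Real.add_one_le_exp _)
        ring
      calc _ ≤ Real.exp (c * (E k past s₀ / B)) * Real.exp (-(c * (E k past s₀ / B))) :=
            mul_le_mul_of_nonneg_left (h₁.trans h₂) (Real.exp_nonneg _)
        _ = 1 := by rw [← Real.exp_add, add_neg_cancel, Real.exp_zero]) t
  rw [Finset.sum_singleton, one_mul] at key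
  refine (prob_mono ?_).trans key
  intro ω hω
  refine ⟨K, le_rfl, (), Finset.mem_singleton_self _, ?_⟩
  have h₁ : 2 * (∑ j : Fin K, Y j (firstEpisodes ω j j.2.le) (ω j) + B * t) <
    ∑ j : Fin K, E j (firstEpisodes ω j j.2.le) ((ω j).state 0) := hω
  have h₂ : 0 ≤ ∑ j : Fin K, E j (firstEpisodes ω j j.2.le) ((ω j).state 0) :=
    Finset.sum_nonneg fun j _ => hE0 _ _ _
  rw [Real.log_one, sub_zero, Finset.sum_add_distrib, ← Finset.mul_sum, Finset.sum_neg_distrib,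
    ← Finset.sum_div, ← Finset.sum_div, ← sub_eq_add_neg, ← mul_div_assoc, ← sub_div,
    lt_div_iff₀ hB]
  change t * B < c * ∑ j : Fin K, E j (firstEpisodes ω j j.2.le) ((ω j).state 0) -
    ∑ j : Fin K, Y j (firstEpisodes ω j j.2.le) (ω j)
  nlinarith

end Martingale

/-! ### Sums of bonuses -/

section Pigeonhole

/-- Makes sums over successive visits telescope: `√(n + 1) + √n ≤ 3 * √n` for `n ≥ 1`. -/
lemma inv_sqrt_max_le (n : ℕ) :
    1 / √((max n 1 : ℕ) : ℝ) ≤ 3 * (√((n + 1 : ℕ) : ℝ) - √(n : ℝ)) := by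
  rcases Nat.eq_zero_or_pos n with rfl | hn
  · norm_num
  · rw [max_eq_left hn]
    have hn1 : (1 : ℝ) ≤ n := by exact_mod_cast hn
    have h₁ : 0 < √(n : ℝ) := Real.sqrt_pos.2 (by linarith)
    have h₂ : √(n : ℝ) ^ 2 = n := Real.sq_sqrt (by linarith)
    have h₃ : √((n + 1 : ℕ) : ℝ) ^ 2 = n + 1 := by
      rw [Real.sq_sqrt (Nat.cast_nonneg _)]
      push_cast
      ring
    have h₄ : √(n : ℝ) ≤ √((n + 1 : ℕ) : ℝ) := Real.sqrt_le_sqrt (by push_cast; linarith)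
    have h₅ : √((n + 1 : ℕ) : ℝ) ≤ 2 * √(n : ℝ) := by
      refine abs_le_of_sq_le_sq' ?_ (by linarith) |>.2
      rw [h₃, mul_pow, h₂]
      linarith
    rw [div_le_iff₀ h₁]
    nlinarith

variable {S : Type*} {A : Type*} {M H : ℕ} [Fintype S] [Fintype A] [DecidableEq S]
  [DecidableEq A]

lemma sum_none_le (K : ℕ) : ∑ k : Fin K, 1 / √((max (k : ℕ) 1 : ℕ) : ℝ) ≤ 3 * √(K : ℝ) := by
  rw [Fin.sum_univ_eq_sum_range fun k => 1 / √((max k 1 : ℕ) : ℝ)]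
  refine (Finset.sum_le_sum fun k _ => inv_sqrt_max_le k).trans (le_of_eq ?_)
  rw [← Finset.mul_sum, Finset.sum_range_sub fun k : ℕ => √(k : ℝ)]
  simp

lemma visits_snoc {k : ℕ} (past : Fin k → Episode S A M H) (e : Episode S A M H) (h : Fin H)
    (y : Triple S A M) :
    visits (Fin.snoc (α := fun _ => Episode S A M H) past e) (some (h, y)) =
      visits past (some (h, y)) + if e.1 h = y then 1 else 0 := by
  simp only [visits, Finset.card_filter]
  rw [Fin.sum_univ_castSucc]
  simp

lemma firstEpisodes_succ {E : Type*} {K : ℕ} (ω : Fin K → E) (k : ℕ) (hk : k + 1 ≤ K) :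
    firstEpisodes ω (k + 1) hk =
      Fin.snoc (α := fun _ => E) (firstEpisodes ω k (Nat.le_of_succ_le hk)) (ω ⟨k, hk⟩) := by
  funext j
  refine Fin.lastCases ?_ (fun j => ?_) j
  · rw [Fin.snoc_last]
    rfl
  · rw [Fin.snoc_castSucc]
    rfl

/-- The bonuses of the triples that are visited at a given time sum up slowly. -/
lemma sum_inv_sqrt_visits_le {K : ℕ} (ω : Fin K → Episode S A M H) (h : Fin H) :
    ∑ k : Fin K, 1 / √((max (visits (firstEpisodes ω k k.2.le) (some (h, (ω k).1 h))) 1 : ℕ) : ℝ) ≤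
      3 * √(Fintype.card S * (Fintype.card A * (M + 1)) * K) := by
  have h₁ : ∀ (k : ℕ) (hk : k ≤ K), ∑ j : Fin k, 1 / √((max (visits (firstEpisodes ω j
      (j.2.le.trans hk)) (some (h, (ω ⟨j, j.2.trans_le hk⟩).1 h))) 1 : ℕ) : ℝ) ≤
      3 * ∑ y, √(visits (firstEpisodes ω k hk) (some (h, y)) : ℝ) := by
    intro k
    induction k with
    | zero => intro hk; simpa using Finset.sum_nonneg fun y _ => Real.sqrt_nonneg _
    | succ k ih =>
      intro hk
      rw [Fin.sum_univ_castSucc]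
      refine (add_le_add (ih (Nat.le_of_succ_le hk)) (inv_sqrt_max_le _)).trans ?_
      rw [← mul_add]
      refine mul_le_mul_of_nonneg_left ?_ (by norm_num)
      set past := firstEpisodes ω k (Nat.le_of_succ_le hk)
      set e := ω ⟨k, hk⟩ with he
      -- A new episode changes the count of one triple only at time `h`.
      have h₂ : ∀ y, √(visits (firstEpisodes ω (k + 1) hk) (some (h, y)) : ℝ) =
          √(visits past (some (h, y)) : ℝ) + if e.1 h = y then
            √((visits past (some (h, e.1 h)) + 1 : ℕ) : ℝ) - √(visits past (some (h, e.1 h)) : ℝ)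
          else 0 := by
        intro y
        rw [firstEpisodes_succ, visits_snoc]
        by_cases hy : e.1 h = y
        · subst hy
          simp [past, he]
        · rw [if_neg hy, if_neg (by rwa [he] at hy)]
          simp [past]
      simp_rw [h₂]
      rw [Finset.sum_add_distrib, Finset.sum_ite_eq, if_pos (Finset.mem_univ _)]
      exact le_of_eq rfl
  refine (h₁ K le_rfl).trans (mul_le_mul_of_nonneg_left ?_ (by norm_num))
  rw [firstEpisodes_self]
  refine Real.le_sqrt_of_sq_le ?_
  -- Cauchy–Schwarz over the triples, whose visit counts at a fixed time sum to `K`.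
  refine sq_sum_le_card_mul_sum_sq.trans (le_of_eq ?_)
  have h₃ : ∑ y : Triple S A M, visits ω (some (h, y)) = K := by
    simp only [visits, Finset.card_filter]
    rw [Finset.sum_comm]
    simp
  have h₄ : ∑ y : Triple S A M, √(visits ω (some (h, y)) : ℝ) ^ 2 = K := by
    simp_rw [Real.sq_sqrt (Nat.cast_nonneg _)]
    exact_mod_cast h₃
  rw [h₄]
  simp

end Pigeonhole

/-! ### The sum of the planning errors of a run -/

section Errors

/-- Subadditivity of truncation, so that the cap on the planning error can be applied to each
coordinate separately. -/
lemma min_add_le {a x y : ℝ} (ha : 0 ≤ a) (hx : 0 ≤ x) (hy : 0 ≤ y) :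
    min a (x + y) ≤ min a x + min a y := by
  rcases le_total a x with h | h
  · rw [min_eq_left h]
    exact (min_le_left _ _).trans (le_add_of_nonneg_right (le_min ha hy))
  · rcases le_total a y with h' | h'
    · rw [min_eq_left h']
      exact (min_le_left _ _).trans (le_add_of_nonneg_left (le_min ha hx))
    · rw [min_eq_right h, min_eq_right h']
      exact min_le_right _ _

lemma min_sum_le {ι : Type*} (s : Finset ι) {a : ℝ} (ha : 0 ≤ a) {f : ι → ℝ} (hf : ∀ i, 0 ≤ f i) :
    min a (∑ i ∈ s, f i) ≤ ∑ i ∈ s, min a (f i) := by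
  classical
  induction s using Finset.induction_on with
  | empty => simp
  | insert i s hi ih =>
    rw [Finset.sum_insert hi, Finset.sum_insert hi]
    exact (min_add_le ha (hf i) (Finset.sum_nonneg fun i _ => hf i)).trans (add_le_add_right ih _)

variable {S : Type*} {A : Type*} {M H : ℕ} {α : ℝ} {D : Fin H → Triple S A M → ℝ}
  {wd : Coord S A M H → ℝ}

lemma episodeError_nonneg (hD : ∀ h y, 0 ≤ D h y) (hwd : ∀ c, 0 ≤ wd c) (e : Episode S A M H) :
    0 ≤ episodeError α D wd e := by
  have h₂ : 0 ≤ temp α H := by unfold temp; positivity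
  refine Finset.sum_nonneg fun h _ => add_nonneg (hD _ _) (le_min (by positivity) ?_)
  exact mul_nonneg (by positivity)
    (add_nonneg (hwd _) (Finset.sum_nonneg fun _ _ => hwd _))

/-- Each of the `H` steps costs at most `2 * (1 + 2 * H) + 5 * H ≤ 11 * H`. This is the range in the
passage from expected to observed errors. -/
lemma episodeError_le (hH : 1 ≤ H) (hD : ∀ h y, D h y ≤ 2 * (1 + 2 * H)) (e : Episode S A M H) :
    episodeError α D wd e ≤ 11 * H ^ 2 := by
  have hHr : (1 : ℝ) ≤ H := by exact_mod_cast hH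
  have h₁ : ∀ h : Fin H, stepError α D wd h (e.hist h) (e.1 h) ≤ 11 * H := fun h => by
    have e₁ := hD h (e.1 h)
    have e₂ := min_le_left (5 * H : ℝ) (40 * H * temp α H * (wd none +
      ∑ t : Fin h, wd (some (⟨t, t.2.trans h.2⟩, e.hist h t))))
    unfold stepError
    linarith
  refine (Finset.sum_le_sum fun h _ => h₁ h).trans (le_of_eq ?_)
  simp
  ring

/-- The planning error of an episode in terms of the weights of the visited coordinates. -/
lemma episodeError_le_mul {g : Coord S A M H → ℝ} (hg : ∀ c, 0 ≤ g c) {u v : ℝ}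
    (hu : 0 ≤ u) (hv : 0 ≤ v) (hD : ∀ h y, D h y ≤ u * g (some (h, y))) (hwd0 : ∀ c, 0 ≤ wd c)
    (hwd : ∀ c, min (5 * (H : ℝ)) (40 * H * (temp α H * wd c)) ≤ v * g c) (e : Episode S A M H) :
    episodeError α D wd e ≤ (u + H * v) * (g none + ∑ h, g (some (h, e.1 h))) := by
  have hη : 0 ≤ temp α H := by unfold temp; positivity
  have hx : ∀ c, 0 ≤ 40 * H * (temp α H * wd c) := fun c =>
    mul_nonneg (by positivity) (mul_nonneg hη (hwd0 c))
  have hG : 0 ≤ ∑ h, g (some (h, e.1 h)) := Finset.sum_nonneg fun _ _ => hg _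
  have h₁ : ∀ h : Fin H, stepError α D wd h (e.hist h) (e.1 h) ≤ u * g (some (h, e.1 h)) +
      v * (g none + ∑ h, g (some (h, e.1 h))) := by
    intro h
    refine add_le_add (hD h (e.1 h)) ?_
    have e₁ : 40 * H * temp α H * (wd none + ∑ t : Fin h, wd (some (⟨t, t.2.trans h.2⟩,
        e.hist h t))) = 40 * H * (temp α H * wd none) + ∑ t : Fin h,
        40 * H * (temp α H * wd (some (⟨t, t.2.trans h.2⟩, e.hist h t))) := by
      rw [mul_add, Finset.mul_sum]
      simp only [mul_assoc]
    rw [e₁]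
    refine (min_add_le (by positivity) (hx _) (Finset.sum_nonneg fun t _ => hx _)).trans ?_
    rw [mul_add]
    refine add_le_add (hwd none) ((min_sum_le _ (by positivity) fun t => hx _).trans ?_)
    refine (Finset.sum_le_sum fun t _ => hwd _).trans ?_
    rw [← Finset.mul_sum]
    refine mul_le_mul_of_nonneg_left ?_ hv
    -- The times of a history embed into all times of the episode. Bounding each partial sum by the
    -- full one costs the factor `H`.
    change ∑ t : Fin h, g (some (Fin.castLE h.2.le t, e.1 (Fin.castLE h.2.le t))) ≤ _
    rw [← Finset.sum_image (s := Finset.univ) (g := Fin.castLE h.2.le)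
      (f := fun t => g (some (t, e.1 t))) fun _ _ _ _ h => Fin.castLE_injective _ h]
    exact Finset.sum_le_sum_of_subset_of_nonneg (Finset.subset_univ _) fun _ _ _ => hg _
  refine (Finset.sum_le_sum fun h _ => h₁ h).trans ?_
  rw [Finset.sum_add_distrib, ← Finset.mul_sum, Finset.sum_const, Finset.card_univ, Fintype.card_fin,
    nsmul_eq_mul, add_mul, mul_assoc]
  exact add_le_add_left (mul_le_mul_of_nonneg_left (le_add_of_nonneg_left (hg none)) hu) _

lemma gamma_mono {nS nA M H k k' : ℕ} {L lam δ : ℝ} (hL : 0 ≤ L) (hlam : 0 < lam) (hδ : 0 < δ)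
    (hδ1 : δ ≤ 1) (hk : k ≤ k') :
    gamma nS nA M H L lam δ k ≤ gamma nS nA M H L lam δ k' := by
  have hβ : beta nS nA M H L lam δ k ≤ beta nS nA M H L lam δ k' := by
    unfold beta
    gcongr
  have := beta_nonneg (nS := nS) (nA := nA) (M := M) (H := H) (k := k) hL hlam hδ hδ1
  unfold gamma
  gcongr

lemma bonus_nonneg (nS nA M H K : ℕ) (δ : ℝ) (n : ℕ) : 0 ≤ bonus nS nA M H K δ n :=
  add_nonneg (le_min (Real.sqrt_nonneg _) zero_le_one) (le_min (by positivity) (by positivity))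

lemma bonus_le (nS nA M H K : ℕ) (δ : ℝ) (n : ℕ) : bonus nS nA M H K δ n ≤ 1 + 2 * H :=
  add_le_add (min_le_right _ _) (min_le_right _ _)

lemma bonus_le_mul (nS nA M H K : ℕ) (δ : ℝ) (n : ℕ) : bonus nS nA M H K δ n ≤
    (√(Real.log (8 * nS * nA * M * H * K / δ)) +
      H * √(4 * nS * Real.log (8 * nS * nA * M * H * K / δ))) * (1 / √((max n 1 : ℕ) : ℝ)) := by
  refine (add_le_add (min_le_left _ _) (min_le_left _ _)).trans (le_of_eq ?_)
  rw [Real.sqrt_div' _ (Nat.cast_nonneg _), Real.sqrt_div' _ (Nat.cast_nonneg _)]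
  ring

variable [Fintype S] [Fintype A] [DecidableEq S] [DecidableEq A]

/-- The temperature cancels the square root of the effective horizon in the bonus. The cap `5 * H`
takes care of unvisited coordinates, so for the others the regularizing term of the denominator can
be dropped. -/
lemma Model.temp_mul_featBonus_le (m : Model S A M H) (hM : 1 ≤ M) (hH : 1 ≤ H) {L lam δ G : ℝ}
    (hlam : 0 < lam) {k : ℕ} (hG0 : 0 ≤ G)
    (hG : gamma (Fintype.card S) (Fintype.card A) M H L lam (δ / 4) k ≤ G) (n : ℕ) :
    min (5 * (H : ℝ)) (40 * H * (temp m.α H * m.featBonus L lam δ k n)) ≤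
      (5 * H + 80 * H * (G * √m.kappa)) * (1 / √((max n 1 : ℕ) : ℝ)) := by
  have hκ := m.kappa_pos hM hH
  have hE := one_le_effHorizon m.α_nonneg hH
  rcases Nat.eq_zero_or_pos n with rfl | hn
  · refine (min_le_left _ _).trans ?_
    simp only [zero_le, sup_of_le_right, Nat.cast_one, Real.sqrt_one, div_one, mul_one]
    exact le_add_of_nonneg_right (by positivity)
  · refine (min_le_right _ _).trans ?_
    rw [max_eq_left hn]
    have hn0 : (0 : ℝ) < n := Nat.cast_pos.2 hn
    have h₁ : temp m.α H * m.featBonus L lam δ k n =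
        2 * gamma (Fintype.card S) (Fintype.card A) M H L lam (δ / 4) k * √m.kappa *
          (1 / √(n + 4 * lam * effHorizon m.α H)) := by
      rw [Model.featBonus, Real.sqrt_mul hκ.le]
      calc _ = 2 * gamma (Fintype.card S) (Fintype.card A) M H L lam (δ / 4) k * √m.kappa *
            (1 / √(n + 4 * lam * effHorizon m.α H)) *
            (temp m.α H * √(effHorizon m.α H)) := by ring
        _ = _ := by rw [temp_mul_sqrt_effHorizon m.α_nonneg hH, mul_one]
    have h₂ : 1 / √(n + 4 * lam * effHorizon m.α H) ≤ 1 / √(n : ℝ) := by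
      refine one_div_le_one_div_of_le (Real.sqrt_pos.2 hn0) (Real.sqrt_le_sqrt ?_)
      exact le_add_of_nonneg_right (by positivity)
    have h₃ : temp m.α H * m.featBonus L lam δ k n ≤ 2 * G * √m.kappa * (1 / √(n : ℝ)) := by
      rw [h₁]
      gcongr
    calc _ ≤ 40 * H * (2 * G * √m.kappa * (1 / √(n : ℝ))) := by gcongr
      _ = 80 * H * (G * √m.kappa) * (1 / √(n : ℝ)) := by ring
      _ ≤ _ := mul_le_mul_of_nonneg_right (le_add_of_nonneg_left (by positivity)) (by positivity)

/-- The planning error of an episode, with the bonuses that follow the past episodes. -/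
noncomputable def Model.planError (m : Model S A M H) (K : ℕ) (L lam δ : ℝ) (k : ℕ)
    (past : Fin k → Episode S A M H) : Episode S A M H → ℝ :=
  episodeError m.α
    (fun h y => 2 * bonus (Fintype.card S) (Fintype.card A) M H K δ (visits past (some (h, y))))
    (fun c => m.featBonus L lam δ (k + 1) (visits past c))

/-- The planning errors of a run sum up slowly. -/
lemma Model.sum_planError_le (m : Model S A M H) (hM : 1 ≤ M) (hH : 1 ≤ H) {L lam δ : ℝ}
    (hL : 0 ≤ L) (hlam : 0 < lam) (hδ : 0 < δ) (hδ1 : δ < 1) {K : ℕ}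
    (ω : Fin K → Episode S A M H) :
    ∑ k : Fin K, m.planError K L lam δ k (firstEpisodes ω k k.2.le) (ω k) ≤
      (2 * (√(Real.log (8 * Fintype.card S * Fintype.card A * M * H * K / δ)) + H *
          √(4 * Fintype.card S * Real.log (8 * Fintype.card S * Fintype.card A * M * H * K / δ))) +
        H * (5 * H + 80 * H * (gamma (Fintype.card S) (Fintype.card A) M H L lam (δ / 4) K *
          √m.kappa))) *
      (3 * √(K : ℝ) + H * (3 * √(Fintype.card S * (Fintype.card A * (M + 1)) * K))) := by
  set u := 2 * (√(Real.log (8 * Fintype.card S * Fintype.card A * M * H * K / δ)) + H *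
    √(4 * Fintype.card S * Real.log (8 * Fintype.card S * Fintype.card A * M * H * K / δ))) with hu
  set G := gamma (Fintype.card S) (Fintype.card A) M H L lam (δ / 4) K with hG
  have hG0 : 0 ≤ G := gamma_nonneg hL hlam (by linarith) (by linarith)
  set v := 5 * H + 80 * H * (G * √m.kappa) with hv
  have hu0 : 0 ≤ u := by positivity
  have hv0 : 0 ≤ v := by positivity
  have h₁ : ∀ k : Fin K, m.planError K L lam δ k (firstEpisodes ω k k.2.le) (ω k) ≤
      (u + H * v) * (1 / √((max (k : ℕ) 1 : ℕ) : ℝ) + ∑ h : Fin H,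
        1 / √((max (visits (firstEpisodes ω k k.2.le) (some (h, (ω k).1 h))) 1 : ℕ) : ℝ)) := by
    intro k
    refine episodeError_le_mul
      (g := fun c => 1 / √((max (visits (firstEpisodes ω k k.2.le) c) 1 : ℕ) : ℝ))
      (fun c => by positivity) hu0 hv0 (fun h y => ?_)
      (fun c => m.featBonus_nonneg hL hlam hδ hδ1 _ _) (fun c => ?_) (ω k)
    · rw [hu, mul_assoc]
      exact mul_le_mul_of_nonneg_left (bonus_le_mul _ _ _ _ _ _ _) zero_le_two
    -- The radius increases with the episode number, which is at most `K`.
    · exact m.temp_mul_featBonus_le hM hH hlam hG0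
        (gamma_mono hL hlam (by linarith) (by linarith) k.2) _
  refine (Finset.sum_le_sum fun k _ => h₁ k).trans ?_
  rw [← Finset.mul_sum]
  refine mul_le_mul_of_nonneg_left ?_ (by positivity)
  rw [Finset.sum_add_distrib, Finset.sum_comm]
  refine add_le_add (sum_none_le K) ((Finset.sum_le_sum fun h _ =>
    sum_inv_sqrt_visits_le ω h).trans (le_of_eq ?_))
  simp

end Errors

/-! ### The order of the regret bound -/

section Order

/-- The ranges of the parameters; `q` is the fourth root of `M`. -/
structure ParamBounds (c₀ c₁ c₂ : ℝ) (nS nA M H K : ℕ) (q L lam δ : ℝ) : Prop where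
  one_le_nS : 1 ≤ nS
  one_le_nA : 1 ≤ nA
  one_le_M : 1 ≤ M
  one_le_H : 1 ≤ H
  one_le_K : 1 ≤ K
  one_le_q : 1 ≤ q
  q_pow : (M : ℝ) = q ^ 4
  le_L : c₀ ≤ L
  le_lam : c₁ * (H * q ^ 10 * nS * nA / L) ≤ lam
  lam_le : lam ≤ c₂ * (H * q ^ 10 * nS * nA / L)
  δ_pos : 0 < δ
  δ_lt_one : δ < 1

/-- The logarithmic factor of the regret bound. -/
noncomputable def logTerm (nS nA M H K : ℕ) (L δ : ℝ) : ℝ :=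
  Real.log (3 + nS * nA * M * H * K * L / δ)

lemma one_le_log_three_add {X : ℝ} (hX : 0 ≤ X) : 1 ≤ Real.log (3 + X) := by
  rw [Real.le_log_iff_exp_le (by linarith)]
  linarith [Real.exp_one_lt_three]

/-- A constant inside the logarithm becomes a constant factor, because the logarithmic term is at
least one. -/
lemma log_le_mul_log_three_add {a X y : ℝ} (ha : 1 ≤ a) (hX : 0 ≤ X) (hy0 : 0 < y)
    (hy : y ≤ a * (3 + X)) : Real.log y ≤ (1 + Real.log a) * Real.log (3 + X) := by
  have h₁ := one_le_log_three_add hX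
  have h₂ := Real.log_nonneg ha
  have h₃ : Real.log y ≤ Real.log a + Real.log (3 + X) := by
    rw [← Real.log_mul (by linarith) (by linarith)]
    exact Real.log_le_log hy0 hy
  nlinarith

variable {c₀ c₁ c₂ : ℝ} {nS nA M H K : ℕ} {q L lam δ : ℝ}

lemma ParamBounds.one_le_logTerm (h : ParamBounds c₀ c₁ c₂ nS nA M H K q L lam δ) (hc₀ : 0 < c₀) :
    1 ≤ logTerm nS nA M H K L δ := by
  have hL : 0 < L := hc₀.trans_le h.le_L
  have := h.δ_pos
  exact one_le_log_three_add (by positivity)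

lemma ParamBounds.lam_pos (h : ParamBounds c₀ c₁ c₂ nS nA M H K q L lam δ) (hc₀ : 0 < c₀)
    (hc₁ : 0 < c₁) : 0 < lam := by
  have hL : 0 < L := hc₀.trans_le h.le_L
  have hS : (0 : ℝ) < nS := by exact_mod_cast h.one_le_nS
  have hA : (0 : ℝ) < nA := by exact_mod_cast h.one_le_nA
  have hH : (0 : ℝ) < H := by exact_mod_cast h.one_le_H
  have hq := zero_lt_one.trans_le h.one_le_q
  exact lt_of_lt_of_le (by positivity) h.le_lam

/-- The logarithms in the algorithm are of the order of the logarithmic factor. -/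
lemma ParamBounds.logs_le (h : ParamBounds c₀ c₁ c₂ nS nA M H K q L lam δ) (hc₀ : 0 < c₀)
    (hc₁ : 0 < c₁) :
    Real.log (8 * nS * nA * M * H * K / δ) ≤
        (1 + Real.log (1 + 8 / c₀ + 1 / c₁)) * logTerm nS nA M H K L δ ∧
      Real.log (8 / δ) ≤ (1 + Real.log (1 + 8 / c₀ + 1 / c₁)) * logTerm nS nA M H K L δ ∧
      Real.log (1 + K / ((M + 1) * nS * nA * lam)) ≤
        (1 + Real.log (1 + 8 / c₀ + 1 / c₁)) * logTerm nS nA M H K L δ := by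
  have hL : 0 < L := hc₀.trans_le h.le_L
  have hδ := h.δ_pos
  have hlam := h.lam_pos hc₀ hc₁
  have hS : (1 : ℝ) ≤ nS := by exact_mod_cast h.one_le_nS
  have hA : (1 : ℝ) ≤ nA := by exact_mod_cast h.one_le_nA
  have hM : (1 : ℝ) ≤ M := by exact_mod_cast h.one_le_M
  have hH : (1 : ℝ) ≤ H := by exact_mod_cast h.one_le_H
  have hK : (1 : ℝ) ≤ K := by exact_mod_cast h.one_le_K
  set N : ℝ := nS * nA * M * H * K with hN
  have hNK : K ≤ N := by
    have e₁ : 1 ≤ (nS : ℝ) * nA := one_le_mul_of_one_le_of_one_le hS hA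
    have e₂ := one_le_mul_of_one_le_of_one_le e₁ hM
    have e₃ := one_le_mul_of_one_le_of_one_le e₂ hH
    exact le_mul_of_one_le_left (by linarith) e₃
  have hN1 : 1 ≤ N := hK.trans hNK
  set X : ℝ := N * L / δ with hX
  have hX0 : 0 ≤ X := by positivity
  have ha0 : 0 ≤ 8 / c₀ := by positivity
  have ha1 : 0 ≤ 1 / c₁ := by positivity
  have ha : 1 ≤ 1 + 8 / c₀ + 1 / c₁ := by linarith
  -- The target logarithm contains `L` while this one does not; `c₀ ≤ L` bridges the difference.
  have h8 : 8 * N / δ ≤ 8 / c₀ * X := by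
    have : 8 / c₀ * X = 8 * N / δ * (L / c₀) := by rw [hX]; ring
    rw [this]
    exact le_mul_of_one_le_right (by positivity) ((one_le_div hc₀).2 h.le_L)
  have h8' : 8 * N / δ ≤ (1 + 8 / c₀ + 1 / c₁) * (3 + X) := by nlinarith
  have hKX : K * L ≤ X := by
    rw [hX, le_div_iff₀ hδ]
    have := mul_le_mul_of_nonneg_right hNK hL.le
    nlinarith [h.δ_lt_one, mul_pos (by linarith : (0 : ℝ) < K) hL]
  have hden : c₁ / L ≤ (M + 1) * nS * nA * lam := by
    have e₁ : c₁ / L ≤ lam := by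
      refine le_trans ?_ h.le_lam
      rw [div_eq_mul_inv, div_eq_mul_inv]
      refine mul_le_mul_of_nonneg_left (le_mul_of_one_le_left (by positivity) ?_) hc₁.le
      have e₂ := one_le_mul_of_one_le_of_one_le hH (one_le_pow₀ h.one_le_q (n := 10))
      exact one_le_mul_of_one_le_of_one_le (one_le_mul_of_one_le_of_one_le e₂ hS) hA
    have e₃ : 1 ≤ (M + 1 : ℝ) * nS * nA := one_le_mul_of_one_le_of_one_le
      (one_le_mul_of_one_le_of_one_le (by linarith) hS) hA
    exact e₁.trans (le_mul_of_one_le_left hlam.le e₃)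
  have h₁ : (K : ℝ) / ((M + 1) * nS * nA * lam) ≤ 1 / c₁ * X := by
    calc (K : ℝ) / ((M + 1) * nS * nA * lam) ≤ K / (c₁ / L) :=
          div_le_div_of_nonneg_left (by linarith) (by positivity) hden
      _ = 1 / c₁ * (K * L) := by field_simp
      _ ≤ _ := mul_le_mul_of_nonneg_left hKX ha1
  have hNr : 8 * nS * nA * M * H * K / δ = 8 * N / δ := by rw [hN]; ring
  refine ⟨log_le_mul_log_three_add ha hX0 (by positivity) (hNr.trans_le h8'),
    log_le_mul_log_three_add ha hX0 (by positivity) (le_trans ?_ h8'),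
    log_le_mul_log_three_add ha hX0 (by positivity) (by nlinarith)⟩
  gcongr
  linarith

-- With `w ^ 2 = H * nS * nA`, the regularization has `√lam` of order `q ^ 5 * w / √L`. This
-- balances the first summand, of order `q ^ 10 * w ^ 2 / √lam` up to logarithms, against the last
-- one, `√lam * L`; both have order `q ^ 5 * w * √L`.
set_option maxHeartbeats 400000 in
lemma exists_beta_le (hc₀ : 0 < c₀) (hc₁ : 0 < c₁) :
    ∃ C, 0 ≤ C ∧ ∀ {nS nA M H K : ℕ} {q L lam δ : ℝ},
      ParamBounds c₀ c₁ c₂ nS nA M H K q L lam δ →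
      beta nS nA M H L lam (δ / 4) K ≤
        C * (q ^ 5 * (√(H : ℝ) * √(nS * nA : ℝ)) * √L * logTerm nS nA M H K L δ) := by
  set a := 1 + 8 / c₀ + 1 / c₁ with ha
  have ha1 : 1 ≤ a := by
    have h₁ : 0 ≤ 8 / c₀ := by positivity
    have h₂ : 0 ≤ 1 / c₁ := by positivity
    linarith
  have hla := Real.log_nonneg ha1
  refine ⟨6 * (1 + Real.log a) / √c₁ + √c₂ / c₀ + √c₂, by positivity, ?_⟩
  intro nS nA M H K q L lam δ h
  have hL : 0 < L := hc₀.trans_le h.le_L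
  have hδ := h.δ_pos
  have hlam := h.lam_pos hc₀ hc₁
  have hS : (1 : ℝ) ≤ nS := by exact_mod_cast h.one_le_nS
  have hA : (1 : ℝ) ≤ nA := by exact_mod_cast h.one_le_nA
  have hM : (1 : ℝ) ≤ M := by exact_mod_cast h.one_le_M
  have hH : (1 : ℝ) ≤ H := by exact_mod_cast h.one_le_H
  have hq := h.one_le_q
  have hq0 : 0 < q := by linarith
  have hell := h.one_le_logTerm hc₀
  obtain ⟨-, hl₁, hl₂⟩ := h.logs_le hc₀ hc₁
  rw [← ha] at hl₁ hl₂
  set ell := logTerm nS nA M H K L δ with hell_def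
  set w := √(H : ℝ) * √(nS * nA : ℝ) with hw
  have hw2 : w ^ 2 = H * (nS * nA) := by
    rw [hw, mul_pow, Real.sq_sqrt (by positivity), Real.sq_sqrt (by positivity)]
  have hw0 : 0 < w := by positivity
  set l := √L with hl
  have hl0 : 0 < l := Real.sqrt_pos.2 hL
  have hlsq : l ^ 2 = L := Real.sq_sqrt hL.le
  have hscale : (q ^ 5 * w / l) ^ 2 = H * q ^ 10 * nS * nA / L := by
    rw [div_pow, mul_pow, hw2, hlsq]
    ring
  have hlow : √c₁ * (q ^ 5 * w / l) ≤ √lam := by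
    refine Real.le_sqrt_of_sq_le ?_
    rw [mul_pow, hscale, Real.sq_sqrt hc₁.le]
    exact h.le_lam
  have hup : √lam ≤ √c₂ * (q ^ 5 * w / l) := by
    rw [← Real.sqrt_sq (by positivity : 0 ≤ q ^ 5 * w / l), ← Real.sqrt_mul' _ (sq_nonneg _), hscale]
    exact Real.sqrt_le_sqrt h.lam_le
  set s := √lam with hs
  have hs0 : 0 < s := Real.sqrt_pos.2 hlam
  have hM32 : (M : ℝ) ^ (3 / 2 : ℝ) = q ^ 6 := by
    rw [h.q_pow, ← Real.rpow_natCast q 4, ← Real.rpow_mul hq0.le, ← Real.rpow_natCast q 6]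
    norm_num
  have hsc₁ : 0 < √c₁ := Real.sqrt_pos.2 hc₁
  have t₁ : (M : ℝ) ^ (3 / 2 : ℝ) * (M + 1) * nS * nA * H / s *
      (Real.log (1 + K / ((M + 1) * nS * nA * lam)) + 2 * Real.log (2 / (δ / 4))) ≤
      6 * (1 + Real.log a) / √c₁ * (q ^ 5 * w * l * ell) := by
    have e₁ : 2 / (δ / 4) = 8 / δ := by field_simp; norm_num
    rw [e₁, hM32, h.q_pow]
    have hM1 : q ^ 4 + 1 ≤ 2 * q ^ 4 := by linarith [one_le_pow₀ hq (n := 4)]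
    rw [h.q_pow] at hl₂
    have e₂ : Real.log (1 + K / ((q ^ 4 + 1) * nS * nA * lam)) + 2 * Real.log (8 / δ) ≤
        3 * (1 + Real.log a) * ell := by linarith
    have e₃ : q ^ 6 * (q ^ 4 + 1) * nS * nA * H / s ≤ 2 * q ^ 5 * w * l / √c₁ := by
      rw [div_le_div_iff₀ hs0 hsc₁]
      have e₄ : q ^ 6 * (q ^ 4 + 1) * nS * nA * H ≤ 2 * q ^ 10 * w ^ 2 := by
        rw [hw2]
        have : 0 ≤ q ^ 6 * ((H : ℝ) * (nS * nA)) := by positivity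
        nlinarith
      calc q ^ 6 * (q ^ 4 + 1) * nS * nA * H * √c₁ ≤ 2 * q ^ 10 * w ^ 2 * √c₁ :=
            mul_le_mul_of_nonneg_right e₄ hsc₁.le
        _ = 2 * q ^ 5 * w * l * (√c₁ * (q ^ 5 * w / l)) := by field_simp
        _ ≤ _ := mul_le_mul_of_nonneg_left hlow (by positivity)
    calc _ ≤ q ^ 6 * (q ^ 4 + 1) * nS * nA * H / s * (3 * (1 + Real.log a) * ell) :=
          mul_le_mul_of_nonneg_left e₂ (by positivity)
      _ ≤ 2 * q ^ 5 * w * l / √c₁ * (3 * (1 + Real.log a) * ell) :=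
          mul_le_mul_of_nonneg_right e₃ (by positivity)
      _ = _ := by ring
  have hwl : q ^ 5 * w * l ≤ q ^ 5 * w * l * ell := le_mul_of_one_le_right (by positivity) hell
  have t₃ : s * L ≤ √c₂ * (q ^ 5 * w * l * ell) := by
    calc s * L ≤ √c₂ * (q ^ 5 * w / l) * L := mul_le_mul_of_nonneg_right hup hL.le
      _ = √c₂ * (q ^ 5 * w * l) := by rw [← hlsq]; field_simp
      _ ≤ _ := mul_le_mul_of_nonneg_left hwl (Real.sqrt_nonneg _)
  have t₂ : √(lam / (4 * M)) ≤ √c₂ / c₀ * (q ^ 5 * w * l * ell) := by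
    have e₁ : √(lam / (4 * M)) ≤ s := Real.sqrt_le_sqrt
      (div_le_self hlam.le (by linarith))
    have e₂ := mul_le_mul_of_nonneg_left h.le_L hs0.le
    rw [div_mul_eq_mul_div, le_div_iff₀ hc₀]
    have e₃ := mul_le_mul_of_nonneg_right e₁ hc₀.le
    linarith
  unfold beta
  rw [← hs]
  linarith

-- The quadratic term sets the order: its coefficient is of order `L / (q ^ 3 * σ)` with `σ = √(nS *
-- nA)`, and `β ^ 2` is at most of order `q ^ 10 * H * σ ^ 2 * L` up to logarithms. The linear term
-- is absorbed by means of `c₀ ≤ L`.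
set_option maxHeartbeats 400000 in
lemma exists_gamma_le (hc₀ : 0 < c₀) (hc₁ : 0 < c₁) :
    ∃ C, 0 ≤ C ∧ ∀ {nS nA M H K : ℕ} {q L lam δ : ℝ},
      ParamBounds c₀ c₁ c₂ nS nA M H K q L lam δ →
      gamma nS nA M H L lam (δ / 4) K ≤
        C * (H * q ^ 7 * √(nS * nA : ℝ) * L ^ 2 * logTerm nS nA M H K L δ ^ 2) := by
  obtain ⟨Cβ, hCβ, hβ⟩ := exists_beta_le (c₂ := c₂) hc₀ hc₁
  set c₃ := 1 + 1 / c₀ with hc₃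
  have hc₃0 : 0 < c₃ := by positivity
  refine ⟨4 * c₃ * Cβ / √c₀ + √(2 * c₃ / c₁) * Cβ ^ 2, by positivity, ?_⟩
  intro nS nA M H K q L lam δ h
  have hL : 0 < L := hc₀.trans_le h.le_L
  have hδ := h.δ_pos
  have hlam := h.lam_pos hc₀ hc₁
  have hS : (1 : ℝ) ≤ nS := by exact_mod_cast h.one_le_nS
  have hA : (1 : ℝ) ≤ nA := by exact_mod_cast h.one_le_nA
  have hH : (1 : ℝ) ≤ H := by exact_mod_cast h.one_le_H
  have hq := h.one_le_q
  have hq0 : 0 < q := by linarith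
  have hell := h.one_le_logTerm hc₀
  have hb := hβ h
  have hb0 := beta_nonneg (nS := nS) (nA := nA) (M := M) (H := H) (k := K) (δ := δ / 4) hL.le hlam
    (by linarith) (by linarith [h.δ_lt_one])
  set β := beta nS nA M H L lam (δ / 4) K with hβdef
  set ell := logTerm nS nA M H K L δ with hell_def
  set σ := √(nS * nA : ℝ) with hσ
  have hσ2 : σ ^ 2 = nS * nA := Real.sq_sqrt (by positivity)
  have hσ0 : 0 < σ := by positivity
  set hh := √(H : ℝ) with hhh
  have hh2 : hh ^ 2 = H := Real.sq_sqrt (by linarith)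
  have hh1 : 1 ≤ hh := Real.one_le_sqrt.2 hH
  set l := √L with hl
  have hl0 : 0 < l := Real.sqrt_pos.2 hL
  have hlsq : l ^ 2 = L := Real.sq_sqrt hL.le
  have hl1 : √c₀ ≤ l := Real.sqrt_le_sqrt h.le_L
  have hsc₀ : 0 < √c₀ := Real.sqrt_pos.2 hc₀
  have h1L : 1 + L ≤ c₃ * L := by
    have : 1 ≤ 1 / c₀ * L := by
      rw [one_div, ← div_eq_inv_mul]
      exact (one_le_div hc₀).2 h.le_L
    rw [hc₃]
    linarith
  have f₁ : 2 + 2 * L + √(2 * (1 + L)) ≤ 4 * c₃ * L := by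
    have : √(2 * (1 + L)) ≤ 2 * (1 + L) := Real.sqrt_le_iff.2 ⟨by linarith, le_self_pow₀ (by linarith) two_ne_zero⟩
    linarith
  have f₂ : √(2 * (1 + L) * H * M / lam) ≤ √(2 * c₃ / c₁) * (L / (q ^ 3 * σ)) := by
    rw [← Real.sqrt_sq (by positivity : 0 ≤ L / (q ^ 3 * σ)), ← Real.sqrt_mul' _ (sq_nonneg _)]
    refine Real.sqrt_le_sqrt ?_
    rw [h.q_pow]
    have e₁ : 2 * (1 + L) * H * q ^ 4 ≤ 2 * (c₃ * L) * H * q ^ 4 := by gcongr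
    calc 2 * (1 + L) * H * q ^ 4 / lam ≤
        2 * (c₃ * L) * H * q ^ 4 / (c₁ * (H * q ^ 10 * nS * nA / L)) :=
          div_le_div₀ (by positivity) e₁ (by positivity) h.le_lam
      _ = 2 * (c₃ * L) * H * q ^ 4 / (c₁ * (H * q ^ 10 * σ ^ 2 / L)) := by rw [hσ2]; ring_nf
      _ = _ := by field_simp
  have hb2 : β ^ 2 ≤ (Cβ * (q ^ 5 * (hh * σ) * l * ell)) ^ 2 := pow_le_pow_left₀ hb0 hb 2
  have g₁ : (2 + 2 * L + √(2 * (1 + L))) * β ≤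
      4 * c₃ * Cβ / √c₀ * (H * q ^ 7 * σ * L ^ 2 * ell ^ 2) := by
    have e₁ : q ^ 5 * (hh * σ) * l * ell * L * √c₀ ≤ H * q ^ 7 * σ * L ^ 2 * ell ^ 2 := by
      have a₁ : q ^ 5 ≤ q ^ 7 := pow_le_pow_right₀ hq (by norm_num)
      have a₂ : hh ≤ H := (le_self_pow₀ hh1 two_ne_zero).trans_eq hh2
      have a₃ : ell ≤ ell ^ 2 := le_self_pow₀ hell two_ne_zero
      have a₄ : l * √c₀ ≤ L := by
        rw [← hlsq, sq]
        exact mul_le_mul_of_nonneg_left hl1 hl0.le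
      calc q ^ 5 * (hh * σ) * l * ell * L * √c₀ = hh * q ^ 5 * σ * (L * (l * √c₀)) * ell := by ring
        _ ≤ H * q ^ 7 * σ * (L * L) * ell ^ 2 := by gcongr
        _ = _ := by ring
    calc _ ≤ 4 * c₃ * L * (Cβ * (q ^ 5 * (hh * σ) * l * ell)) :=
          mul_le_mul f₁ hb hb0 (by positivity)
      _ = 4 * c₃ * Cβ / √c₀ * (q ^ 5 * (hh * σ) * l * ell * L * √c₀) := by field_simp
      _ ≤ _ := mul_le_mul_of_nonneg_left e₁ (by positivity)
  have g₂ : √(2 * (1 + L) * H * M / lam) * β ^ 2 ≤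
      √(2 * c₃ / c₁) * Cβ ^ 2 * (H * q ^ 7 * σ * L ^ 2 * ell ^ 2) := by
    calc _ ≤ √(2 * c₃ / c₁) * (L / (q ^ 3 * σ)) * (Cβ * (q ^ 5 * (hh * σ) * l * ell)) ^ 2 :=
          mul_le_mul f₂ hb2 (sq_nonneg _) (by positivity)
      _ = √(2 * c₃ / c₁) * Cβ ^ 2 * (L * (q ^ 5 * (hh * σ) * l * ell) ^ 2 / (q ^ 3 * σ)) := by
          ring
      _ = √(2 * c₃ / c₁) * Cβ ^ 2 * (hh ^ 2 * q ^ 7 * σ * (L * l ^ 2) * ell ^ 2) := by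
          congr 1
          rw [div_eq_iff (by positivity)]
          ring
      _ = _ := by rw [hh2, hlsq]; ring
  unfold gamma
  rw [← hβdef]
  linarith

set_option maxHeartbeats 400000 in
/-- The bound on the regret that follows from the sum of the planning errors has the stated
order. -/
lemma exists_regret_bound_le (hc₀ : 0 < c₀) (hc₁ : 0 < c₁) :
    ∃ C, 0 < C ∧ ∀ {nS nA M H K : ℕ} {q L lam δ κ : ℝ},
      ParamBounds c₀ c₁ c₂ nS nA M H K q L lam δ → 1 ≤ κ →
      1 ≤ Real.log (8 * nS * nA * M * H * K / δ) →
      2 * ((2 * (√(Real.log (8 * nS * nA * M * H * K / δ)) + H *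
          √(4 * nS * Real.log (8 * nS * nA * M * H * K / δ))) +
        H * (5 * H + 80 * H * (gamma nS nA M H L lam (δ / 4) K * √κ))) *
        (3 * √(K : ℝ) + H * (3 * √(nS * (nA * (M + 1)) * K))) +
        11 * H ^ 2 * Real.log (4 / δ)) ≤
      C * √((H : ℝ) ^ 8 * (M : ℝ) ^ (13 / 2 : ℝ) * (nS : ℝ) ^ 2 * (nA : ℝ) ^ 2 * L ^ 4 * κ * K) *
        logTerm nS nA M H K L δ ^ 2 := by
  obtain ⟨Cγ, hCγ, hγ⟩ := exists_gamma_le (c₂ := c₂) hc₀ hc₁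
  set a := 1 + 8 / c₀ + 1 / c₁ with ha
  have ha1 : 1 ≤ a := by
    have h₁ : 0 ≤ 8 / c₀ := by positivity
    have h₂ : 0 ≤ 1 / c₁ := by positivity
    linarith
  have hla := Real.log_nonneg ha1
  set b := 1 + Real.log a with hb
  have hb0 : 0 < b := by linarith
  refine ⟨2 * ((6 * b / c₀ ^ 2 + 5 / c₀ ^ 2 + 80 * Cγ) * 9 + 11 * b / c₀ ^ 2), by positivity, ?_⟩
  intro nS nA M H K q L lam δ κ h hκ hι
  have hL : 0 < L := hc₀.trans_le h.le_L
  have hδ := h.δ_pos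
  have hS : (1 : ℝ) ≤ nS := by exact_mod_cast h.one_le_nS
  have hA : (1 : ℝ) ≤ nA := by exact_mod_cast h.one_le_nA
  have hH : (1 : ℝ) ≤ H := by exact_mod_cast h.one_le_H
  have hK : (1 : ℝ) ≤ K := by exact_mod_cast h.one_le_K
  have hq := h.one_le_q
  have hq0 : 0 < q := by linarith
  have hell := h.one_le_logTerm hc₀
  obtain ⟨hl₁, hl₂, -⟩ := h.logs_le hc₀ hc₁
  rw [← ha, ← hb] at hl₁ hl₂
  have hg := hγ h
  set g := gamma nS nA M H L lam (δ / 4) K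
  set ι := Real.log (8 * nS * nA * M * H * K / δ)
  set ell := logTerm nS nA M H K L δ
  set σ := √(nS * nA : ℝ) with hσ
  have hσ2 : σ ^ 2 = nS * nA := Real.sq_sqrt (by positivity)
  have hSA : (1 : ℝ) ≤ nS * nA := one_le_mul_of_one_le_of_one_le hS hA
  have hσ1 : 1 ≤ σ := Real.one_le_sqrt.2 hSA
  set sk := √κ with hsk
  have hsk1 : 1 ≤ sk := Real.one_le_sqrt.2 hκ
  set sK := √(K : ℝ) with hsK
  have hsK1 : 1 ≤ sK := Real.one_le_sqrt.2 hK
  have hT : √((H : ℝ) ^ 8 * (M : ℝ) ^ (13 / 2 : ℝ) * (nS : ℝ) ^ 2 * (nA : ℝ) ^ 2 * L ^ 4 * κ * K) =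
      H ^ 4 * q ^ 13 * σ ^ 2 * L ^ 2 * (sk * sK) := by
    have e₁ : (M : ℝ) ^ (13 / 2 : ℝ) = q ^ 26 := by
      rw [h.q_pow, ← Real.rpow_natCast q 4, ← Real.rpow_mul hq0.le, ← Real.rpow_natCast q 26]
      norm_num
    have e₂ : (H : ℝ) ^ 8 * (M : ℝ) ^ (13 / 2 : ℝ) * (nS : ℝ) ^ 2 * (nA : ℝ) ^ 2 * L ^ 4 * κ * K =
        (H ^ 4 * q ^ 13 * σ ^ 2 * L ^ 2 * (sk * sK)) ^ 2 := by
      rw [e₁, hσ2, mul_pow _ (sk * sK), mul_pow sk, hsk, hsK, Real.sq_sqrt (by linarith),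
        Real.sq_sqrt (by linarith)]
      ring
    rw [e₂, Real.sqrt_sq (by positivity)]
  -- Terms that do not contain `L` are compared with the bound through this inequality.
  have hLc : 1 ≤ L ^ 2 / c₀ ^ 2 := by
    rw [← div_pow]
    exact one_le_pow₀ ((one_le_div hc₀).2 h.le_L)
  have hι2 : √ι ≤ b * ell := (Real.sqrt_le_iff.2 ⟨by linarith, le_self_pow₀ hι two_ne_zero⟩ : √ι ≤ ι).trans hl₁
  have hSσ : √(4 * nS * ι) ≤ 2 * σ * (b * ell) := by
    rw [Real.sqrt_le_iff]
    refine ⟨by positivity, ?_⟩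
    have e₁ : (nS : ℝ) ≤ nS * nA := le_mul_of_one_le_right (by linarith) hA
    have e₂ : ι ≤ (b * ell) ^ 2 := hl₁.trans (le_self_pow₀ (hι.trans hl₁) two_ne_zero)
    calc 4 * nS * ι ≤ 4 * (nS * nA) * (b * ell) ^ 2 := by gcongr
      _ = _ := by rw [← hσ2]; ring
  -- The order of the bound for `H ^ 2 * γ * √κ`, which also dominates the reward and transition
  -- bonuses.
  set U : ℝ := H ^ 3 * q ^ 7 * σ * L ^ 2 * sk * ell ^ 2 with hU
  have hell2 : ell ≤ ell ^ 2 := le_self_pow₀ hell two_ne_zero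
  have hq7 : 1 ≤ q ^ 7 := one_le_pow₀ hq
  have hm : 2 * (√ι + H * √(4 * nS * ι)) + H * (5 * H + 80 * H * (g * sk)) ≤
      (6 * b / c₀ ^ 2 + 5 / c₀ ^ 2 + 80 * Cγ) * U := by
    have H3 : (H : ℝ) ≤ H ^ 3 := le_self_pow₀ hH (by norm_num)
    have H23 : (H : ℝ) ^ 2 ≤ H ^ 3 := pow_le_pow_right₀ hH (by norm_num)
    have e₁ : 2 * (√ι + H * √(4 * nS * ι)) ≤ 6 * b * (H * σ * ell) := by
      have a₁ : √ι ≤ H * σ * (b * ell) := hι2.trans (le_mul_of_one_le_left (by positivity)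
        (one_le_mul_of_one_le_of_one_le hH hσ1))
      have a₂ : H * √(4 * nS * ι) ≤ H * (2 * σ * (b * ell)) := by gcongr
      linarith
    have e₂ : H * σ * ell ≤ U / c₀ ^ 2 := by
      calc (H : ℝ) * σ * ell ≤ H ^ 3 * σ * ell ^ 2 := by gcongr
        _ = H ^ 3 * σ * ell ^ 2 * 1 := (mul_one _).symm
        _ ≤ H ^ 3 * σ * ell ^ 2 * (q ^ 7 * (L ^ 2 / c₀ ^ 2) * sk) := by
            gcongr
            exact one_le_mul_of_one_le_of_one_le (one_le_mul_of_one_le_of_one_le hq7 hLc) hsk1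
        _ = _ := by rw [hU]; ring
    have e₃ : (H : ℝ) ^ 2 ≤ U / c₀ ^ 2 := by
      calc (H : ℝ) ^ 2 ≤ H ^ 3 := H23
        _ ≤ H ^ 3 * (q ^ 7 * (L ^ 2 / c₀ ^ 2) * sk * σ * ell ^ 2) := by
            refine le_mul_of_one_le_right (by positivity) ?_
            refine one_le_mul_of_one_le_of_one_le (one_le_mul_of_one_le_of_one_le
              (one_le_mul_of_one_le_of_one_le (one_le_mul_of_one_le_of_one_le hq7 hLc) hsk1) hσ1)
              (one_le_pow₀ hell)
        _ = _ := by rw [hU]; ring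
    have e₄ : 80 * (H : ℝ) ^ 2 * (g * sk) ≤ 80 * Cγ * U := by
      calc 80 * (H : ℝ) ^ 2 * (g * sk) ≤
          80 * (H : ℝ) ^ 2 * (Cγ * (H * q ^ 7 * σ * L ^ 2 * ell ^ 2) * sk) := by gcongr
        _ = _ := by rw [hU]; ring
    calc _ = 2 * (√ι + H * √(4 * nS * ι)) + 5 * H ^ 2 + 80 * (H : ℝ) ^ 2 * (g * sk) := by ring
      _ ≤ 6 * b * (U / c₀ ^ 2) + 5 * (U / c₀ ^ 2) + 80 * Cγ * U := by
          have := mul_le_mul_of_nonneg_left e₂ (by positivity : 0 ≤ 6 * b)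
          linarith
      _ = _ := by ring
  have hs : 3 * sK + H * (3 * √(nS * (nA * (M + 1)) * K)) ≤ 9 * (H * σ * q ^ 2 * sK) := by
    have e₁ : √(nS * (nA * (M + 1)) * K) ≤ 2 * (σ * q ^ 2 * sK) := by
      rw [Real.sqrt_le_iff]
      refine ⟨by positivity, ?_⟩
      have : (2 * (σ * q ^ 2 * sK)) ^ 2 = nS * nA * (4 * q ^ 4) * K := by
        rw [mul_pow, mul_pow, mul_pow, hσ2, hsK, Real.sq_sqrt (by linarith)]
        ring
      rw [this, h.q_pow, ← mul_assoc (nS : ℝ)]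
      have := one_le_pow₀ hq (n := 4)
      gcongr
      linarith
    have e₂ : sK ≤ H * σ * q ^ 2 * sK := le_mul_of_one_le_left (by linarith)
      (one_le_mul_of_one_le_of_one_le (one_le_mul_of_one_le_of_one_le hH hσ1) (one_le_pow₀ hq))
    have e₃ := mul_le_mul_of_nonneg_left e₁ (by positivity : (0 : ℝ) ≤ H * 3)
    linarith
  have hlog : Real.log (4 / δ) ≤ b * ell := by
    refine le_trans (Real.log_le_log (by positivity) ?_) hl₂
    gcongr
    norm_num
  rw [hT]
  set T : ℝ := H ^ 4 * q ^ 13 * σ ^ 2 * L ^ 2 * (sk * sK) with hTdef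
  -- The product contains only `q ^ 9`, that is `M ^ (9 / 4)`; passing to the stated `q ^ 13` gives
  -- away a factor `M`.
  have hUT : U * (H * σ * q ^ 2 * sK) ≤ T * ell ^ 2 := by
    calc U * (H * σ * q ^ 2 * sK) = H ^ 4 * q ^ 9 * σ ^ 2 * L ^ 2 * (sk * sK) * ell ^ 2 := by
          rw [hU]; ring
      _ ≤ H ^ 4 * q ^ 13 * σ ^ 2 * L ^ 2 * (sk * sK) * ell ^ 2 := by
          gcongr
          norm_num
  have hHT : (H : ℝ) ^ 2 * ell ≤ T * ell ^ 2 / c₀ ^ 2 := by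
    have H24 : (H : ℝ) ^ 2 ≤ H ^ 4 := pow_le_pow_right₀ hH (by norm_num)
    calc (H : ℝ) ^ 2 * ell ≤ H ^ 4 * ell ^ 2 := by gcongr
      _ ≤ H ^ 4 * ell ^ 2 * (q ^ 13 * σ ^ 2 * (L ^ 2 / c₀ ^ 2) * (sk * sK)) := by
          refine le_mul_of_one_le_right (by positivity) ?_
          exact one_le_mul_of_one_le_of_one_le (one_le_mul_of_one_le_of_one_le
            (one_le_mul_of_one_le_of_one_le (one_le_pow₀ hq) (one_le_pow₀ hσ1)) hLc)
            (one_le_mul_of_one_le_of_one_le hsk1 hsK1)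
      _ = _ := by rw [hTdef]; ring
  have hprod := mul_le_mul hm hs (by positivity) (by positivity)
  have hend : 11 * (H : ℝ) ^ 2 * Real.log (4 / δ) ≤ 11 * b * (T * ell ^ 2 / c₀ ^ 2) := by
    calc 11 * (H : ℝ) ^ 2 * Real.log (4 / δ) ≤ 11 * (H : ℝ) ^ 2 * (b * ell) := by gcongr
      _ = 11 * b * (H ^ 2 * ell) := by ring
      _ ≤ _ := mul_le_mul_of_nonneg_left hHT (by positivity)
  have hprod' := mul_le_mul_of_nonneg_left hUT
    (by positivity : 0 ≤ (6 * b / c₀ ^ 2 + 5 / c₀ ^ 2 + 80 * Cγ) * 9)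
  have hfin : 2 * ((6 * b / c₀ ^ 2 + 5 / c₀ ^ 2 + 80 * Cγ) * 9 + 11 * b / c₀ ^ 2) * T * ell ^ 2 =
      2 * ((6 * b / c₀ ^ 2 + 5 / c₀ ^ 2 + 80 * Cγ) * 9 * (T * ell ^ 2) +
        11 * b * (T * ell ^ 2 / c₀ ^ 2)) := by ring
  rw [hfin]
  linarith

end Order

/-! ### The good event and the regret. -/

section Main

variable {S : Type*} {A : Type*} {M H : ℕ} [Fintype S] [Fintype A] [DecidableEq S]
  [DecidableEq A] [Nonempty S] [Nonempty A]

/-- With `x = δ / (8 * nS * nA * M * H * K)` the exponential equals `x ^ (2 * nS)`. The number of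
subsets is absorbed by `(2 * x ^ 2) ^ nS ≤ x / 4`, and the remaining factor `x` pays for the times,
triples and visit counts. -/
lemma trans_failure_le {nS nA M H K : ℕ} (hS : 1 ≤ nS) (hA : 1 ≤ nA) (hM : 1 ≤ M) (hH : 1 ≤ H)
    (hK : 1 ≤ K) {δ : ℝ} (hδ : 0 < δ) (hδ1 : δ < 1) :
    (H * (nS * (nA * (M + 1))) * (2 ^ nS * K) : ℝ) *
      Real.exp (-(4 * nS * Real.log (8 * nS * nA * M * H * K / δ) / 2)) ≤ δ / 4 := by
  have hSr : (1 : ℝ) ≤ nS := by exact_mod_cast hS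
  have hAr : (1 : ℝ) ≤ nA := by exact_mod_cast hA
  have hMr : (1 : ℝ) ≤ M := by exact_mod_cast hM
  have hHr : (1 : ℝ) ≤ H := by exact_mod_cast hH
  have hKr : (1 : ℝ) ≤ K := by exact_mod_cast hK
  set N : ℝ := nS * nA * M * H * K with hN
  have hN1 : 1 ≤ N := one_le_mul_of_one_le_of_one_le (one_le_mul_of_one_le_of_one_le
    (one_le_mul_of_one_le_of_one_le (one_le_mul_of_one_le_of_one_le hSr hAr) hMr) hHr) hKr
  set x : ℝ := δ / (8 * N) with hx
  have hx0 : 0 < x := by positivity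
  have hx1 : x ≤ 1 / 8 := by
    rw [hx, div_le_iff₀ (by positivity)]
    linarith
  have hlog : Real.log (8 * nS * nA * M * H * K / δ) = -Real.log x := by
    rw [← Real.log_inv, hx, inv_div, hN]
    congr 2
    ring
  have hexp : Real.exp (-(4 * nS * Real.log (8 * nS * nA * M * H * K / δ) / 2)) = (x ^ 2) ^ nS := by
    rw [hlog, ← pow_mul, ← Real.exp_log (pow_pos hx0 _), Real.log_pow]
    congr 1
    push_cast
    ring
  rw [hexp]
  have h₁ : (2 : ℝ) ^ nS * (x ^ 2) ^ nS ≤ x / 4 := by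
    rw [← mul_pow]
    have e₁ : 2 * x ^ 2 ≤ x / 4 := by nlinarith
    exact (pow_le_pow_left₀ (by positivity) e₁ nS).trans
      (pow_le_of_le_one (by positivity) (by linarith) (by omega))
  have h₂ : (H * (nS * (nA * (M + 1))) * K : ℝ) ≤ 2 * N := by
    have : (H * (nS * (nA * (M + 1))) * K : ℝ) ≤ H * (nS * (nA * (2 * M))) * K := by
      gcongr
      linarith
    refine this.trans (le_of_eq ?_)
    rw [hN]
    ring
  calc (H * (nS * (nA * (M + 1))) * (2 ^ nS * K) : ℝ) * (x ^ 2) ^ nS =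
      H * (nS * (nA * (M + 1))) * K * (2 ^ nS * (x ^ 2) ^ nS) := by ring
    _ ≤ 2 * N * (x / 4) := mul_le_mul h₂ h₁ (by positivity) (by positivity)
    _ = δ / 16 := by
      rw [hx]
      field_simp
      norm_num
    _ ≤ δ / 4 := by linarith

/-- With high probability the regret is bounded by twice the sum of the planning errors, up to a
constant. -/
lemma Model.prob_lt_regret_le (m : Model S A M H) {K : ℕ} (hM : 1 ≤ M) (hH : 1 ≤ H) (hK : 1 ≤ K)
    {b : Feature S A M H} {L lam δ : ℝ} (hL : 0 ≤ L) (hlam : 0 < lam) (hδ : 0 < δ) (hδ1 : δ < 1)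
    (hf : m.f ∈ rectSet b) (hb : l2norm b ≤ L)
    (init : (k : ℕ) → (Fin k → Episode S A M H) → PMF S) (ℓ : Learner S A M H)
    (hℓ : m.IsTractableLDCUCB K L lam δ b ℓ)
    (hι : 1 ≤ Real.log (8 * Fintype.card S * Fintype.card A * M * H * K / δ)) :
    prob (m.runLaw init ℓ K) {ω | 2 * (∑ k : Fin K, m.planError K L lam δ k
      (firstEpisodes ω k k.2.le) (ω k) + 11 * H ^ 2 * Real.log (4 / δ)) < m.regret ℓ ω} ≤ δ := by
  have hHr : (1 : ℝ) ≤ H := by exact_mod_cast hH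
  obtain ⟨fhat, hfhat⟩ := hℓ
  set nS := Fintype.card S with hnS
  set nA := Fintype.card A with hnA
  have hS : 1 ≤ nS := Fintype.card_pos
  have hA : 1 ≤ nA := Fintype.card_pos
  set ι := Real.log (8 * nS * nA * M * H * K / δ) with hιdef
  -- The family of grids is fixed in advance from `K` and serves all episodes.
  obtain ⟨J, N, hJ, hN⟩ := exists_grid_size (L := L) hlam
    (1 + (K : ℝ) * H / (M * (M + 1) * nS * nA * H * lam))
  set E₁ : Set (Fin K → Episode S A M H) := {ω | ∃ k, ∃ hk : k ≤ K,
    ¬ m.FeatAccurate lam (Real.log (2 / δ)) J N (firstEpisodes ω k hk)} with hE₁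
  set E₂ : Set (Fin K → Episode S A M H) := {ω | ∃ k, ∃ hk : k ≤ K,
    ¬ m.TransAccurate (4 * nS * ι) (firstEpisodes ω k hk)} with hE₂
  set E₃ : Set (Fin K → Episode S A M H) := {ω | 2 * (∑ j : Fin K, m.planError K L lam δ j
      (firstEpisodes ω j j.2.le) (ω j) + 11 * H ^ 2 * Real.log (4 / δ)) <
      ∑ j : Fin K, expect (m.episodeLaw (ℓ.policy j (firstEpisodes ω j j.2.le)) ((ω j).state 0))
        (m.planError K L lam δ j (firstEpisodes ω j j.2.le))} with hE₃
  have p₁ : prob (m.runLaw init ℓ K) E₁ ≤ δ / 2 := by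
    refine (m.prob_not_featAccurate_le init ℓ K lam (Real.log (2 / δ)) J N).trans (le_of_eq ?_)
    rw [← Real.log_inv, Real.exp_log (by positivity), inv_div]
  have p₂ : prob (m.runLaw init ℓ K) E₂ ≤ δ / 4 :=
    (m.prob_not_transAccurate_le init ℓ K
      (by have : (0 : ℝ) < nS := by exact_mod_cast hS
          positivity)).trans (trans_failure_le hS hA hM hH hK hδ hδ1)
  have p₃ : prob (m.runLaw init ℓ K) E₃ ≤ δ / 4 := by
    refine (m.prob_lt_sum_expect_le init ℓ K (m.planError K L lam δ) (by positivity)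
      (fun k past e => episodeError_nonneg (fun h y =>
        mul_nonneg zero_le_two (bonus_nonneg _ _ _ _ _ _ _))
        (fun c => m.featBonus_nonneg hL hlam hδ hδ1 _ _) e)
      (fun k past e => episodeError_le hH
        (fun h y => mul_le_mul_of_nonneg_left (bonus_le _ _ _ _ _ _ _) zero_le_two) e)
      (Real.log (4 / δ))).trans (le_of_eq ?_)
    rw [← Real.log_inv, Real.exp_log (by positivity), inv_div]
  have hsub : {ω | 2 * (∑ k : Fin K, m.planError K L lam δ k
      (firstEpisodes ω k k.2.le) (ω k) + 11 * H ^ 2 * Real.log (4 / δ)) < m.regret ℓ ω} ⊆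
      E₁ ∪ E₂ ∪ E₃ := by
    intro ω hω
    by_contra hnot
    simp only [Set.mem_union, not_or] at hnot
    obtain ⟨⟨n₁, n₂⟩, n₃⟩ := hnot
    have g₁ : ∀ k, ∀ hk : k ≤ K, m.FeatAccurate lam (Real.log (2 / δ)) J N (firstEpisodes ω k hk) :=
      fun k hk => by_contra fun h => n₁ ⟨k, hk, h⟩
    have g₂ : ∀ k, ∀ hk : k ≤ K, m.TransAccurate (4 * nS * ι) (firstEpisodes ω k hk) :=
      fun k hk => by_contra fun h => n₂ ⟨k, hk, h⟩
    rw [hE₃, Set.mem_ofPred_eq] at n₃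
    rw [Set.mem_ofPred_eq] at hω
    -- With accurate estimates each summand of the regret is at most the conditional expectation of
    -- the planning error, so a larger regret would force the third failure event.
    refine n₃ (hω.trans_le (Finset.sum_le_sum fun k _ => ?_))
    have hk := k.2.le
    obtain ⟨hmem, hmax, hgreedy⟩ := hfhat k (firstEpisodes ω k hk)
    have hJk : 1 + ((k : ℕ) : ℝ) * H / (M * (M + 1) * nS * nA * H * lam) ≤ 4 ^ J := by
      refine le_trans ?_ hJ
      have : ((k : ℕ) : ℝ) ≤ K := by exact_mod_cast hk
      gcongr
    have hvalid := Model.isValid_planInput (K := K) (g₁ k hk) (g₂ k hk) hM hH hlam hL hδ hδ1 hf hb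
      hmem hmax hJk hN hι
    exact hvalid.optimalValue_sub_le hM hH _ hgreedy ((ω k).state 0)
  calc _ ≤ prob (m.runLaw init ℓ K) (E₁ ∪ E₂ ∪ E₃) := prob_mono hsub
    _ ≤ prob (m.runLaw init ℓ K) E₁ + prob (m.runLaw init ℓ K) E₂ + prob (m.runLaw init ℓ K) E₃ :=
        (prob_union_le _ _ _).trans (add_le_add_left (prob_union_le _ _ _) _)
    _ ≤ δ / 2 + δ / 4 + δ / 4 := add_le_add (add_le_add p₁ p₂) p₃
    _ = δ := by ring

end Main

end LogDCMDP

theorem mainTheorem2 (c₀ c₁ c₂ : ℝ) (hc₀ : 0 < c₀) (hc₁ : 0 < c₁) (hc₂ : c₁ ≤ c₂) :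
    ∃ (C : ℝ) (p : ℕ), 0 < C ∧
      ∀ (S : Type*) (A : Type*) [Fintype S] [Fintype A] [DecidableEq S] [DecidableEq A]
        [Nonempty S] [Nonempty A] (M H K : ℕ) (_ : 1 ≤ M) (_ : 1 ≤ H) (_ : 1 ≤ K)
        (m : Model S A M H) (b : Feature S A M H) (L lam δ : ℝ)
        (_ : c₀ ≤ L) (_ : m.f ∈ rectSet b) (_ : l2norm b ≤ L)
        (_ : c₁ * (H * (M : ℝ) ^ (5 / 2 : ℝ) * Fintype.card S * Fintype.card A / L) ≤ lam)
        (_ : lam ≤ c₂ * (H * (M : ℝ) ^ (5 / 2 : ℝ) * Fintype.card S * Fintype.card A / L))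
        (_ : 0 < δ) (_ : δ < 1)
        (init : (k : ℕ) → (Fin k → Episode S A M H) → PMF S) (ℓ : Learner S A M H)
        (_ : m.IsTractableLDCUCB K L lam δ b ℓ),
        ENNReal.ofReal (1 - δ) ≤ (m.runLaw init ℓ K).toOuterMeasure
          {ω | m.regret ℓ ω ≤
            C * √((H : ℝ) ^ 8 * (M : ℝ) ^ (13 / 2 : ℝ) * (Fintype.card S : ℝ) ^ 2 *
                (Fintype.card A : ℝ) ^ 2 * L ^ 4 * m.kappa * K) *
              Real.log (3 + Fintype.card S * Fintype.card A * M * H * K * L / δ) ^ p} := by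
  obtain ⟨C, hC, hbound⟩ := exists_regret_bound_le (c₂ := c₂) hc₀ hc₁
  refine ⟨C, 2, hC, ?_⟩
  intro S A _ _ _ _ _ _ M H K hM hH hK m b L lam δ hL hf hb hlow hup hδ hδ1 init ℓ hℓ
  have hMr : (0 : ℝ) ≤ M := Nat.cast_nonneg M
  have hM1 : (1 : ℝ) ≤ M := by exact_mod_cast hM
  -- In terms of the fourth root of `M`, all the fractional powers of `M` that occur become integer
  -- powers.
  have hq : ((M : ℝ) ^ (1 / 4 : ℝ)) ^ 4 = M := by
    rw [← Real.rpow_natCast, ← Real.rpow_mul hMr]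
    norm_num
  have hq' : (M : ℝ) ^ (5 / 2 : ℝ) = ((M : ℝ) ^ (1 / 4 : ℝ)) ^ 10 := by
    rw [← Real.rpow_natCast, ← Real.rpow_mul hMr]
    norm_num
  rw [hq'] at hlow hup
  have hpar : ParamBounds c₀ c₁ c₂ (Fintype.card S) (Fintype.card A) M H K
      ((M : ℝ) ^ (1 / 4 : ℝ)) L lam δ :=
    ⟨Fintype.card_pos, Fintype.card_pos, hM, hH, hK, Real.one_le_rpow hM1 (by norm_num), hq.symm,
      hL, hlow, hup, hδ, hδ1⟩
  have hL0 : 0 ≤ L := hc₀.le.trans hL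
  have hlam := hpar.lam_pos hc₀ hc₁
  have hι : 1 ≤ Real.log (8 * Fintype.card S * Fintype.card A * M * H * K / δ) := by
    have h₁ : 1 ≤ Fintype.card S * Fintype.card A * M * H * K := by
      have hS : 0 < Fintype.card S := Fintype.card_pos
      have hA : 0 < Fintype.card A := Fintype.card_pos
      exact Nat.succ_le_of_lt (by positivity)
    have h₂ : (1 : ℝ) ≤ Fintype.card S * Fintype.card A * M * H * K := by exact_mod_cast h₁
    rw [Real.le_log_iff_exp_le (div_pos (by linarith) hδ), le_div_iff₀ hδ]
    nlinarith [Real.exp_one_lt_three, Real.exp_pos 1]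
  refine ofReal_one_sub_le_toOuterMeasure (le_trans (prob_mono ?_)
    (m.prob_lt_regret_le hM hH hK hL0 hlam hδ hδ1 hf hb init ℓ hℓ hι))
  intro ω hω
  have h₁ := m.sum_planError_le hM hH hL0 hlam hδ hδ1 ω
  have h₂ := hbound hpar (m.one_le_kappa hM hH) hι
  refine lt_of_le_of_lt (le_trans ?_ h₂) (not_le.1 hω)
  linarith
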